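/- Notation. For $X\in\mathfrak{sl}(n,\mathbb C)$ let $X^*=\overline X^{T}$, $|X|^2=\operatorname{tr}(XX^*)$, and let $\mathcal O_X$ be the orbit of $X$ under conjugation by $SL(n,\mathbb C)$. Let $Z=\{X\in\mathfrak{sl}(n,\mathbb C): |X|^4-|\operatorname{tr}(X^2)|^2=0\}$ and $$K(B)=\frac{|[B,B^*]|^2}{|B|^4-|\operatorname{tr}(B^2)|^2},\qquad B\in\mathfrak{sl}(n,\mathbb C)\setminus Z .$$ Critical points of $K$ on $\mathcal O_A\setminus Z$ are those of the restriction of $K$ to the orbit. A tuple $(\lambda_1,\dots,\lambda_n)\in\mathbb C^n$ is uni-real if it is a complex multiple of a real tuple. Put $\Lambda_k=(k-1,k-3,\dots,3-k,1-k)$ ($\Lambda_0$ is empty). In a partition $\pi=(n_1,\dots,n_s)$ of $n$ zero parts are ignored and the order of the parts is irrelevant; $\pi$ is even if all its nonzero parts have the same parity, and odd otherwise. Put $C_\pi=12/\sum_p n_p(n_p^2-1)$. Let $e_k$ be the $k\times k$ matrix with superdiagonal entries $\sqrt{i(k-i)}$, $1\le i\le k-1$, and zeros elsewhere, let $\tilde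 e_k=e_k^T$ and $x_k=\operatorname{diag}(k-1,k-3,\dots,1-k)$; let $j_k:\mathfrak{sl}(2,\mathbb C)\to\mathfrak{sl}(k,\mathbb C)$ be the representation sending the standard basis $e,\tilde e,x$ of $\mathfrak{sl}(2,\mathbb C)$ to $e_k,\tilde e_k,x_k$, and $j_\pi=\operatorname{diag}(j_{n_1},\dots,j_{n_s})$. Write $S_\pi\subset\mathcal O_A$ for the set of elements of $\mathcal O_A\setminus Z$ that are $SU(n)$-conjugate to an element of $j_\pi(\mathfrak{sl}(2,\mathbb C))$. Eigenvalues are listed with multiplicity, in any order. **Theorem.** Let $A\in\mathfrak{sl}(n,\mathbb C)$ be not a scalar matrix, and consider $K$ on $\mathcal O_A\setminus Z$. 1. Suppose $A$ is diagonalizable and its eigenvalues $(\lambda_1,\dots,\lambda_n)$ are not uni-real. Then $K$ has minimum $0$, achieved exactly on the $SU(n)$-orbit of $\operatorname{diag}(\lambda_1,\dots,\lambda_n)$, and $K$ has no other critical points. 2. Suppose $A$ is diagonalizable with eigenvalues $c(\Lambda_{2m_1+1},\dots,\Lambda_{2m_s+1})$, $c\in\mathbb C^*$, $m_i\ge 0$,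 where $\pi=(2m_1+1,\dots,2m_s+1)$ is a partition of $n$. Then $\pi'=(m_1,m_1+1,\dots,m_s,m_s+1)$ is a partition of $n$, and the eigenvalues are also $2c(\Lambda_{m_1},\Lambda_{m_1+1},\dots,\Lambda_{m_s},\Lambda_{m_s+1})$. The function $K$ has minimum $C_\pi$, achieved exactly on $S_\pi$. Its other critical points are exactly the elements of $S_{\pi'}$, which is non-empty, and $K=C_{\pi'}=4C_\pi$ there. 3. Suppose $A$ is diagonalizable with eigenvalues $c(\Lambda_{2m_1},\dots,\Lambda_{2m_s})$, $c\in\mathbb C^*$, where $\pi=(2m_1,\dots,2m_s)$ is a partition of $n$. Then $K$ has minimum $C_\pi$, achieved exactly on $S_\pi$, and $K$ has no other critical points. 4. Suppose $A$ is diagonalizable with eigenvalues $c(\Lambda_{n_1},\dots,\Lambda_{n_s})$, $c\in\mathbb C^*$, where $\pi=(n_1,\dots,n_s)$ is an odd partition of $n$ that is not of the form $(m_1,m_1+1,\dots,m_l,m_l+1)$ with integers $m_i\ge 0$. Then $K$ has infimum $C_\pi/4$, which is not achieved. The set of critical points of $K$ is $S_\pi$, which is non-empty, and $K=C_\pi$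 there. 5. Suppose $A$ is diagonalizable, its eigenvalues $(\lambda_1,\dots,\lambda_n)$ are uni-real, and they are not of the form $c(\Lambda_{n_1},\dots,\Lambda_{n_s})$ for any $c\in\mathbb C^*$ and any partition $(n_1,\dots,n_s)$ of $n$. Then $K$ has infimum $$\frac{\min_{\lambda_i\ne\lambda_j}|\lambda_i-\lambda_j|^2}{\sum_{i=1}^n|\lambda_i|^2},$$ which is not achieved, and $K$ has no critical points. 6. Suppose $A$ is nilpotent, and let $\pi$ be the partition of $n$ formed by the sizes of its Jordan blocks. Then $K$ has minimum $C_\pi$, achieved exactly on $S_\pi$, and $K$ has no other critical points. 7. Suppose $A$ is neither diagonalizable nor nilpotent. Then $K$ has infimum $0$ and no critical points. -/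

import Mathlib

open Matrix

namespace OrbitK

noncomputable section

/-- The squared norm `|X|² = tr(X X*)`. -/
def normSq {n : ℕ} (X : Matrix (Fin n) (Fin n) ℂ) : ℝ := (trace (X * Xᴴ)).re

/-- The function `K(B) = |[B, B*]|² / (|B|⁴ - |tr(B²)|²)`; it is only ever used outside `Z`. -/
def K {n : ℕ} (B : Matrix (Fin n) (Fin n) ℂ) : ℝ :=
  normSq (B * Bᴴ - Bᴴ * B) / (normSq B ^ 2 - ‖trace (B * B)‖ ^ 2)

/-- The set `Z` of trace-free matrices on which the denominator of `K` vanishes. -/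
def Z (n : ℕ) : Set (Matrix (Fin n) (Fin n) ℂ) :=
  {B | trace B = 0 ∧ normSq B ^ 2 - ‖trace (B * B)‖ ^ 2 = 0}

/-- The `SL(n, ℂ)`-adjoint orbit of `A`. -/
def slOrbit {n : ℕ} (A : Matrix (Fin n) (Fin n) ℂ) : Set (Matrix (Fin n) (Fin n) ℂ) :=
  {B | ∃ g : Matrix.SpecialLinearGroup (Fin n) ℂ,
    B = (g : Matrix (Fin n) (Fin n) ℂ) * A * ((g⁻¹ : Matrix.SpecialLinearGroup (Fin n) ℂ) :
      Matrix (Fin n) (Fin n) ℂ)}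

/-- The union of the `SU(n)`-adjoint orbits of the elements of `S`. -/
def suOrbit {n : ℕ} (S : Set (Matrix (Fin n) (Fin n) ℂ)) : Set (Matrix (Fin n) (Fin n) ℂ) :=
  {B | ∃ U ∈ Matrix.specialUnitaryGroup (Fin n) ℂ, ∃ M ∈ S, B = U * M * star U}

/-- `B` is a critical point of `K` restricted to the adjoint orbit through `B`: the derivative of
`K` along `exp(tM) B exp(-tM)` at `t = 0` vanishes for all `M` in `sl(n, ℂ)`. The velocities
`[M, B]` of these curves fill the tangent space at `B` of the orbit. -/
def IsCriticalPoint {n : ℕ} (B : Matrix (Fin n) (Fin n) ℂ) : Prop :=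
  ∀ M : Matrix (Fin n) (Fin n) ℂ, trace M = 0 →
    HasDerivAt (fun t : ℝ =>
      K (NormedSpace.exp ((t : ℂ) • M) * B * NormedSpace.exp (-((t : ℂ) • M)))) 0 0

/-- The set of critical points of `K` on `O_A \ Z`. -/
def criticalSet {n : ℕ} (A : Matrix (Fin n) (Fin n) ℂ) : Set (Matrix (Fin n) (Fin n) ℂ) :=
  {B | B ∈ slOrbit A \ Z n ∧ IsCriticalPoint B}

/-- `K` on `O_A \ Z` has infimum `v`. -/
def HasInfimum {n : ℕ} (A : Matrix (Fin n) (Fin n) ℂ) (v : ℝ) : Prop :=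
  IsGLB (K '' (slOrbit A \ Z n)) v

/-- `K` achieves its minimum on `O_A \ Z` somewhere. -/
def AttainsMinimum {n : ℕ} (A : Matrix (Fin n) (Fin n) ℂ) : Prop :=
  ∃ B ∈ slOrbit A \ Z n, IsMinOn K (slOrbit A \ Z n) B

/-- `K` on `O_A \ Z` has minimum `v`, and `S` is exactly the set where it is achieved. -/
def HasMinimumExactlyOn {n : ℕ} (A : Matrix (Fin n) (Fin n) ℂ) (v : ℝ)
    (S : Set (Matrix (Fin n) (Fin n) ℂ)) : Prop :=
  IsLeast (K '' (slOrbit A \ Z n)) v ∧ {B | B ∈ slOrbit A \ Z n ∧ K B = v} = S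

/-- `A` is diagonalizable. -/
def IsDiagonalizable {n : ℕ} (A : Matrix (Fin n) (Fin n) ℂ) : Prop :=
  ∃ (P : Matrix (Fin n) (Fin n) ℂ) (d : Fin n → ℂ), IsUnit P.det ∧ A = P * diagonal d * P⁻¹

/-- `lam` lists the eigenvalues of `A` with algebraic multiplicity. -/
def HasEigenvalues {n : ℕ} (A : Matrix (Fin n) (Fin n) ℂ) (lam : Fin n → ℂ) : Prop :=
  A.charpoly.roots = Finset.univ.val.map lam

/-- A tuple of complex numbers is uni-real if it is a complex multiple of a real tuple. -/
def UniReal {n : ℕ} (lam : Fin n → ℂ) : Prop :=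
  ∃ (c : ℂ) (r : Fin n → ℝ), ∀ i, lam i = c * (r i : ℂ)

/-- `Λ_k = (k - 1, k - 3, …, 3 - k, 1 - k)`. -/
def Lam (k : ℕ) : Multiset ℤ := (Multiset.range k).map fun i => (k : ℤ) - 1 - 2 * (i : ℤ)

/-- The eigenvalues of `A`, with algebraic multiplicity, are `c (Λ_{n_1}, …, Λ_{n_s})`, where
`π = (n_1, …, n_s)`. -/
def EigenvaluesOfForm {n : ℕ} (A : Matrix (Fin n) (Fin n) ℂ) (c : ℂ) (π : n.Partition) : Prop :=
  A.charpoly.roots = (π.parts.bind Lam).map fun a : ℤ => c * (a : ℂ)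

/-- A partition is even if all its (nonzero) parts have the same parity, and odd otherwise. -/
def IsEvenPartition {n : ℕ} (π : n.Partition) : Prop :=
  ∀ p ∈ π.parts, ∀ q ∈ π.parts, p % 2 = q % 2

/-- The numbers `m_1, m_1 + 1, …, m_l, m_l + 1`, zeros omitted. -/
def consecutivePairs (m : Multiset ℕ) : Multiset ℕ :=
  (m + m.map (· + 1)).filter (· ≠ 0)

/-- `C_π = 12 / ∑ n_p (n_p² - 1)`. -/
def C {n : ℕ} (π : n.Partition) : ℝ :=
  12 / (π.parts.map fun p : ℕ => (p : ℝ) * ((p : ℝ) ^ 2 - 1)).sum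

/-- The parts of `π` in non-increasing order. -/
def partList {n : ℕ} (π : n.Partition) : List ℕ := π.parts.sort (· ≥ ·)

theorem sum_partList {n : ℕ} (π : n.Partition) :
    ∑ i : Fin (partList π).length, (partList π).get i = n := by
  have h : (partList π).sum = n := by
    rw [← Multiset.sum_coe, partList, Multiset.sort_eq, π.parts_sum]
  simpa [Fin.sum_univ_getElem] using h

/-- The indices of the consecutive diagonal blocks of sizes `n_1, …, n_s`. -/
def blockEquiv {n : ℕ} (π : n.Partition) :
    (Σ i : Fin (partList π).length, Fin ((partList π).get i)) ≃ Fin n :=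
  finSigmaFinEquiv.trans (finCongr (sum_partList π))

/-- The block diagonal matrix `diag(f_{n_1}, …, f_{n_s})` for `π = (n_1, …, n_s)`. -/
def diagBlocks {n : ℕ} (π : n.Partition) (f : ∀ k : ℕ, Matrix (Fin k) (Fin k) ℂ) :
    Matrix (Fin n) (Fin n) ℂ :=
  Matrix.reindex (blockEquiv π) (blockEquiv π)
    (Matrix.blockDiagonal' fun i : Fin (partList π).length => f ((partList π).get i))

/-- The matrix `e_k`, with entries `√(i (k - i))`, `1 ≤ i ≤ k - 1`, above the diagonal. -/
def eMat (k : ℕ) : Matrix (Fin k) (Fin k) ℂ :=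
  Matrix.of fun i j => if (i : ℕ) + 1 = (j : ℕ) then
    ((Real.sqrt (((i : ℕ) + 1 : ℝ) * ((k : ℝ) - ((i : ℕ) + 1 : ℝ))) : ℝ) : ℂ) else 0

/-- The diagonal matrix `x_k = diag(k - 1, k - 3, …, 1 - k)`. -/
def xMat (k : ℕ) : Matrix (Fin k) (Fin k) ℂ :=
  Matrix.diagonal fun i => (k : ℂ) - 1 - 2 * ((i : ℕ) : ℂ)

/-- The irreducible representation `j_k : sl(2, ℂ) → sl(k, ℂ)` in its standard basis: it sends
`a e + b ẽ + c x`, that is the matrix with rows `(c, a)` and `(b, -c)`, to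
`a e_k + b ẽ_k + c x_k`. -/
def jRep (M : Matrix (Fin 2) (Fin 2) ℂ) (k : ℕ) : Matrix (Fin k) (Fin k) ℂ :=
  M 0 1 • eMat k + M 1 0 • (eMat k)ᵀ + M 0 0 • xMat k

/-- The standard `sl(2, ℂ)` of type `π`: the image of `j_π = diag(j_{n_1}, …, j_{n_s})`. -/
def stdSl2 {n : ℕ} (π : n.Partition) : Set (Matrix (Fin n) (Fin n) ℂ) :=
  {B | ∃ M : Matrix (Fin 2) (Fin 2) ℂ, trace M = 0 ∧ B = diagBlocks π (jRep M)}

/-- The nilpotent Jordan block of size `k`. -/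
def jordanBlock (k : ℕ) : Matrix (Fin k) (Fin k) ℂ :=
  Matrix.of fun i j => if (i : ℕ) = (j : ℕ) + 1 then 1 else 0

/-- `A` is nilpotent and the block sizes of its Jordan normal form are the parts of `π`. -/
def HasJordanType {n : ℕ} (A : Matrix (Fin n) (Fin n) ℂ) (π : n.Partition) : Prop :=
  ∃ P : Matrix (Fin n) (Fin n) ℂ, IsUnit P.det ∧ A = P * diagBlocks π jordanBlock * P⁻¹

end

end OrbitK

open OrbitK

namespace OrbitK

/-! ### The Frobenius norm and the function `K` -/

section NormSq

variable {n : ℕ}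

/-! Write H = [B, B*] (`mom B`), q = |B|², τ = tr(B²), and use the inner product tr(XY*). The
denominator q² - |τ|² of K is the Gram determinant of B and B*. Along an orbit τ is constant, so
only q and |H|² vary, and the derivative of K in the direction M is a positive multiple of Re tr(M
G) with G = [B, [B*, H]] - K q H (`hasDerivAt_K`).

Critical points. Put C = [H, B]. Always tr(CB*) = |H|² and tr(CB) = 0, which fixes the projection of
C to span(B, B*); its squared norm is K q |H|². If G = 0, then |C|² is also K q |H|², so C lies in
that span (`mom_bracket_eq_of_gradK`). When H ≠ 0, ad H therefore preserves span(B, B*), with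
eigenvalues ±κ, κ > 0, and a scaled κ-eigenvector E satisfies [[E, E*], E] = 2E; thus B lies in a
*-closed sl(2) (`exists_triple_of_gradK`). The representation theory of such an sl(2), done with
orthonormal bases, makes E unitarily similar to a standard block matrix (`IsTriple.exists_usim`).
Conversely every element of such an sl(2) outside Z is critical with K = 2/|E|²
(`IsTriple.K_tripleComb`). So a critical point is either normal or of standard type.

Which partitions occur. A nonzero element of the sl(2) of E is similar to a multiple of [E, E*] or
to E itself (`IsTriple.sim_tripleComb`), so a standard critical point of type π forces the spectrum
cΛ_π or the Jordan type π. The multiset Λ_π determines π. Only the scale c is ambiguous, and a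
parity argument leaves, besides signs, just the factor 2 coming from Λ_{2m+1} = 2(Λ_m, Λ_{m+1}).
Normal critical points exist only on diagonalizable orbits that are not uni-real, where they are the
zeros of K; the normal points of a uni-real orbit lie in Z.

Extremal values. Up to a unitary change of basis, an element of an orbit is an upper triangular
conjugate of a model matrix in a basis sorted by a real grading, so it differs from the model only
by terms raising the grade. Cauchy–Schwarz for H against a diagonal matrix, or a corrected one, then
gives the sharp lower bounds `C_le_K_of_sim` and `le_K_of_sim_diagonal`. They are approached along
diag(r) + tE_ij as t tends to 0 (`exists_K_eq_of_ne`); in the mixed case, shrinking the nilpotent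
part sends K to 0 (`exists_K_le_of_commute`). A minimum point is critical, so the equality cases,
and the failure to attain an infimum, are read off from the critical set. -/

theorem normSq_eq_sum (X : Matrix (Fin n) (Fin n) ℂ) : normSq X = ∑ i, ∑ j, ‖X i j‖ ^ 2 := by
  simp [normSq, trace, mul_apply, Complex.mul_conj, Complex.normSq_eq_norm_sq,
    -Complex.ofReal_pow]

theorem normSq_nonneg (X : Matrix (Fin n) (Fin n) ℂ) : 0 ≤ normSq X := by
  rw [normSq_eq_sum]; positivity

theorem normSq_eq_zero {X : Matrix (Fin n) (Fin n) ℂ} : normSq X = 0 ↔ X = 0 := by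
  rw [normSq_eq_sum, Finset.sum_eq_zero_iff_of_nonneg (fun _ _ => by positivity)]
  constructor
  · intro h
    ext i j
    have := (Finset.sum_eq_zero_iff_of_nonneg (fun _ _ => by positivity)).1 (h i (Finset.mem_univ _))
      j (Finset.mem_univ _)
    simpa using this
  · rintro rfl; simp

theorem normSq_zero : normSq (0 : Matrix (Fin n) (Fin n) ℂ) = 0 := normSq_eq_zero.2 rfl

theorem normSq_pos {X : Matrix (Fin n) (Fin n) ℂ} (h : X ≠ 0) : 0 < normSq X :=
  lt_of_le_of_ne (normSq_nonneg X) fun h' => h (normSq_eq_zero.1 h'.symm)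

theorem trace_mul_conjTranspose_self (X : Matrix (Fin n) (Fin n) ℂ) :
    trace (X * Xᴴ) = (normSq X : ℂ) := by
  rw [normSq_eq_sum]
  simp [trace, mul_apply, Complex.mul_conj, Complex.normSq_eq_norm_sq]

theorem trace_conjTranspose_mul_self (X : Matrix (Fin n) (Fin n) ℂ) :
    trace (Xᴴ * X) = (normSq X : ℂ) := by
  rw [trace_mul_comm, trace_mul_conjTranspose_self]

theorem normSq_smul (c : ℂ) (X : Matrix (Fin n) (Fin n) ℂ) :
    normSq (c • X) = ‖c‖ ^ 2 * normSq X := by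
  simp [normSq_eq_sum, Finset.mul_sum, mul_pow]

theorem normSq_neg (X : Matrix (Fin n) (Fin n) ℂ) : normSq (-X) = normSq X := by
  simp [normSq_eq_sum]

theorem normSq_conjTranspose (X : Matrix (Fin n) (Fin n) ℂ) : normSq Xᴴ = normSq X := by
  rw [normSq, conjTranspose_conjTranspose, trace_mul_comm, normSq]

theorem trace_conjTranspose_mul (X Y : Matrix (Fin n) (Fin n) ℂ) :
    trace (Y * Xᴴ) = star (trace (X * Yᴴ)) := by
  rw [← trace_conjTranspose, conjTranspose_mul, conjTranspose_conjTranspose]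

theorem normSq_add (X Y : Matrix (Fin n) (Fin n) ℂ) :
    normSq (X + Y) = normSq X + normSq Y + 2 * (trace (X * Yᴴ)).re := by
  simp only [normSq, conjTranspose_add, add_mul, mul_add, trace_add, Complex.add_re]
  rw [trace_conjTranspose_mul X Y]
  simp only [RCLike.star_def, Complex.conj_re]
  ring

theorem norm_trace_mul_conjTranspose_sq_le (X Y : Matrix (Fin n) (Fin n) ℂ) :
    ‖trace (X * Yᴴ)‖ ^ 2 ≤ normSq X * normSq Y := by
  have h := norm_inner_le_norm (𝕜 := ℂ) (WithLp.toLp 2 fun p : Fin n × Fin n => Y p.1 p.2)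
    (WithLp.toLp 2 fun p : Fin n × Fin n => X p.1 p.2)
  have h1 : ∀ X : Matrix (Fin n) (Fin n) ℂ,
      ‖(WithLp.toLp 2 fun p : Fin n × Fin n => X p.1 p.2)‖ ^ 2 = normSq X := by
    intro X
    rw [EuclideanSpace.norm_sq_eq, Fintype.sum_prod_type, normSq_eq_sum]
  have h2 : inner ℂ (WithLp.toLp 2 fun p : Fin n × Fin n => Y p.1 p.2)
      (WithLp.toLp 2 fun p : Fin n × Fin n => X p.1 p.2) = trace (X * Yᴴ) := by
    simp [PiLp.inner_apply, Fintype.sum_prod_type, trace, mul_apply]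
  rw [h2] at h
  calc _ ≤ _ := pow_le_pow_left₀ (norm_nonneg _) h 2
    _ = _ := by rw [mul_pow, h1, h1, mul_comm]

theorem norm_trace_mul_self_le (X : Matrix (Fin n) (Fin n) ℂ) : ‖trace (X * X)‖ ≤ normSq X := by
  have h := norm_trace_mul_conjTranspose_sq_le X Xᴴ
  rw [conjTranspose_conjTranspose, normSq_conjTranspose, ← sq (normSq X)] at h
  exact (pow_le_pow_iff_left₀ (norm_nonneg _) (normSq_nonneg _) two_ne_zero).1 h

theorem denom_nonneg (X : Matrix (Fin n) (Fin n) ℂ) :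
    0 ≤ normSq X ^ 2 - ‖trace (X * X)‖ ^ 2 :=
  sub_nonneg.2 (pow_le_pow_left₀ (norm_nonneg _) (norm_trace_mul_self_le X) 2)

theorem K_nonneg (X : Matrix (Fin n) (Fin n) ℂ) : 0 ≤ K X :=
  div_nonneg (normSq_nonneg _) (denom_nonneg X)

/-- Numerator and denominator both scale by |c|⁴. This is what reduces uni-real spectra to real
ones. -/
theorem K_smul {c : ℂ} (hc : c ≠ 0) (X : Matrix (Fin n) (Fin n) ℂ) : K (c • X) = K X := by
  have h0 : ‖c‖ ^ 4 ≠ 0 := pow_ne_zero _ (norm_ne_zero_iff.2 hc)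
  have h1 : (c • X) * (c • X)ᴴ - (c • X)ᴴ * (c • X) = (c * star c) • (X * Xᴴ - Xᴴ * X) := by
    simp only [conjTranspose_smul, smul_mul_smul_comm, smul_sub, mul_comm (star c) c]
  have h2 : trace ((c • X) * (c • X)) = c ^ 2 * trace (X * X) := by
    simp [trace_smul, sq, mul_assoc]
  rw [K, h1, h2, normSq_smul, normSq_smul, K, ← mul_div_mul_left (normSq _) _ h0]
  congr 1
  · simp only [RCLike.star_def, norm_mul, RCLike.norm_conj]; ring
  · simp only [norm_mul, norm_pow]; ring

/-- The denominator of `K` is positive on trace-free matrices outside `Z`. -/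
theorem denom_pos {X : Matrix (Fin n) (Fin n) ℂ} (ht : trace X = 0) (hZ : X ∉ Z n) :
    0 < normSq X ^ 2 - ‖trace (X * X)‖ ^ 2 :=
  lt_of_le_of_ne (denom_nonneg X) fun h => hZ ⟨ht, h.symm⟩

theorem notMem_Z_of_denom_pos {X : Matrix (Fin n) (Fin n) ℂ}
    (h : 0 < normSq X ^ 2 - ‖trace (X * X)‖ ^ 2) : X ∉ Z n := fun h' => h.ne' h'.2

/-- A scalar multiple of a Hermitian matrix annihilates the denominator of `K`. -/
theorem denom_smul_isHermitian {X : Matrix (Fin n) (Fin n) ℂ} (hX : X.IsHermitian) (c : ℂ) :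
    normSq (c • X) ^ 2 - ‖trace ((c • X) * (c • X))‖ ^ 2 = 0 := by
  have h := trace_mul_conjTranspose_self X
  rw [hX.eq] at h
  have h2 : trace ((c • X) * (c • X)) = c ^ 2 * normSq X := by
    rw [← h]; simp [trace_smul, sq, mul_assoc]
  rw [h2, normSq_smul]
  simp [abs_of_nonneg (normSq_nonneg X)]

end NormSq

/-! ### Similarity and unitary similarity -/

theorem conjTranspose_unitary_conj {ι : Type*} [Fintype ι] (U X : Matrix ι ι ℂ) :
    (U * X * star U)ᴴ = U * Xᴴ * star U := by
  simp [star_eq_conjTranspose, mul_assoc]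

section Similarity

variable {ι : Type*} [Fintype ι] [DecidableEq ι]

/-- Similarity of square complex matrices. -/
def Sim (A B : Matrix ι ι ℂ) : Prop := ∃ P Q : Matrix ι ι ℂ, P * Q = 1 ∧ B = P * A * Q

theorem Sim.refl (A : Matrix ι ι ℂ) : Sim A A := ⟨1, 1, by simp, by simp⟩

theorem Sim.symm {A B : Matrix ι ι ℂ} (h : Sim A B) : Sim B A := by
  obtain ⟨P, Q, h1, rfl⟩ := h
  have h2 := mul_eq_one_comm.1 h1
  refine ⟨Q, P, h2, ?_⟩
  calc A = (Q * P) * A * (Q * P) := by simp [h2]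
    _ = _ := by noncomm_ring

theorem Sim.trans {A B C : Matrix ι ι ℂ} (h : Sim A B) (h' : Sim B C) : Sim A C := by
  obtain ⟨P, Q, h1, rfl⟩ := h
  obtain ⟨P', Q', h1', rfl⟩ := h'
  refine ⟨P' * P, Q * Q', ?_, by noncomm_ring⟩
  calc P' * P * (Q * Q') = P' * (P * Q) * Q' := by noncomm_ring
    _ = 1 := by simp [h1, h1']

theorem Sim.smul {A B : Matrix ι ι ℂ} (h : Sim A B) (c : ℂ) : Sim (c • A) (c • B) := by
  obtain ⟨P, Q, h1, rfl⟩ := h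
  exact ⟨P, Q, h1, by simp⟩

theorem Sim.pow {A B : Matrix ι ι ℂ} (h : Sim A B) (k : ℕ) : Sim (A ^ k) (B ^ k) := by
  obtain ⟨P, Q, h1, rfl⟩ := h
  have h2 := mul_eq_one_comm.1 h1
  refine ⟨P, Q, h1, ?_⟩
  induction k with
  | zero => simp [h1]
  | succ k ih =>
    rw [pow_succ, ih, pow_succ]
    calc P * A ^ k * Q * (P * A * Q) = P * A ^ k * (Q * P) * A * Q := by noncomm_ring
      _ = _ := by rw [h2]; noncomm_ring

theorem Sim.rank_eq {A B : Matrix ι ι ℂ} (h : Sim A B) : A.rank = B.rank := by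
  have key : ∀ A B : Matrix ι ι ℂ, Sim A B → B.rank ≤ A.rank := by
    rintro A B ⟨P, Q, -, rfl⟩
    exact (rank_mul_le_left _ _).trans (rank_mul_le_right _ _)
  exact le_antisymm (key _ _ h.symm) (key _ _ h)

theorem Sim.charpoly_eq {A B : Matrix ι ι ℂ} (h : Sim A B) : A.charpoly = B.charpoly := by
  obtain ⟨P, Q, h1, rfl⟩ := h
  have h2 := mul_eq_one_comm.1 h1
  have := charpoly_units_conj (⟨P, Q, h1, h2⟩ : (Matrix ι ι ℂ)ˣ) A
  rw [← inv_eq_right_inv h1]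
  exact this.symm

theorem Sim.trace_eq {A B : Matrix ι ι ℂ} (h : Sim A B) : A.trace = B.trace := by
  obtain ⟨P, Q, h1, rfl⟩ := h
  rw [trace_mul_comm, ← mul_assoc, mul_eq_one_comm.1 h1, one_mul]

theorem Sim.trace_mul_self_eq {A B : Matrix ι ι ℂ} (h : Sim A B) :
    (A * A).trace = (B * B).trace := by
  simpa [sq] using (h.pow 2).trace_eq

theorem Sim.isNilpotent {A B : Matrix ι ι ℂ} (h : Sim A B) (hA : IsNilpotent A) :
    IsNilpotent B := by
  obtain ⟨k, hk⟩ := hA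
  obtain ⟨P, Q, -, h'⟩ := h.pow k
  exact ⟨k, by simp [h', hk]⟩

theorem submatrix_perm_eq (A : Matrix ι ι ℂ) (σ : Equiv.Perm ι) :
    A.submatrix σ σ = (1 : Matrix ι ι ℂ).submatrix σ id * A * (1 : Matrix ι ι ℂ).submatrix id σ := by
  ext i j
  simp [mul_apply, one_apply]

theorem one_submatrix_perm_mul (σ : Equiv.Perm ι) :
    (1 : Matrix ι ι ℂ).submatrix σ id * (1 : Matrix ι ι ℂ).submatrix id σ = 1 := by
  ext i j
  simp [mul_apply, one_apply]

theorem sim_submatrix_perm (A : Matrix ι ι ℂ) (σ : Equiv.Perm ι) : Sim A (A.submatrix σ σ) :=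
  ⟨_, _, one_submatrix_perm_mul σ, submatrix_perm_eq A σ⟩

/-- Unitary similarity of square complex matrices. -/
def USim (A B : Matrix ι ι ℂ) : Prop := ∃ U ∈ unitaryGroup ι ℂ, B = U * A * star U

theorem USim.sim {A B : Matrix ι ι ℂ} (h : USim A B) : Sim A B := by
  obtain ⟨U, hU, rfl⟩ := h
  exact ⟨U, star U, mem_unitaryGroup_iff.1 hU, rfl⟩

theorem USim.symm {A B : Matrix ι ι ℂ} (h : USim A B) : USim B A := by
  obtain ⟨U, hU, rfl⟩ := h
  have h2 := mem_unitaryGroup_iff'.1 hU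
  refine ⟨star U, Unitary.star_mem hU, ?_⟩
  rw [star_star]
  calc A = (star U * U) * A * (star U * U) := by simp [h2]
    _ = _ := by noncomm_ring

theorem USim.trans {A B C : Matrix ι ι ℂ} (h : USim A B) (h' : USim B C) : USim A C := by
  obtain ⟨U, hU, rfl⟩ := h
  obtain ⟨V, hV, rfl⟩ := h'
  exact ⟨V * U, mul_mem hV hU, by rw [star_mul]; noncomm_ring⟩

theorem usim_submatrix_perm (A : Matrix ι ι ℂ) (σ : Equiv.Perm ι) :
    USim A (A.submatrix σ σ) := by
  have h : star ((1 : Matrix ι ι ℂ).submatrix σ id) = (1 : Matrix ι ι ℂ).submatrix id σ := by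
    simp [star_eq_conjTranspose, conjTranspose_submatrix]
  refine ⟨(1 : Matrix ι ι ℂ).submatrix σ id, ?_, ?_⟩
  · rw [mem_unitaryGroup_iff, h, one_submatrix_perm_mul]
  · rw [h]; exact submatrix_perm_eq A σ

theorem unitary_conj_mul {U : Matrix ι ι ℂ} (hU : U ∈ unitaryGroup ι ℂ) (X Y : Matrix ι ι ℂ) :
    (U * X * star U) * (U * Y * star U) = U * (X * Y) * star U := by
  have h2 := mem_unitaryGroup_iff'.1 hU
  calc _ = U * X * (star U * U) * Y * star U := by noncomm_ring
    _ = _ := by rw [h2]; noncomm_ring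

theorem trace_unitary_conj {U : Matrix ι ι ℂ} (hU : U ∈ unitaryGroup ι ℂ) (X : Matrix ι ι ℂ) :
    trace (U * X * star U) = trace X := by
  rw [trace_mul_comm, ← mul_assoc, mem_unitaryGroup_iff'.1 hU, one_mul]

end Similarity

/-! ### Orbits under the special linear and special unitary groups -/

section Orbits

variable {n : ℕ}

theorem USim.normSq_eq {A B : Matrix (Fin n) (Fin n) ℂ} (h : USim A B) :
    normSq A = normSq B := by
  obtain ⟨U, hU, rfl⟩ := h
  rw [normSq, normSq, conjTranspose_unitary_conj, unitary_conj_mul hU, trace_unitary_conj hU]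

theorem USim.K_eq {A B : Matrix (Fin n) (Fin n) ℂ} (h : USim A B) : K A = K B := by
  have h1 : USim (A * Aᴴ - Aᴴ * A) (B * Bᴴ - Bᴴ * B) := by
    obtain ⟨U, hU, rfl⟩ := h
    refine ⟨U, hU, ?_⟩
    rw [conjTranspose_unitary_conj, unitary_conj_mul hU, unitary_conj_mul hU]
    noncomm_ring
  rw [K, K, h1.normSq_eq, h.normSq_eq, h.sim.trace_mul_self_eq]

theorem USim.mem_Z_iff {A B : Matrix (Fin n) (Fin n) ℂ} (h : USim A B) : A ∈ Z n ↔ B ∈ Z n := by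
  simp only [Z, Set.mem_ofPred_eq, h.normSq_eq, h.sim.trace_mul_self_eq, h.sim.trace_eq]

theorem specialLinearGroup_mul_inv (g : Matrix.SpecialLinearGroup (Fin n) ℂ) :
    (g : Matrix (Fin n) (Fin n) ℂ) * (g⁻¹ : Matrix.SpecialLinearGroup (Fin n) ℂ) = 1 :=
  (Matrix.SpecialLinearGroup.coe_mul g g⁻¹).symm.trans (by
    rw [mul_inv_cancel]; exact Matrix.SpecialLinearGroup.coe_one)

/-- Similarity is conjugacy under the special linear group. -/
theorem mem_slOrbit_iff {A B : Matrix (Fin n) (Fin n) ℂ} : B ∈ slOrbit A ↔ Sim A B := by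
  constructor
  · rintro ⟨g, rfl⟩
    exact ⟨g, (g⁻¹ : Matrix.SpecialLinearGroup (Fin n) ℂ), specialLinearGroup_mul_inv g,
      rfl⟩
  · rintro ⟨P, Q, h1, rfl⟩
    rcases Nat.eq_zero_or_pos n with rfl | hn
    · exact ⟨1, Subsingleton.elim _ _⟩
    have hdet : P.det ≠ 0 := fun h0 => by
      have := congrArg det h1
      simp [h0] at this
    -- Dividing the conjugator by an n-th root of its determinant makes it special and does not
    -- change the conjugation; n = 0 is split off because the root needs n > 0.
    obtain ⟨z, hz⟩ := IsAlgClosed.exists_pow_nat_eq P.det hn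
    have hz0 : z ≠ 0 := by
      rintro rfl
      exact hdet (by rw [← hz, zero_pow hn.ne'])
    have hg : (z⁻¹ • P).det = 1 := by
      rw [det_smul, Fintype.card_fin, inv_pow, hz, inv_mul_cancel₀ hdet]
    set g : Matrix.SpecialLinearGroup (Fin n) ℂ := ⟨z⁻¹ • P, hg⟩ with hgdef
    have hinv : ((g⁻¹ : Matrix.SpecialLinearGroup (Fin n) ℂ) : Matrix (Fin n) (Fin n) ℂ) = z • Q := by
      have h2 : (z⁻¹ • P) * (z • Q) = 1 := by
        rw [smul_mul_smul_comm, inv_mul_cancel₀ hz0, h1, one_smul]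
      exact left_inv_eq_right_inv (mul_eq_one_comm.1 (specialLinearGroup_mul_inv g)) h2
    refine ⟨g, ?_⟩
    rw [hinv]
    change P * A * Q = z⁻¹ • P * A * z • Q
    simp [smul_smul, mul_inv_cancel₀ hz0]

/-- Unitary similarity is conjugacy under the special unitary group. -/
theorem mem_suOrbit_iff {S : Set (Matrix (Fin n) (Fin n) ℂ)} {B : Matrix (Fin n) (Fin n) ℂ} :
    B ∈ suOrbit S ↔ ∃ M ∈ S, USim M B := by
  constructor
  · rintro ⟨U, hU, M, hM, rfl⟩
    exact ⟨M, hM, U, (mem_specialUnitaryGroup_iff.1 hU).1, rfl⟩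
  · rintro ⟨M, hM, U, hU, rfl⟩
    rcases Nat.eq_zero_or_pos n with rfl | hn
    · exact ⟨1, one_mem _, M, hM, Subsingleton.elim _ _⟩
    have hdet : ‖U.det‖ = 1 := by
      have := congrArg det (mem_unitaryGroup_iff.1 hU)
      rw [det_mul, star_eq_conjTranspose, det_conjTranspose, det_one] at this
      have h2 := congrArg norm this
      rw [norm_mul, norm_star, norm_one] at h2
      nlinarith [norm_nonneg U.det]
    have hdet0 : U.det ≠ 0 := by rw [← norm_ne_zero_iff, hdet]; exact one_ne_zero
    -- The determinant has modulus 1, hence so has the root z, and rescaling by z keeps the matrix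
    -- unitary.
    obtain ⟨z, hz⟩ := IsAlgClosed.exists_pow_nat_eq U.det⁻¹ hn
    have hz1 : ‖z‖ = 1 := by
      have h2 := congrArg norm hz
      rw [norm_pow, norm_inv, hdet, inv_one] at h2
      exact (pow_eq_one_iff_of_nonneg (norm_nonneg _) hn.ne').1 h2
    have hzz : z * star z = 1 := by
      rw [RCLike.star_def, Complex.mul_conj, Complex.normSq_eq_norm_sq, hz1]; simp
    refine ⟨z • U, mem_specialUnitaryGroup_iff.2 ⟨?_, ?_⟩, M, hM, ?_⟩
    · rw [mem_unitaryGroup_iff, star_smul, smul_mul_smul_comm, hzz, mem_unitaryGroup_iff.1 hU,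
        one_smul]
    · rw [det_smul, Fintype.card_fin, hz, inv_mul_cancel₀ hdet0]
    · rw [star_smul, smul_mul_assoc, smul_mul_smul_comm, hzz, one_smul]

end Orbits

end OrbitK

namespace OrbitK

/-! ### The derivative of `K` along an orbit -/

section Calculus

variable {n : ℕ}

open scoped Matrix.Norms.Operator

theorem trace_commutator_mul {ι : Type*} [Fintype ι] (X Y W : Matrix ι ι ℂ) :
    trace ((X * Y - Y * X) * W) = trace (X * (Y * W - W * Y)) := by
  rw [sub_mul, mul_sub, trace_sub, trace_sub, mul_assoc, mul_assoc Y X W, trace_mul_comm Y,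
    mul_assoc]

theorem exp_mul_exp_neg (X : Matrix (Fin n) (Fin n) ℂ) :
    NormedSpace.exp X * NormedSpace.exp (-X) = 1 := by
  rw [← Matrix.exp_add_of_commute _ _ (Commute.neg_right (Commute.refl X)), add_neg_cancel,
    NormedSpace.exp_zero]

theorem sim_exp_conj (X B : Matrix (Fin n) (Fin n) ℂ) :
    Sim B (NormedSpace.exp X * B * NormedSpace.exp (-X)) :=
  ⟨_, _, exp_mul_exp_neg X, rfl⟩

theorem hasDerivAt_exp_conj (M B : Matrix (Fin n) (Fin n) ℂ) :
    HasDerivAt (fun t : ℝ => NormedSpace.exp ((t : ℂ) • M) * B * NormedSpace.exp (-((t : ℂ) • M)))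
      (M * B - B * M) 0 := by
  have h1 := hasDerivAt_exp_smul_const (𝕂 := ℝ) M 0
  have h2 := hasDerivAt_exp_smul_const (𝕂 := ℝ) (-M) 0
  have h := (h1.mul_const B).mul h2
  simp only [zero_smul, NormedSpace.exp_zero, one_mul, mul_one] at h
  have e : (fun t : ℝ => NormedSpace.exp ((t : ℂ) • M) * B * NormedSpace.exp (-((t : ℂ) • M))) =
      (fun t : ℝ => NormedSpace.exp (t • M) * B) * fun t : ℝ => NormedSpace.exp (t • -M) := by
    ext1 t
    simp
  rw [e]
  exact h.congr_deriv (by noncomm_ring)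

/-- A curve of matrices with `B' = [N, B]` is the conjugate of its initial value by `exp (s N)`. -/
theorem eq_exp_conj_of_hasDerivAt {N : Matrix (Fin n) (Fin n) ℂ}
    {B : ℂ → Matrix (Fin n) (Fin n) ℂ}
    (hB : ∀ s, HasDerivAt B (N * B s - B s * N) s) (s : ℂ) : Sim (B 0) (B s) := by
  -- Undoing the flow, exp(-tN) B(t) exp(tN) has derivative zero and so stays at B(0).
  have h : ∀ s, HasDerivAt (fun t : ℂ => NormedSpace.exp (t • -N) * B t * NormedSpace.exp (t • N))
      0 s := by
    intro s
    have h1 := hasDerivAt_exp_smul_const (𝕂 := ℂ) (-N) s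
    have h2 := hasDerivAt_exp_smul_const' (𝕂 := ℂ) N s
    exact ((h1.mul (hB s)).mul h2).congr_deriv (by simp only [Pi.mul_apply]; noncomm_ring)
  have h3 := is_const_of_deriv_eq_zero (𝕜 := ℂ) (fun s => (h s).differentiableAt)
    (fun s => (h s).deriv) 0 s
  simp only [zero_smul, NormedSpace.exp_zero, one_mul, mul_one] at h3
  have h4 : NormedSpace.exp (s • -N) * NormedSpace.exp (s • N) = 1 := by
    simpa using exp_mul_exp_neg (s • -N)
  exact ⟨_, _, h4, h3⟩ |> fun h : Sim (B s) (B 0) => h.symm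

theorem HasDerivAt.matrix_trace {f : ℝ → Matrix (Fin n) (Fin n) ℂ}
    {f' : Matrix (Fin n) (Fin n) ℂ} {x : ℝ} (hf : HasDerivAt f f' x) :
    HasDerivAt (fun t => trace (f t)) (trace f') x :=
  (LinearMap.toContinuousLinearMap (traceLinearMap (Fin n) ℝ ℂ)).hasFDerivAt.comp_hasDerivAt x hf

theorem HasDerivAt.conjTranspose {f : ℝ → Matrix (Fin n) (Fin n) ℂ}
    {f' : Matrix (Fin n) (Fin n) ℂ} {x : ℝ} (hf : HasDerivAt f f' x) :
    HasDerivAt (fun t => (f t)ᴴ) f'ᴴ x :=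
  (LinearMap.toContinuousLinearMap (conjTransposeLinearEquiv (Fin n) (Fin n) ℝ ℂ).toLinearMap
    ).hasFDerivAt.comp_hasDerivAt x hf

theorem HasDerivAt.normSq {f : ℝ → Matrix (Fin n) (Fin n) ℂ}
    {f' : Matrix (Fin n) (Fin n) ℂ} {x : ℝ} (hf : HasDerivAt f f' x) :
    HasDerivAt (fun t => normSq (f t)) (2 * (trace (f' * (f x)ᴴ)).re) x := by
  have h := Complex.reCLM.hasFDerivAt.comp_hasDerivAt x
    (HasDerivAt.matrix_trace (hf.mul (HasDerivAt.conjTranspose hf)))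
  refine h.congr_deriv ?_
  rw [trace_add, trace_conjTranspose_mul f' (f x)]
  simp [two_mul]

/-- The Hermitian matrix `[B, B*]`. -/
noncomputable def mom (B : Matrix (Fin n) (Fin n) ℂ) : Matrix (Fin n) (Fin n) ℂ := B * Bᴴ - Bᴴ * B

theorem conjTranspose_mom (B : Matrix (Fin n) (Fin n) ℂ) : (mom B)ᴴ = mom B := by
  simp [mom]

/-- Up to a positive factor, the gradient of `K` along the orbit of `B`. -/
noncomputable def gradK (B : Matrix (Fin n) (Fin n) ℂ) : Matrix (Fin n) (Fin n) ℂ :=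
  B * (Bᴴ * mom B - mom B * Bᴴ) - (Bᴴ * mom B - mom B * Bᴴ) * B
    - ((K B * normSq B : ℝ) : ℂ) • mom B

theorem trace_gradK (B : Matrix (Fin n) (Fin n) ℂ) : trace (gradK B) = 0 := by
  rw [gradK, trace_sub, trace_sub, trace_mul_comm, trace_smul, mom, trace_sub, trace_mul_comm B Bᴴ]
  simp

/-- Conjugation fixes tr(B²), so the denominator moves only through |B|². Invariance of the trace
form carries the brackets off M: the derivatives of |H|² and |B|² become 4 Re tr(M [B, [B*, H]]) and
2 Re tr(M H). -/
theorem hasDerivAt_K {B : Matrix (Fin n) (Fin n) ℂ}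
    (hD : normSq B ^ 2 - ‖trace (B * B)‖ ^ 2 ≠ 0) (M : Matrix (Fin n) (Fin n) ℂ) :
    HasDerivAt (fun t : ℝ =>
      K (NormedSpace.exp ((t : ℂ) • M) * B * NormedSpace.exp (-((t : ℂ) • M))))
      (4 / (normSq B ^ 2 - ‖trace (B * B)‖ ^ 2) * (trace (M * gradK B)).re) 0 := by
  set G : ℝ → Matrix (Fin n) (Fin n) ℂ := fun t =>
    NormedSpace.exp ((t : ℂ) • M) * B * NormedSpace.exp (-((t : ℂ) • M)) with hG
  have hG0 : G 0 = B := by simp [hG]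
  have h := hasDerivAt_exp_conj M B
  change HasDerivAt G _ 0 at h
  have hs := HasDerivAt.conjTranspose h
  have hN := HasDerivAt.normSq ((h.mul hs).sub (hs.mul h))
  have hB := HasDerivAt.normSq h
  have hT : ∀ t, trace (G t * G t) = trace (B * B) := fun t =>
    ((sim_exp_conj _ B).trace_mul_self_eq).symm
  have hK : (fun t => K (G t)) = fun t => normSq (G t * (G t)ᴴ - (G t)ᴴ * G t) /
      (normSq (G t) ^ 2 - ‖trace (B * B)‖ ^ 2) := by
    ext t; rw [K, hT]
  change HasDerivAt (fun t => K (G t)) _ 0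
  rw [hK]
  have hD' := (hB.pow 2).sub_const (‖trace (B * B)‖ ^ 2)
  have hq := hN.div hD' (by simpa [hG0] using hD)
  refine hq.congr_deriv ?_
  simp only [Pi.mul_apply, Pi.sub_apply, Pi.pow_apply, hG0]
  set H := mom B with hH
  have e0 : B * Bᴴ - Bᴴ * B = H := rfl
  have hHH : Hᴴ = H := conjTranspose_mom B
  rw [e0, hHH]
  set C := Bᴴ * H - H * Bᴴ with hC
  set B' := M * B - B * M with hB'
  have e1 : (trace ((B' * Bᴴ + B * B'ᴴ - (B'ᴴ * B + Bᴴ * B')) * H)).re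
      = 2 * (trace (M * (B * C - C * B))).re := by
    have f1 : trace (B' * C) = trace (M * (B * C - C * B)) := trace_commutator_mul M B C
    have f2 : trace ((B' * Bᴴ + B * B'ᴴ - (B'ᴴ * B + Bᴴ * B')) * H)
        = trace (B' * C) + star (trace (B' * C)) := by
      have g1 : trace ((B' * Bᴴ - Bᴴ * B') * H) = trace (B' * C) := trace_commutator_mul _ _ _
      have g : ∀ Y : Matrix (Fin n) (Fin n) ℂ, trace ((B * Yᴴ - Yᴴ * B) * H) =
          star (trace ((Y * Bᴴ - Bᴴ * Y) * H)) := by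
        intro Y
        rw [← trace_conjTranspose, conjTranspose_mul, conjTranspose_sub, conjTranspose_mul,
          conjTranspose_mul, conjTranspose_conjTranspose, hHH, trace_mul_comm]
      have g2 := g B'
      rw [g1] at g2
      rw [← g2]
      nth_rewrite 1 [← g1]
      rw [← trace_add]
      congr 1
      noncomm_ring
    rw [f2, f1]
    simp [two_mul]
  have e2 : trace (B' * Bᴴ) = trace (M * H) := trace_commutator_mul M B Bᴴ
  rw [e1, e2]
  have e3 : (trace (M * gradK B)).re = (trace (M * (B * C - C * B))).re
      - K B * normSq B * (trace (M * H)).re := by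
    rw [gradK, ← hH, ← hC, mul_sub, trace_sub, Matrix.mul_smul, trace_smul]
    simp
  rw [e3, K, e0]
  field_simp
  push_cast
  ring

/-- Outside `Z`, critical points are the zeros of the gradient. -/
theorem isCriticalPoint_iff {B : Matrix (Fin n) (Fin n) ℂ}
    (hD : 0 < normSq B ^ 2 - ‖trace (B * B)‖ ^ 2) : IsCriticalPoint B ↔ gradK B = 0 := by
  constructor
  · intro h
    have h1 := (h (gradK B)ᴴ (by rw [trace_conjTranspose, trace_gradK, star_zero])).unique
      (hasDerivAt_K hD.ne' (gradK B)ᴴ)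
    rw [trace_conjTranspose_mul_self, Complex.ofReal_re, eq_comm, mul_eq_zero] at h1
    exact normSq_eq_zero.1 (h1.resolve_left (by positivity))
  · intro h M _
    simpa [h] using hasDerivAt_K hD.ne' M

/-- Minimum points of `K` on an orbit are critical. -/
theorem isCriticalPoint_of_isMinOn {A B : Matrix (Fin n) (Fin n) ℂ} (hA : trace A = 0)
    (hB : B ∈ slOrbit A \ Z n) (hmin : IsMinOn K (slOrbit A \ Z n) B) : IsCriticalPoint B := by
  have hBA := mem_slOrbit_iff.1 hB.1
  have hBt : trace B = 0 := by rw [← hBA.trace_eq, hA]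
  have hD := denom_pos hBt hB.2
  rw [isCriticalPoint_iff hD]
  -- In the direction of the adjoint of `gradK B` the derivative is a positive multiple of its
  -- squared norm.
  have hd := hasDerivAt_K hD.ne' (gradK B)ᴴ
  have hc := (HasDerivAt.normSq (hasDerivAt_exp_conj (gradK B)ᴴ B)).continuousAt
  have hlm : IsLocalMin (fun t : ℝ => K (NormedSpace.exp ((t : ℂ) • (gradK B)ᴴ) * B *
      NormedSpace.exp (-((t : ℂ) • (gradK B)ᴴ)))) 0 := by
    -- The denominator is continuous along the curve, so nearby points stay outside Z and can be
    -- compared with the minimum.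
    have hev := ((hc.pow 2).sub (continuousAt_const (y := ‖trace (B * B)‖ ^ 2))).eventually
      (lt_mem_nhds (a := 0) (by simpa using hD))
    filter_upwards [hev] with t ht
    have hs := sim_exp_conj ((t : ℂ) • (gradK B)ᴴ) B
    have hin := hmin (a := NormedSpace.exp ((t : ℂ) • (gradK B)ᴴ) * B *
      NormedSpace.exp (-((t : ℂ) • (gradK B)ᴴ))) ⟨mem_slOrbit_iff.2 (hBA.trans hs),
        notMem_Z_of_denom_pos (by rw [← hs.trace_mul_self_eq]; exact ht)⟩
    simpa using hin
  have h1 := hlm.hasDerivAt_eq_zero hd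
  rw [trace_conjTranspose_mul_self, Complex.ofReal_re, mul_eq_zero] at h1
  exact normSq_eq_zero.1 (h1.resolve_left (by positivity))

end Calculus

end OrbitK

namespace OrbitK

/-! ### Critical points and `sl(2)`-triples -/

section Triple

variable {n : ℕ}

/-- `E` spans, with its adjoint, a `*`-closed `sl(2)`: `[[E, E*], E] = 2 E`. -/
def IsTriple (E : Matrix (Fin n) (Fin n) ℂ) : Prop := mom E * E - E * mom E = (2 : ℂ) • E

/-- The element `a E + b E* + c [E, E*]`. -/
noncomputable def tripleComb (E : Matrix (Fin n) (Fin n) ℂ) (a b c : ℂ) : Matrix (Fin n)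
    (Fin n) ℂ :=
  a • E + b • Eᴴ + c • mom E

theorem trace_mom (B : Matrix (Fin n) (Fin n) ℂ) : trace (mom B) = 0 := by
  rw [mom, trace_sub, trace_mul_comm, sub_self]

theorem K_eq_div (B : Matrix (Fin n) (Fin n) ℂ) :
    K B = normSq (mom B) / (normSq B ^ 2 - ‖trace (B * B)‖ ^ 2) := rfl

theorem normSq_pos_of_denom_pos {B : Matrix (Fin n) (Fin n) ℂ}
    (hD : 0 < normSq B ^ 2 - ‖trace (B * B)‖ ^ 2) : 0 < normSq B := by
  refine lt_of_le_of_ne (normSq_nonneg B) fun h => ?_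
  rw [← h] at hD
  nlinarith [sq_nonneg ‖trace (B * B)‖]

/-- With the next lemma this gives the inner products of [H, B] with B and with B*, valid for every
B. They determine the projection of [H, B] to span(B, B*). -/
theorem trace_mom_bracket_mul_conjTranspose (B : Matrix (Fin n) (Fin n) ℂ) :
    trace ((mom B * B - B * mom B) * Bᴴ) = normSq (mom B) := by
  rw [trace_commutator_mul]
  change trace (mom B * mom B) = _
  nth_rewrite 2 [← conjTranspose_mom]
  exact trace_mul_conjTranspose_self _

theorem trace_mom_bracket_mul (B : Matrix (Fin n) (Fin n) ℂ) :
    trace ((mom B * B - B * mom B) * B) = 0 := by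
  rw [trace_commutator_mul, sub_self, Matrix.mul_zero, trace_zero]

theorem conjTranspose_mom_bracket (B : Matrix (Fin n) (Fin n) ℂ) :
    (mom B * B - B * mom B)ᴴ = Bᴴ * mom B - mom B * Bᴴ := by
  rw [conjTranspose_sub, conjTranspose_mul, conjTranspose_mul, conjTranspose_mom]

theorem trace_conjTranspose_mul_conjTranspose (B : Matrix (Fin n) (Fin n) ℂ) :
    trace (Bᴴ * Bᴴ) = star (trace (B * B)) := by
  rw [← trace_conjTranspose, conjTranspose_mul]

/-- At a zero of the gradient, `[[B, B*], B]` is a combination of `B` and `B*`. -/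
theorem mom_bracket_eq_of_gradK {B : Matrix (Fin n) (Fin n) ℂ}
    (hD : 0 < normSq B ^ 2 - ‖trace (B * B)‖ ^ 2) (hg : gradK B = 0) :
    mom B * B - B * mom B = ((K B * normSq B : ℝ) : ℂ) • B
      + (-(K B : ℂ) * trace (B * B)) • Bᴴ := by
  have hq := normSq_pos_of_denom_pos hD
  set q := normSq B with hqdef
  set τ := trace (B * B) with hτ
  set C := mom B * B - B * mom B with hC
  have hCs : B * Cᴴ - Cᴴ * B = ((K B * q : ℝ) : ℂ) • mom B := by
    rw [hC, conjTranspose_mom_bracket]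
    exact sub_eq_zero.1 hg
  have t1 : trace (C * Bᴴ) = normSq (mom B) := trace_mom_bracket_mul_conjTranspose B
  have t3 : trace (C * B) = 0 := trace_mom_bracket_mul B
  -- The only use of criticality: pairing the gradient equation with H computes the norm of C.
  have t2 : normSq C = K B * q * normSq (mom B) := by
    have : trace (C * Cᴴ) = ((K B * q : ℝ) : ℂ) * normSq (mom B) := by
      rw [hC, trace_commutator_mul, ← hC, hCs, Matrix.mul_smul, trace_smul]
      nth_rewrite 2 [← conjTranspose_mom]
      rw [trace_mul_conjTranspose_self, smul_eq_mul]
    rw [trace_mul_conjTranspose_self] at this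
    exact_mod_cast this
  have hKD : K B * (q ^ 2 - ‖τ‖ ^ 2) = normSq (mom B) := by
    rw [K_eq_div, div_mul_cancel₀ _ hD.ne']
  -- The candidate is the projection of C to span(B, B*); by Pythagoras the remainder has norm zero.
  have key : normSq (C + -(((K B * q : ℝ) : ℂ) • B + (-(K B : ℂ) * τ) • Bᴴ)) = 0 := by
    rw [normSq_add, normSq_neg, normSq_add, normSq_smul, normSq_smul, normSq_conjTranspose, t2]
    have e1 : trace (C * (-(((K B * q : ℝ) : ℂ) • B + (-(K B : ℂ) * τ) • Bᴴ))ᴴ)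
        = -((K B * q * normSq (mom B) : ℝ) : ℂ) := by
      simp only [conjTranspose_neg, conjTranspose_add, conjTranspose_smul, Matrix.mul_neg, mul_add,
        Matrix.mul_smul, trace_neg, trace_add, trace_smul, conjTranspose_conjTranspose, t1, t3]
      simp
    have e2 : trace ((((K B * q : ℝ) : ℂ) • B) * ((-(K B : ℂ) * τ) • Bᴴ)ᴴ)
        = -((K B ^ 2 * q * ‖τ‖ ^ 2 : ℝ) : ℂ) := by
      simp only [conjTranspose_smul, conjTranspose_conjTranspose, Matrix.mul_smul, Matrix.smul_mul,
        trace_smul, ← hτ, smul_eq_mul]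
      have : τ * star τ = ((‖τ‖ ^ 2 : ℝ) : ℂ) := by
        rw [RCLike.star_def, Complex.mul_conj, Complex.normSq_eq_norm_sq]
      simp only [star_mul, star_neg, RCLike.star_def, Complex.conj_ofReal] at this ⊢
      push_cast at this ⊢
      linear_combination (-(K B : ℂ) ^ 2 * q) * this
    rw [e1, e2, ← hqdef, ← hKD]
    simp only [norm_mul, norm_neg, Complex.norm_real, Real.norm_eq_abs, mul_pow, sq_abs,
      Complex.neg_re, Complex.ofReal_re]
    ring
  rw [normSq_eq_zero] at key
  rwa [← sub_eq_add_neg, sub_eq_zero] at key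

theorem gradK_eq_zero_of_mom_eq_zero {B : Matrix (Fin n) (Fin n) ℂ} (h : mom B = 0) :
    gradK B = 0 := by simp [gradK, h]

/-- The converse of `mom_bracket_eq_of_gradK`, with the value of `K`. -/
theorem gradK_eq_zero_of_mom_bracket {B : Matrix (Fin n) (Fin n) ℂ}
    (hD : 0 < normSq B ^ 2 - ‖trace (B * B)‖ ^ 2) {μ : ℝ} {ν : ℂ}
    (h : mom B * B - B * mom B = (μ : ℂ) • B + ν • Bᴴ) :
    K B = μ / normSq B ∧ gradK B = 0 := by
  have hq := normSq_pos_of_denom_pos hD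
  have t1 := trace_mom_bracket_mul_conjTranspose B
  have t3 := trace_mom_bracket_mul B
  rw [h, add_mul, trace_add, Matrix.smul_mul, Matrix.smul_mul, trace_smul, trace_smul] at t1 t3
  rw [trace_mul_conjTranspose_self, trace_conjTranspose_mul_conjTranspose] at t1
  rw [trace_conjTranspose_mul_self] at t3
  set τ := trace (B * B) with hτ
  have hττ : τ * star τ = ((‖τ‖ ^ 2 : ℝ) : ℂ) := by
    rw [RCLike.star_def, Complex.mul_conj, Complex.normSq_eq_norm_sq]
  -- The unknown ν is eliminated between the pairings with B* and with B.
  have e : normSq (mom B) * normSq B = μ * (normSq B ^ 2 - ‖τ‖ ^ 2) := by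
    have : ((normSq (mom B) * normSq B : ℝ) : ℂ) = ((μ * (normSq B ^ 2 - ‖τ‖ ^ 2) : ℝ) : ℂ) := by
      simp only [smul_eq_mul] at t1 t3
      push_cast at hττ ⊢
      rw [← t1, ← hττ]
      linear_combination (star τ) * t3
    exact_mod_cast this
  have hK : K B = μ / normSq B := by
    rw [K_eq_div, div_eq_div_iff hD.ne' hq.ne']
    exact e
  refine ⟨hK, ?_⟩
  rw [gradK, ← conjTranspose_mom_bracket, h, hK, div_mul_cancel₀ _ hq.ne']
  simp only [conjTranspose_add, conjTranspose_smul, conjTranspose_conjTranspose, RCLike.star_def,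
    Complex.conj_ofReal, mul_add, add_mul, Matrix.mul_smul, Matrix.smul_mul]
  rw [mom]
  module

/-- A non-normal critical point lies in the `*`-closed `sl(2)` of some triple. -/
theorem exists_triple_of_gradK {B : Matrix (Fin n) (Fin n) ℂ}
    (hD : 0 < normSq B ^ 2 - ‖trace (B * B)‖ ^ 2) (hg : gradK B = 0) (hH : mom B ≠ 0) :
    ∃ (E : Matrix (Fin n) (Fin n) ℂ) (a b : ℂ), IsTriple E ∧ B = tripleComb E a b 0 := by
  have hq := normSq_pos_of_denom_pos hD
  have h1 := mom_bracket_eq_of_gradK hD hg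
  have hKpos : 0 < K B := by rw [K_eq_div]; exact div_pos (normSq_pos hH) hD
  set μ : ℝ := K B * normSq B with hμ
  set ν : ℂ := -(K B : ℂ) * trace (B * B) with hν
  have hμpos : 0 < μ := mul_pos hKpos hq
  have hνn : ‖ν‖ ^ 2 = K B ^ 2 * ‖trace (B * B)‖ ^ 2 := by
    rw [hν, norm_mul, norm_neg, Complex.norm_real, Real.norm_eq_abs, mul_pow, sq_abs]
  have hpos : 0 < μ ^ 2 - ‖ν‖ ^ 2 := by
    rw [hνn, hμ, mul_pow, ← mul_sub]; positivity
  -- On span(B, B*) the operator ad H has matrix rows (μ, -ν̄) and (ν, -μ), hence eigenvalues ±κ.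
  set κ : ℝ := Real.sqrt (μ ^ 2 - ‖ν‖ ^ 2) with hκ
  have hκpos : 0 < κ := Real.sqrt_pos.2 hpos
  have hκ2 : κ ^ 2 = μ ^ 2 - ‖ν‖ ^ 2 := Real.sq_sqrt hpos.le
  -- This is (μ + κ)² - |ν|², the factor by which [E, E*] exceeds H for the unscaled eigenvector (μ
  -- + κ)B + νB*.
  set γ : ℝ := 2 * κ * (μ + κ) with hγ
  have hγpos : 0 < γ := by positivity
  -- The scale s is fixed by s²γκ = 2, so that [[E, E*], E] = 2E.
  set s : ℝ := Real.sqrt (2 / (γ * κ)) with hs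
  have hspos : 0 < s := Real.sqrt_pos.2 (by positivity)
  have hs2 : s ^ 2 * (γ * κ) = 2 := by
    rw [hs, Real.sq_sqrt (by positivity), div_mul_cancel₀]; positivity
  have hνν : (ν * star ν : ℂ) = μ ^ 2 - κ ^ 2 := by
    rw [RCLike.star_def, Complex.mul_conj, Complex.normSq_eq_norm_sq]
    have : ‖ν‖ ^ 2 = μ ^ 2 - κ ^ 2 := by linarith
    rw [this]; push_cast; ring
  have h2 : mom B * Bᴴ - Bᴴ * mom B = -((μ : ℂ) • Bᴴ) - star ν • B := by
    have := congrArg conjTranspose h1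
    rw [conjTranspose_mom_bracket, conjTranspose_add, conjTranspose_smul, conjTranspose_smul,
      conjTranspose_conjTranspose, RCLike.star_def, Complex.conj_ofReal] at this
    rw [← neg_sub, this, neg_add', RCLike.star_def]
  set E : Matrix (Fin n) (Fin n) ℂ := ((s * (μ + κ) : ℝ) : ℂ) • B + ((s : ℂ) * ν) • Bᴴ with hE
  have hEs : Eᴴ = ((s * (μ + κ) : ℝ) : ℂ) • Bᴴ + ((s : ℂ) * star ν) • B := by
    rw [hE]
    simp [mul_comm]
  have hmom : mom E = ((s ^ 2 * γ : ℝ) : ℂ) • mom B := by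
    have e : ((s * (μ + κ) : ℝ) : ℂ) * ((s * (μ + κ) : ℝ) : ℂ) - ((s : ℂ) * ν) * ((s : ℂ) * star ν)
        = ((s ^ 2 * γ : ℝ) : ℂ) := by
      rw [hγ]; push_cast
      linear_combination (-(s : ℂ) ^ 2) * hνν
    rw [← e, mom, hEs, hE, mom]
    simp only [mul_add, add_mul, Matrix.mul_smul, Matrix.smul_mul, smul_smul]
    module
  refine ⟨E, ((μ + κ) / (γ * s) : ℝ), -ν / (γ * s), ?_, ?_⟩
  · rw [IsTriple, hmom]
    have e1 : (((s ^ 2 * γ : ℝ) : ℂ) • mom B) * E - E * (((s ^ 2 * γ : ℝ) : ℂ) • mom B)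
        = ((s ^ 2 * γ : ℝ) : ℂ) • (((s * (μ + κ) : ℝ) : ℂ) • (mom B * B - B * mom B)
          + ((s : ℂ) * ν) • (mom B * Bᴴ - Bᴴ * mom B)) := by
      rw [hE]
      simp only [mul_add, add_mul, Matrix.mul_smul, Matrix.smul_mul]
      module
    have e2 : (((s ^ 2 * (γ * κ) : ℝ)) : ℂ) = 2 := by rw [hs2]; norm_num
    rw [e1, h1, h2, ← e2, hE]
    match_scalars
    · linear_combination (-(s : ℂ) ^ 3 * γ) * hνν
    · ring
  · rw [tripleComb, hEs, hE, zero_smul, add_zero]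
    have hsC : (s : ℂ) ≠ 0 := by exact_mod_cast hspos.ne'
    have hγC : (γ : ℂ) ≠ 0 := by exact_mod_cast hγpos.ne'
    have hγe : (γ : ℂ) = 2 * κ * (μ + κ) := by rw [hγ]; push_cast; ring
    match_scalars
    · field_simp
      linear_combination hγe + hνν
    · field_simp
      ring

theorem IsTriple.bracket_conjTranspose {E : Matrix (Fin n) (Fin n) ℂ} (hE : IsTriple E) :
    mom E * Eᴴ - Eᴴ * mom E = -((2 : ℂ) • Eᴴ) := by
  have := congrArg conjTranspose hE
  rw [conjTranspose_mom_bracket, conjTranspose_smul] at this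
  rw [← neg_sub, this]
  simp

theorem IsTriple.bracket {E : Matrix (Fin n) (Fin n) ℂ} (hE : IsTriple E) (a b c a' b' c' : ℂ) :
    tripleComb E a b c * tripleComb E a' b' c' - tripleComb E a' b' c' * tripleComb E a b c =
      tripleComb E (2 * (c * a' - a * c')) (2 * (b * c' - c * b')) (a * b' - b * a') := by
  have h1 : mom E * E - E * mom E = (2 : ℂ) • E := hE
  have h2 := hE.bracket_conjTranspose
  have h3 : E * Eᴴ - Eᴴ * E = mom E := rfl
  unfold tripleComb
  simp only [mul_add, add_mul, smul_mul_smul_comm]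
  linear_combination (norm := module) (a * b' - b * a') • h3 + (c * a' - a * c') • h1 +
    (c * b' - b * c') • h2

theorem tripleComb_conjTranspose (E : Matrix (Fin n) (Fin n) ℂ) (a b c : ℂ) :
    (tripleComb E a b c)ᴴ = tripleComb E (star b) (star a) (star c) := by
  simp only [tripleComb, conjTranspose_add, conjTranspose_smul, conjTranspose_conjTranspose,
    conjTranspose_mom]
  abel

theorem tripleComb_add (E : Matrix (Fin n) (Fin n) ℂ) (a b c a' b' c' : ℂ) :
    tripleComb E a b c + tripleComb E a' b' c' = tripleComb E (a + a') (b + b') (c + c') := by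
  simp only [tripleComb]; module

theorem tripleComb_smul (E : Matrix (Fin n) (Fin n) ℂ) (z a b c : ℂ) :
    z • tripleComb E a b c = tripleComb E (z * a) (z * b) (z * c) := by
  simp only [tripleComb]; module

theorem IsTriple.mom_tripleComb {E : Matrix (Fin n) (Fin n) ℂ} (hE : IsTriple E) (a b c : ℂ) :
    mom (tripleComb E a b c) = tripleComb E (2 * (c * star b - a * star c))
      (2 * (b * star c - c * star a)) (a * star a - b * star b) := by
  rw [mom, tripleComb_conjTranspose, hE.bracket]

/-- The sl(2) structure constants alone put [[B, B*], B] in span(B, B*) with a real first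
coefficient, which is the hypothesis of `gradK_eq_zero_of_mom_bracket`. The coefficient is
2|B|²/|E|², whence K = 2/|E|². -/
theorem IsTriple.mom_tripleComb_bracket {E : Matrix (Fin n) (Fin n) ℂ} (hE : IsTriple E)
    (a b c : ℂ) :
    mom (tripleComb E a b c) * tripleComb E a b c - tripleComb E a b c * mom (tripleComb E a b c) =
      ((2 * (‖a‖ ^ 2 + ‖b‖ ^ 2 + 2 * ‖c‖ ^ 2) : ℝ) : ℂ) • tripleComb E a b c
        + (-4 * (c ^ 2 + a * b)) • (tripleComb E a b c)ᴴ := by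
  have h : ∀ z : ℂ, (‖z‖ : ℂ) ^ 2 = z * star z := fun z => by
    rw [RCLike.star_def, Complex.mul_conj, Complex.normSq_eq_norm_sq]; push_cast; rfl
  rw [hE.mom_tripleComb, hE.bracket, tripleComb_conjTranspose, tripleComb_smul, tripleComb_smul,
    tripleComb_add]
  push_cast
  rw [h, h, h]
  congr 1 <;> ring

theorem IsTriple.trace_eq_zero {E : Matrix (Fin n) (Fin n) ℂ} (hE : IsTriple E) : trace E = 0 := by
  have := congrArg trace hE
  rw [trace_sub, trace_mul_comm, sub_self, trace_smul] at this
  simpa using this.symm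

theorem IsTriple.trace_tripleComb {E : Matrix (Fin n) (Fin n) ℂ} (hE : IsTriple E) (a b c : ℂ) :
    trace (tripleComb E a b c) = 0 := by
  simp [tripleComb, trace_mom, trace_conjTranspose, hE.trace_eq_zero]

theorem IsTriple.trace_mom_mul {E : Matrix (Fin n) (Fin n) ℂ} (hE : IsTriple E) :
    trace (mom E * E) = 0 := by
  have h := trace_commutator_mul (mom E) E (mom E)
  rw [hE, mul_sub, trace_sub, ← mul_assoc, trace_mul_comm (mom E * E), Matrix.smul_mul,
    trace_smul, sub_self, trace_mul_comm] at h
  simpa using h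

theorem IsTriple.trace_mul_self {E : Matrix (Fin n) (Fin n) ℂ} (hE : IsTriple E) :
    trace (E * E) = 0 := by
  have h := trace_mom_bracket_mul E
  rw [hE, Matrix.smul_mul, trace_smul] at h
  simpa using h

theorem IsTriple.normSq_mom {E : Matrix (Fin n) (Fin n) ℂ} (hE : IsTriple E) :
    normSq (mom E) = 2 * normSq E := by
  have h := trace_mom_bracket_mul_conjTranspose E
  rw [hE, Matrix.smul_mul, trace_smul, trace_mul_conjTranspose_self, smul_eq_mul] at h
  exact_mod_cast h.symm

/-- E, E* and [E, E*] are pairwise orthogonal, being eigenvectors of ad [E, E*] for 2, -2, 0, and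
|[E, E*]|² = 2|E|². -/
theorem IsTriple.normSq_tripleComb {E : Matrix (Fin n) (Fin n) ℂ} (hE : IsTriple E) (a b c : ℂ) :
    normSq (tripleComb E a b c) = (‖a‖ ^ 2 + ‖b‖ ^ 2 + 2 * ‖c‖ ^ 2) * normSq E := by
  have h1 : trace (E * Eᴴᴴ) = 0 := by rw [conjTranspose_conjTranspose, hE.trace_mul_self]
  have h2 : trace (E * (mom E)ᴴ) = 0 := by
    rw [conjTranspose_mom, trace_mul_comm, hE.trace_mom_mul]
  have h3 : trace (Eᴴ * (mom E)ᴴ) = 0 := by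
    rw [← conjTranspose_mul, trace_conjTranspose, hE.trace_mom_mul, star_zero]
  rw [tripleComb, normSq_add, normSq_add]
  simp only [normSq_smul, normSq_conjTranspose, conjTranspose_smul, add_mul, Matrix.smul_mul,
    Matrix.mul_smul, trace_add, trace_smul, h1, h2, h3, hE.normSq_mom]
  simp
  ring

theorem IsTriple.trace_tripleComb_mul_self {E : Matrix (Fin n) (Fin n) ℂ} (hE : IsTriple E)
    (a b c : ℂ) :
    trace (tripleComb E a b c * tripleComb E a b c) = 2 * (c ^ 2 + a * b) * normSq E := by
  have h1 := hE.trace_mul_self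
  have h2 : trace (E * mom E) = 0 := by rw [trace_mul_comm, hE.trace_mom_mul]
  have h3 : trace (Eᴴ * mom E) = 0 := by
    rw [← conjTranspose_mom, ← conjTranspose_mul, trace_conjTranspose, hE.trace_mom_mul, star_zero]
  have h4 : trace (mom E * mom E) = 2 * normSq E := by
    nth_rewrite 2 [← conjTranspose_mom]
    rw [trace_mul_conjTranspose_self, hE.normSq_mom]; push_cast; rfl
  have h5 : trace (Eᴴ * Eᴴ) = 0 := by rw [trace_conjTranspose_mul_conjTranspose, h1, star_zero]
  simp only [tripleComb, mul_add, add_mul, smul_mul_smul_comm, trace_add, trace_smul, h1, h2, h3,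
    h4, h5, hE.trace_mom_mul, trace_mul_comm (mom E) Eᴴ, trace_mul_conjTranspose_self,
    trace_conjTranspose_mul_self, smul_eq_mul]
  ring

/-- `K` takes the value `2 / |E|²` on the elements outside `Z` of the `sl(2)` of `E`, and they are
critical. -/
theorem IsTriple.K_tripleComb {E : Matrix (Fin n) (Fin n) ℂ} (hE : IsTriple E) {a b c : ℂ}
    (hZ : tripleComb E a b c ∉ Z n) :
    K (tripleComb E a b c) = 2 / normSq E ∧ IsCriticalPoint (tripleComb E a b c) := by
  have hD := denom_pos (hE.trace_tripleComb a b c) hZ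
  have hq := normSq_pos_of_denom_pos hD
  obtain ⟨h1, h2⟩ := gradK_eq_zero_of_mom_bracket hD (hE.mom_tripleComb_bracket a b c)
  refine ⟨?_, (isCriticalPoint_iff hD).2 h2⟩
  rw [h1]
  rw [hE.normSq_tripleComb] at hq ⊢
  have h3 := left_ne_zero_of_mul hq.ne'
  rw [mul_comm, mul_div_mul_left _ _ h3]

theorem tripleComb_zero (E : Matrix (Fin n) (Fin n) ℂ) : tripleComb E 0 0 0 = 0 := by
  simp [tripleComb]

/-! ### Conjugacy inside the sl(2) of a triple -/

section Conjugation

open scoped Matrix.Norms.Operator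

theorem hasDerivAt_tripleComb (E : Matrix (Fin n) (Fin n) ℂ) {a b c : ℂ → ℂ} {a' b' c' s : ℂ}
    (ha : HasDerivAt a a' s) (hb : HasDerivAt b b' s) (hc : HasDerivAt c c' s) :
    HasDerivAt (fun s => tripleComb E (a s) (b s) (c s)) (tripleComb E a' b' c') s :=
  ((ha.smul_const E).add (hb.smul_const Eᴴ)).add (hc.smul_const (mom E))

/-- The flow of ad E in the coordinates (a, b, c): ad E is nilpotent, so the flow is polynomial in
s. The companion below is the flow of ad E*. -/
theorem IsTriple.sim_tripleComb_up {E : Matrix (Fin n) (Fin n) ℂ} (hE : IsTriple E)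
    (a b c s : ℂ) :
    Sim (tripleComb E a b c) (tripleComb E (a - 2 * c * s - b * s ^ 2) b (c + b * s)) := by
  have h := eq_exp_conj_of_hasDerivAt (N := tripleComb E 1 0 0)
    (B := fun s => tripleComb E (a - 2 * c * s - b * s ^ 2) b (c + b * s)) (fun s => by
      have h1 : HasDerivAt (fun s => a - 2 * c * s - b * s ^ 2) (-2 * (c + b * s)) s :=
        ((((hasDerivAt_id s).const_mul (2 * c)).const_sub a).sub
          ((hasDerivAt_pow 2 s).const_mul b)).congr_deriv (by push_cast; ring)
      have h2 : HasDerivAt (fun s => c + b * s) b s :=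
        (((hasDerivAt_id s).const_mul b).const_add c).congr_deriv (by ring)
      refine (hasDerivAt_tripleComb E h1 (hasDerivAt_const s b) h2).congr_deriv ?_
      rw [hE.bracket]
      congr 1 <;> ring) s
  simpa using h

theorem IsTriple.sim_tripleComb_down {E : Matrix (Fin n) (Fin n) ℂ} (hE : IsTriple E)
    (a b c s : ℂ) :
    Sim (tripleComb E a b c) (tripleComb E a (b + 2 * c * s - a * s ^ 2) (c - a * s)) := by
  have h := eq_exp_conj_of_hasDerivAt (N := tripleComb E 0 1 0)
    (B := fun s => tripleComb E a (b + 2 * c * s - a * s ^ 2) (c - a * s)) (fun s => by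
      have h1 : HasDerivAt (fun s => b + 2 * c * s - a * s ^ 2) (2 * (c - a * s)) s :=
        ((((hasDerivAt_id s).const_mul (2 * c)).const_add b).sub
          ((hasDerivAt_pow 2 s).const_mul a)).congr_deriv (by push_cast; ring)
      have h2 : HasDerivAt (fun s => c - a * s) (-a) s :=
        (((hasDerivAt_id s).const_mul a).const_sub c).congr_deriv (by ring)
      refine (hasDerivAt_tripleComb E (hasDerivAt_const s a) h1 h2).congr_deriv ?_
      rw [hE.bracket]
      congr 1 <;> ring) s
  simpa using h

theorem IsTriple.sim_smul {E : Matrix (Fin n) (Fin n) ℂ} (hE : IsTriple E) {a : ℂ} (ha : a ≠ 0) :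
    Sim E (a • E) := by
  -- The flow of ad [E, E*] multiplies E by exp(2s), and the time log(a)/2 gives the factor a.
  have h := eq_exp_conj_of_hasDerivAt (N := tripleComb E 0 0 1)
    (B := fun s => tripleComb E (Complex.exp (2 * s)) 0 0) (fun s => by
      have h1 : HasDerivAt (fun s => Complex.exp (2 * s)) (2 * Complex.exp (2 * s)) s :=
        (((hasDerivAt_id s).const_mul 2).cexp).congr_deriv (by simp only [id]; ring)
      refine (hasDerivAt_tripleComb E h1 (hasDerivAt_const s 0)
        (hasDerivAt_const s 0)).congr_deriv ?_
      rw [hE.bracket]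
      congr 1 <;> ring) (Complex.log a / 2)
  rw [mul_div_cancel₀ _ two_ne_zero, Complex.exp_log ha] at h
  simpa [tripleComb] using h

/-- A nonzero element of the `sl(2)` of `E` is conjugate to a multiple of `[E, E*]` or to `E`. -/
theorem IsTriple.sim_tripleComb {E : Matrix (Fin n) (Fin n) ℂ} (hE : IsTriple E) {a b c z : ℂ}
    (h0 : tripleComb E a b c ≠ 0) (hz : z ^ 2 = c ^ 2 + a * b) :
    (z ≠ 0 → Sim (tripleComb E a b c) (z • mom E)) ∧ (z = 0 → Sim (tripleComb E a b c) E) := by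
  -- First make the coefficient of E nonzero: if a = 0, one of the flows at times 1 and -1 does it.
  -- The quantity c² + ab, minus the determinant in sl(2), is preserved.
  obtain ⟨a', b', c', ha', hz', hs⟩ : ∃ a' b' c' : ℂ, a' ≠ 0 ∧ z ^ 2 = c' ^ 2 + a' * b' ∧
      Sim (tripleComb E a b c) (tripleComb E a' b' c') := by
    by_cases ha : a = 0
    · subst ha
      have : 2 * c + b ≠ 0 ∨ 2 * c - b ≠ 0 := by
        by_contra! h
        obtain ⟨h1, h2⟩ := h
        have hc : c = 0 := by linear_combination (h1 + h2) / 4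
        have hb : b = 0 := by linear_combination (h1 - h2) / 2
        exact h0 (by rw [hc, hb, tripleComb_zero])
      rcases this with h | h
      · refine ⟨_, _, _, ?_, ?_, hE.sim_tripleComb_up 0 b c 1⟩
        · intro h'; apply h; linear_combination -h'
        · linear_combination hz
      · refine ⟨_, _, _, ?_, ?_, hE.sim_tripleComb_up 0 b c (-1)⟩
        · intro h'; apply h; linear_combination h'
        · linear_combination hz
    · exact ⟨a, b, c, ha, hz, Sim.refl _⟩
  have hs2 : Sim (tripleComb E a b c) (tripleComb E a' 0 z) := by
    -- This time is a root of b' + 2c's - a's², thanks to z² = c'² + a'b', and moves c' to z.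
    have := hE.sim_tripleComb_down a' b' c' ((c' - z) / a')
    have e1 : b' + 2 * c' * ((c' - z) / a') - a' * ((c' - z) / a') ^ 2 = 0 := by
      field_simp
      linear_combination -hz'
    have e2 : c' - a' * ((c' - z) / a') = z := by field_simp; ring
    rw [e1, e2] at this
    exact hs.trans this
  constructor
  · intro hz0
    have := hE.sim_tripleComb_up a' 0 z (a' / (2 * z))
    have e1 : a' - 2 * z * (a' / (2 * z)) - 0 * (a' / (2 * z)) ^ 2 = 0 := by field_simp; ring
    rw [e1] at this
    simpa [tripleComb] using hs2.trans this
  · rintro rfl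
    have : tripleComb E a' 0 0 = a' • E := by simp [tripleComb]
    rw [this] at hs2
    exact hs2.trans (hE.sim_smul ha').symm

end Conjugation

end Triple

end OrbitK

namespace OrbitK

/-! ### Unitary normal form of triples -/

section Chains

variable {V : Type*} [NormedAddCommGroup V] [InnerProductSpace ℂ V]

theorem chain_weight {F G : Module.End ℂ V}
    (hXG : (F * G - G * F) * G - G * (F * G - G * F) = -((2 : ℂ) • G)) {v : V} {l : ℂ}
    (hl : (F * G - G * F) v = l • v) (a : ℕ) :
    (F * G - G * F) ((G ^ a) v) = (l - 2 * a) • (G ^ a) v := by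
  induction a with
  | zero => simpa using hl
  | succ a ih =>
    have h := LinearMap.congr_fun hXG ((G ^ a) v)
    rw [LinearMap.sub_apply, Module.End.mul_apply, Module.End.mul_apply, ih, sub_eq_iff_eq_add] at h
    rw [pow_succ', Module.End.mul_apply, h, map_smul, LinearMap.neg_apply, LinearMap.smul_apply]
    push_cast
    module

/-- Moving F to the right past each G costs the weight at that place; the factor is l + (l - 2) + ⋯
+ (l - 2a) = (a + 1)(l - a). -/
theorem chain_raise {F G : Module.End ℂ V}
    (hXG : (F * G - G * F) * G - G * (F * G - G * F) = -((2 : ℂ) • G)) {v : V} {l : ℂ}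
    (hF : F v = 0) (hl : (F * G - G * F) v = l • v) (a : ℕ) :
    F ((G ^ (a + 1)) v) = ((a + 1) * (l - a)) • (G ^ a) v := by
  have h : ∀ a : ℕ, F ((G ^ (a + 1)) v) = (l - 2 * a) • (G ^ a) v + G (F ((G ^ a) v)) := by
    intro a
    rw [← chain_weight hXG hl a, pow_succ', LinearMap.sub_apply]
    simp [Module.End.mul_apply]
  induction a with
  | zero => rw [h]; simp [hF]
  | succ a ih =>
    rw [h, ih, map_smul, ← Module.End.mul_apply, ← pow_succ']
    push_cast
    module

theorem chain_raise_pow {F G : Module.End ℂ V}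
    (hXG : (F * G - G * F) * G - G * (F * G - G * F) = -((2 : ℂ) • G)) {v : V} {l : ℂ}
    (hF : F v = 0) (hl : (F * G - G * F) v = l • v) (a k : ℕ) :
    ∃ c : ℂ, (F ^ a) ((G ^ (a + k)) v) = c • (G ^ k) v := by
  induction a with
  | zero => exact ⟨1, by simp⟩
  | succ a ih =>
    obtain ⟨c, hc⟩ := ih
    refine ⟨((a + k : ℕ) + 1) * (l - (a + k : ℕ)) * c, ?_⟩
    rw [pow_succ, Module.End.mul_apply, show a + 1 + k = a + k + 1 by ring,
      chain_raise hXG hF hl, map_smul, hc, smul_smul]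

theorem inner_pow_left {F G : Module.End ℂ V} (hadj : ∀ x y, inner ℂ (G x) y = inner ℂ x (F y))
    (a : ℕ) (x y : V) : inner ℂ ((G ^ a) x) y = inner ℂ x ((F ^ a) y) := by
  induction a generalizing y with
  | zero => simp
  | succ a ih => rw [pow_succ', Module.End.mul_apply, hadj, ih, pow_succ, Module.End.mul_apply]

/-- Adjointness turns the powers of G on the longer side into powers of F, which annihilate the
shorter string. For equal lengths they reduce it to a multiple of its highest weight vector. -/
theorem chain_orthogonal {F G : Module.End ℂ V} (hadj : ∀ x y, inner ℂ (G x) y = inner ℂ x (F y))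
    (hXG : (F * G - G * F) * G - G * (F * G - G * F) = -((2 : ℂ) • G)) {v w : V} {l l' : ℂ}
    (hv : F v = 0) (hl : (F * G - G * F) v = l • v)
    (hw : F w = 0) (hl' : (F * G - G * F) w = l' • w) {a b : ℕ}
    (h : inner ℂ v w = 0 ∨ a ≠ b) : inner ℂ ((G ^ a) v) ((G ^ b) w) = 0 := by
  have key : ∀ {v w : V} {l' : ℂ} {a b : ℕ}, F w = 0 → (F * G - G * F) w = l' • w → b < a →
      inner ℂ ((G ^ a) v) ((G ^ b) w) = 0 := by
    intro v w l' a b hw hl' hab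
    obtain ⟨k, rfl⟩ := Nat.exists_eq_add_of_lt hab
    obtain ⟨c, hc⟩ := chain_raise_pow hXG hw hl' b 0
    rw [add_zero, pow_zero, Module.End.one_apply] at hc
    rw [inner_pow_left hadj, show b + k + 1 = k + 1 + b by ring, pow_add, Module.End.mul_apply, hc,
      map_smul, pow_succ, Module.End.mul_apply, hw, map_zero, smul_zero, inner_zero_right]
  rcases lt_trichotomy a b with hab | rfl | hab
  · rw [← inner_conj_symm, key hv hl hab, map_zero]
  · obtain ⟨c, hc⟩ := chain_raise_pow hXG hw hl' a 0
    rw [add_zero, pow_zero, Module.End.one_apply] at hc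
    rw [inner_pow_left hadj, hc, inner_smul_right, h.resolve_right (by simp), mul_zero]
  · exact key hw hl' hab

theorem norm_chain_succ {F G : Module.End ℂ V}
    (hadj : ∀ x y, inner ℂ (G x) y = inner ℂ x (F y))
    (hXG : (F * G - G * F) * G - G * (F * G - G * F) = -((2 : ℂ) • G)) {v : V} {l : ℝ}
    (hF : F v = 0) (hl : (F * G - G * F) v = (l : ℂ) • v) (a : ℕ) :
    ‖(G ^ (a + 1)) v‖ ^ 2 = ((a + 1) * (l - a)) * ‖(G ^ a) v‖ ^ 2 := by
  have h : (inner ℂ ((G ^ (a + 1)) v) ((G ^ (a + 1)) v) : ℂ) =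
      ((a + 1) * (l - a) : ℂ) * inner ℂ ((G ^ a) v) ((G ^ a) v) := by
    nth_rewrite 1 [pow_succ']
    rw [Module.End.mul_apply, hadj, chain_raise hXG hF hl, inner_smul_right]
  have e : ∀ x : V, inner ℂ x x = ((‖x‖ ^ 2 : ℝ) : ℂ) := fun x =>
    (inner_self_eq_norm_sq_to_K x).trans (by push_cast; rfl)
  rw [e, e] at h
  exact_mod_cast h

/-- The space splits into strings w, Gw, G²w, …, where w runs through an orthonormal eigenbasis of
the Hermitian operator X = [F, G] on ker F. Different strings are orthogonal, and normalising their
vectors produces the square roots in `eMat`. -/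
theorem exists_chain_basis [FiniteDimensional ℂ V] {F G : Module.End ℂ V}
    (hadj : ∀ x y, inner ℂ (G x) y = inner ℂ x (F y))
    (hXF : (F * G - G * F) * F - F * (F * G - G * F) = (2 : ℂ) • F)
    (hXG : (F * G - G * F) * G - G * (F * G - G * F) = -((2 : ℂ) • G))
    (hnF : IsNilpotent F) (hnG : IsNilpotent G) :
    ∃ (m : ℕ) (p : Fin m → ℕ) (b : OrthonormalBasis (Σ i, Fin (p i)) ℂ V), (∀ i, 0 < p i) ∧
      (∀ i (h : 0 < p i), F (b ⟨i, ⟨0, h⟩⟩) = 0) ∧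
      ∀ i a (h : a + 1 < p i), F (b ⟨i, ⟨a + 1, h⟩⟩) =
        ((Real.sqrt ((a + 1 : ℝ) * ((p i : ℝ) - (a + 1 : ℝ))) : ℝ) : ℂ) •
          b ⟨i, ⟨a, (Nat.lt_succ_self a).trans h⟩⟩ := by
  set X : Module.End ℂ V := F * G - G * F with hX
  have hadj' : ∀ x y, inner ℂ (F x) y = inner ℂ x (G y) := fun x y => by
    rw [← inner_conj_symm, ← hadj, inner_conj_symm]
  have hXsym : X.IsSymmetric := by
    intro x y
    simp only [hX, LinearMap.sub_apply, Module.End.mul_apply, inner_sub_left, inner_sub_right,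
      hadj, hadj']
  have hker : ∀ v ∈ LinearMap.ker F, X v ∈ LinearMap.ker F := by
    intro v hv
    rw [LinearMap.mem_ker] at hv ⊢
    have h := LinearMap.congr_fun hXF v
    simp only [LinearMap.sub_apply, Module.End.mul_apply X, Module.End.mul_apply F X,
      LinearMap.smul_apply, hv, map_zero, smul_zero, zero_sub, neg_eq_zero] at h
    exact h
  have hS := hXsym.restrict_invariant hker
  set m := Module.finrank ℂ (LinearMap.ker F) with hm
  set w := hS.eigenvectorBasis hm.symm with hw
  set l := hS.eigenvalues hm.symm with hl
  have hvF : ∀ i, F (w i : V) = 0 := fun i => (w i).2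
  have hvX : ∀ i, X (w i : V) = (l i : ℂ) • (w i : V) := fun i =>
    congrArg Subtype.val (hS.apply_eigenvectorBasis hm.symm i)
  have hvn : ∀ i, ‖(w i : V)‖ = 1 := fun i => w.orthonormal.1 i
  have hvo : ∀ i j, i ≠ j → inner ℂ (w i : V) (w j : V) = 0 := fun i j hij => w.orthonormal.2 hij
  obtain ⟨N, hN⟩ := hnG
  have hex : ∀ i, ∃ a, (G ^ a) (w i : V) = 0 := fun i => ⟨N, by rw [hN]; rfl⟩
  classical
  set p : Fin m → ℕ := fun i => Nat.find (hex i) with hp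
  have hppos : ∀ i, 0 < p i := by
    intro i
    rw [hp, Nat.find_pos, pow_zero, Module.End.one_apply]
    intro h
    have := hvn i
    rw [h, norm_zero] at this
    exact zero_ne_one this
  have hne : ∀ i a, a < p i → (G ^ a) (w i : V) ≠ 0 := fun i a h => Nat.find_min (hex i) h
  have hzero : ∀ i a, p i ≤ a → (G ^ a) (w i : V) = 0 := by
    intro i a h
    obtain ⟨k, rfl⟩ := Nat.exists_eq_add_of_le h
    rw [add_comm, pow_add, Module.End.mul_apply, Nat.find_spec (hex i), map_zero]
  -- The norm of G^p w is zero while that of G^(p-1) w is not, so the factor p(l - (p - 1)) relating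
  -- their squares vanishes.
  have hlp : ∀ i, l i = (p i : ℝ) - 1 := by
    intro i
    obtain ⟨k, hk⟩ := Nat.exists_eq_add_of_lt (hppos i)
    rw [zero_add] at hk
    have h := norm_chain_succ hadj hXG (hvF i) (hvX i) k
    rw [hzero i (k + 1) hk.le, norm_zero, zero_pow two_ne_zero, eq_comm, mul_eq_zero,
      mul_eq_zero] at h
    have h1 : ‖(G ^ k) (w i : V)‖ ^ 2 ≠ 0 := by
      have := hne i k (by omega)
      positivity
    have h2 : (k : ℝ) + 1 ≠ 0 := by positivity
    have := (h.resolve_right h1).resolve_left h2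
    rw [hk]; push_cast; linarith
  set u : (Σ i, Fin (p i)) → V := fun x => ((‖(G ^ (x.2 : ℕ)) (w x.1 : V)‖⁻¹ : ℝ) : ℂ) •
    (G ^ (x.2 : ℕ)) (w x.1 : V) with hu
  have huo : Orthonormal ℂ u := by
    constructor
    · rintro ⟨i, a⟩
      have := norm_ne_zero_iff.2 (hne i a a.2)
      simp only [hu, norm_smul, Complex.norm_real, norm_inv, norm_norm]
      exact inv_mul_cancel₀ this
    · rintro ⟨i, a⟩ ⟨j, b⟩ hij
      simp only [hu, inner_smul_left, inner_smul_right]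
      rw [chain_orthogonal hadj hXG (hvF i) (hvX i) (hvF j) (hvX j), mul_zero, mul_zero]
      by_cases h : i = j
      · subst h
        right
        intro hab
        exact hij (by rw [Fin.ext hab])
      · exact Or.inl (hvo i j h)
  have hspan : ⊤ ≤ Submodule.span ℂ (Set.range u) := by
    rw [top_le_iff, ← Submodule.orthogonal_eq_bot_iff, Submodule.eq_bot_iff]
    intro y hy
    have hy' : ∀ i a, inner ℂ ((G ^ a) (w i : V)) y = 0 := by
      intro i a
      by_cases ha : a < p i
      · have h := hy (u ⟨i, ⟨a, ha⟩⟩) (Submodule.subset_span ⟨_, rfl⟩)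
        simp only [hu, inner_smul_left, mul_eq_zero] at h
        refine h.resolve_left ?_
        rw [Complex.conj_ofReal]
        refine Complex.ofReal_ne_zero.2 ?_
        exact inv_ne_zero (norm_ne_zero_iff.2 (hne i a ha))
      · rw [hzero i a (not_lt.1 ha), inner_zero_left]
    obtain ⟨M, hM⟩ := hnF
    -- If y is orthogonal to all strings, then F^k y is orthogonal to every w. Once it lies in ker F
    -- it is therefore zero, and k can be lowered to 0 from the nilpotency exponent.
    have hdesc : ∀ k, (F ^ k) y = 0 → y = 0 := by
      intro k
      induction k with
      | zero => simp
      | succ k ih =>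
        intro h
        apply ih
        have hmem : (F ^ k) y ∈ LinearMap.ker F := by
          rw [LinearMap.mem_ker, ← Module.End.mul_apply, ← pow_succ', h]
        have h0 : (⟨(F ^ k) y, hmem⟩ : LinearMap.ker F) = 0 := by
          refine w.repr.map_eq_zero_iff.1 (PiLp.ext fun i => ?_)
          rw [OrthonormalBasis.repr_apply_apply]
          change inner ℂ (w i : V) ((F ^ k) y) = 0
          rw [← inner_pow_left hadj]
          exact hy' i k
        exact congrArg Subtype.val h0
    exact hdesc M (by rw [hM]; rfl)
  refine ⟨m, p, OrthonormalBasis.mk huo hspan, hppos, ?_, ?_⟩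
  · intro i h
    simp [hu, hvF]
  · intro i a h
    have h0 := norm_ne_zero_iff.2 (hne i a (by omega))
    have h1 := norm_ne_zero_iff.2 (hne i (a + 1) h)
    have h2 := norm_chain_succ hadj hXG (hvF i) (hvX i) a
    have hla : l i - a = (p i : ℝ) - (a + 1 : ℝ) := by rw [hlp]; ring
    rw [hla] at h2
    have h3 : ‖(G ^ (a + 1)) (w i : V)‖ =
        Real.sqrt ((a + 1 : ℝ) * ((p i : ℝ) - (a + 1 : ℝ))) * ‖(G ^ a) (w i : V)‖ := by
      rw [← Real.sqrt_sq (norm_nonneg ((G ^ (a + 1)) (w i : V))), h2, Real.sqrt_mul',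
        Real.sqrt_sq (norm_nonneg _)]
      positivity
    have h4 : 0 ≤ (a + 1 : ℝ) * ((p i : ℝ) - (a + 1 : ℝ)) := by
      have : (a : ℝ) + 1 < p i := by exact_mod_cast h
      have h5 : 0 < (p i : ℝ) - (a + 1 : ℝ) := by linarith
      positivity
    rw [OrthonormalBasis.coe_mk]
    simp only [hu]
    rw [map_smul, chain_raise hXG (hvF i) (hvX i), smul_smul, smul_smul]
    congr 1
    have hlc : (l i : ℂ) - a = (((p i : ℝ) - (a + 1 : ℝ) : ℝ) : ℂ) := by
      rw [← hla]; push_cast; rfl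
    rw [hlc]
    have h6 : ((‖(G ^ (a + 1)) (w i : V)‖⁻¹ * ((a + 1 : ℝ) * ((p i : ℝ) - (a + 1 : ℝ))) : ℝ) : ℂ) =
        ((Real.sqrt ((a + 1 : ℝ) * ((p i : ℝ) - (a + 1 : ℝ))) * ‖(G ^ a) (w i : V)‖⁻¹ : ℝ) : ℂ) := by
      congr 1
      rw [inv_mul_eq_div, div_eq_iff h1, h3]
      nth_rewrite 1 [← Real.mul_self_sqrt h4]
      field_simp
    push_cast at h6 ⊢
    exact h6

end Chains

/-- Each nonzero power F^k would be an eigenvector of ad X with eigenvalue 2k, but ad X has operator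
norm at most 2‖X‖. -/
theorem isNilpotent_of_bracket {R : Type*} [NormedRing R] [NormedAlgebra ℂ R] {X F : R}
    (h : X * F - F * X = (2 : ℂ) • F) : IsNilpotent F := by
  have hk : ∀ k : ℕ, X * F ^ k - F ^ k * X = (2 * k : ℂ) • F ^ k := by
    intro k
    induction k with
    | zero => simp
    | succ k ih =>
      have e : X * F ^ (k + 1) - F ^ (k + 1) * X =
          (X * F ^ k - F ^ k * X) * F + F ^ k * (X * F - F * X) := by
        rw [pow_succ]; noncomm_ring
      rw [e, ih, h, smul_mul_assoc, mul_smul_comm, ← pow_succ, ← add_smul]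
      push_cast; ring_nf
  obtain ⟨k, hk'⟩ := exists_nat_gt ‖X‖
  refine ⟨k, ?_⟩
  by_contra h0
  have h1 : ‖(2 * k : ℂ) • F ^ k‖ ≤ 2 * ‖X‖ * ‖F ^ k‖ := by
    rw [← hk]
    calc _ ≤ ‖X * F ^ k‖ + ‖F ^ k * X‖ := norm_sub_le _ _
      _ ≤ ‖X‖ * ‖F ^ k‖ + ‖F ^ k‖ * ‖X‖ := add_le_add (norm_mul_le _ _) (norm_mul_le _ _)
      _ = _ := by ring
  have h2 : 0 < ‖F ^ k‖ := norm_pos_iff.2 h0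
  rw [norm_smul, norm_mul, Complex.norm_ofNat, Complex.norm_natCast] at h1
  nlinarith [le_of_mul_le_mul_right h1 h2]

theorem exists_equiv_of_map_univ_eq {ι κ α : Type*} [Fintype ι] [Fintype κ] [DecidableEq α]
    {f : ι → α} {g : κ → α}
    (h : (Finset.univ : Finset ι).val.map f = (Finset.univ : Finset κ).val.map g) :
    ∃ e : ι ≃ κ, ∀ i, f i = g (e i) := by
  have hc : ∀ c, Nonempty ({i // f i = c} ≃ {j // g j = c}) := by
    intro c
    rw [← Fintype.card_eq, Fintype.card_subtype, Fintype.card_subtype]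
    have := congrArg (Multiset.count c) h
    rw [Multiset.count_map, Multiset.count_map] at this
    simpa [Finset.card, Finset.filter, eq_comm] using this
  let e : ∀ c, {i // f i = c} ≃ {j // g j = c} := fun c => (hc c).some
  refine ⟨(Equiv.sigmaFiberEquiv f).symm.trans
    ((Equiv.sigmaCongrRight e).trans (Equiv.sigmaFiberEquiv g)), fun i => ?_⟩
  exact (e (f i) ⟨i, rfl⟩).2.symm

/-! ### Block matrices -/

section Blocks

variable {n : ℕ}

theorem diagBlocks_apply (π : n.Partition) (f : ∀ k : ℕ, Matrix (Fin k) (Fin k) ℂ)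
    (x y : Σ i : Fin (partList π).length, Fin ((partList π).get i)) :
    diagBlocks π f (blockEquiv π x) (blockEquiv π y) =
      blockDiagonal' (fun i : Fin (partList π).length => f ((partList π).get i)) x y := by
  simp [diagBlocks]

theorem map_get_partList (π : n.Partition) :
    (Finset.univ : Finset (Fin (partList π).length)).val.map (partList π).get = π.parts := by
  have : (↑(partList π) : Multiset ℕ) = π.parts := Multiset.sort_eq _ _
  rw [← this, Fin.univ_val_map, List.ofFn_get]

theorem exists_chain_basis_reindex {V ι κ : Type*} [NormedAddCommGroup V] [InnerProductSpace ℂ V]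
    [Fintype ι] [Fintype κ] {F : Module.End ℂ V} {p : ι → ℕ} {q : κ → ℕ} {σ : ι ≃ κ}
    (hσ : ∀ i, p i = q (σ i)) (b : OrthonormalBasis (Σ i, Fin (p i)) ℂ V)
    (hb0 : ∀ i (h : 0 < p i), F (b ⟨i, ⟨0, h⟩⟩) = 0)
    (hb1 : ∀ i a (h : a + 1 < p i), F (b ⟨i, ⟨a + 1, h⟩⟩) =
        ((Real.sqrt ((a + 1 : ℝ) * ((p i : ℝ) - (a + 1 : ℝ))) : ℝ) : ℂ) •
          b ⟨i, ⟨a, (Nat.lt_succ_self a).trans h⟩⟩) :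
    ∃ b : OrthonormalBasis (Σ k, Fin (q k)) ℂ V, (∀ k (h : 0 < q k), F (b ⟨k, ⟨0, h⟩⟩) = 0) ∧
      ∀ k a (h : a + 1 < q k), F (b ⟨k, ⟨a + 1, h⟩⟩) =
        ((Real.sqrt ((a + 1 : ℝ) * ((q k : ℝ) - (a + 1 : ℝ))) : ℝ) : ℂ) •
          b ⟨k, ⟨a, (Nat.lt_succ_self a).trans h⟩⟩ := by
  obtain rfl : p = fun i => q (σ i) := funext hσ
  have e : ∀ i (a : Fin (q (σ i))),
      (Equiv.sigmaCongrLeft (β := fun k => Fin (q k)) σ).symm ⟨σ i, a⟩ = ⟨i, a⟩ := fun i a => by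
    rw [Equiv.symm_apply_eq]; rfl
  refine ⟨b.reindex (Equiv.sigmaCongrLeft (β := fun k => Fin (q k)) σ), ?_, ?_⟩
  · intro k h
    obtain ⟨i, rfl⟩ := σ.surjective k
    rw [OrthonormalBasis.reindex_apply, e]
    exact hb0 i h
  · intro k a h
    obtain ⟨i, rfl⟩ := σ.surjective k
    rw [OrthonormalBasis.reindex_apply, OrthonormalBasis.reindex_apply, e, e]
    exact hb1 i a h

/-- The basis vectors are the columns of the unitary matrix U, and the hypotheses say EU = U
`diagBlocks π eMat`. -/
theorem usim_diagBlocks_eMat_of_basis {E : Matrix (Fin n) (Fin n) ℂ} {π : n.Partition}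
    (b : OrthonormalBasis (Σ i : Fin (partList π).length, Fin ((partList π).get i)) ℂ
      (EuclideanSpace ℂ (Fin n)))
    (hb0 : ∀ i (h : 0 < (partList π).get i), toEuclideanLin E (b ⟨i, ⟨0, h⟩⟩) = 0)
    (hb1 : ∀ i a (h : a + 1 < (partList π).get i), toEuclideanLin E (b ⟨i, ⟨a + 1, h⟩⟩) =
        ((Real.sqrt ((a + 1 : ℝ) * (((partList π).get i : ℝ) - (a + 1 : ℝ))) : ℝ) : ℂ) •
          b ⟨i, ⟨a, (Nat.lt_succ_self a).trans h⟩⟩) :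
    USim (diagBlocks π eMat) E := by
  have hb : ∀ i (a : Fin ((partList π).get i)), toEuclideanLin E (b ⟨i, a⟩) =
      ∑ a', eMat ((partList π).get i) a' a • b ⟨i, a'⟩ := by
    rintro i ⟨a, ha⟩
    rcases a with _ | a
    · rw [hb0]
      symm
      apply Finset.sum_eq_zero
      intro a' _
      simp [eMat]
    · rw [hb1, Finset.sum_eq_single ⟨a, (Nat.lt_succ_self a).trans ha⟩]
      · simp [eMat]
      · intro a' _ ha'
        have : ¬ ((a' : ℕ) + 1 = a + 1) := fun h => ha' (Fin.ext (Nat.succ_injective h))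
        simp only [eMat, of_apply]
        rw [if_neg this, zero_smul]
      · simp
  set U : Matrix (Fin n) (Fin n) ℂ := of fun r j => b ((blockEquiv π).symm j) r with hU
  have hUu : star U * U = 1 := by
    ext j k
    have := orthonormal_iff_ite.1 b.orthonormal ((blockEquiv π).symm j) ((blockEquiv π).symm k)
    rw [PiLp.inner_apply] at this
    simp only [mul_apply, star_apply, hU, of_apply, one_apply]
    simpa [mul_comm] using this
  have hEU : E * U = U * diagBlocks π eMat := by
    ext r j
    obtain ⟨⟨i, a⟩, rfl⟩ := (blockEquiv π).surjective j
    have h1 := congrArg (fun v : EuclideanSpace ℂ (Fin n) => v r) (hb i a)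
    simp only [toLpLin_apply] at h1
    rw [mul_apply, mul_apply]
    refine Eq.trans ?_ ((blockEquiv π).sum_comp _)
    rw [Fintype.sum_sigma]
    simp only [diagBlocks_apply, hU, of_apply, Equiv.symm_apply_apply]
    rw [Finset.sum_eq_single i]
    · simp only [blockDiagonal'_apply_eq]
      simpa [mulVec, dotProduct, mul_comm] using h1
    · intro i' _ hi'
      apply Finset.sum_eq_zero
      intro a' _
      rw [blockDiagonal'_apply_ne _ _ _ hi', mul_zero]
    · simp
  have hUu' : U * star U = 1 := mul_eq_one_comm.1 hUu
  refine ⟨U, mem_unitaryGroup_iff'.2 hUu, ?_⟩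
  rw [← hEU, mul_assoc, hUu', mul_one]

/-- A triple is unitarily similar to a standard one. -/
theorem IsTriple.exists_usim {E : Matrix (Fin n) (Fin n) ℂ} (hE : IsTriple E) :
    ∃ π : n.Partition, USim (diagBlocks π eMat) E := by
  set F : Module.End ℂ (EuclideanSpace ℂ (Fin n)) := toEuclideanLin E with hF
  set G : Module.End ℂ (EuclideanSpace ℂ (Fin n)) := toEuclideanLin Eᴴ with hG
  have hmul : ∀ A B : Matrix (Fin n) (Fin n) ℂ, (toEuclideanLin (A * B) : Module.End ℂ _) =
      (toEuclideanLin A : Module.End ℂ _) * toEuclideanLin B := by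
    intro A B
    ext1 v
    simp [Module.End.mul_apply, toLpLin_apply]
  have hX : F * G - G * F = toEuclideanLin (mom E) := by
    rw [mom, map_sub, hmul, hmul]
  have hXF : (F * G - G * F) * F - F * (F * G - G * F) = (2 : ℂ) • F := by
    rw [hX, hF, ← hmul, ← hmul, ← map_sub, hE, map_smul]
  have hXG : (F * G - G * F) * G - G * (F * G - G * F) = -((2 : ℂ) • G) := by
    rw [hX, hG, ← hmul, ← hmul, ← map_sub, hE.bracket_conjTranspose, map_neg, map_smul]
  have hpow : ∀ (A : Matrix (Fin n) (Fin n) ℂ) k, (toEuclideanLin A : Module.End ℂ _) ^ k =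
      toEuclideanLin (A ^ k) := by
    intro A k
    induction k with
    | zero => ext1 v; simp
    | succ k ih => rw [pow_succ, pow_succ, hmul, ih]
  have hnE : IsNilpotent E := by
    open scoped Matrix.Norms.Operator in
    exact isNilpotent_of_bracket (X := mom E) hE
  have hnF : IsNilpotent F := by
    obtain ⟨k, hk⟩ := hnE
    exact ⟨k, by rw [hF, hpow, hk, map_zero]⟩
  have hnG : IsNilpotent G := by
    obtain ⟨k, hk⟩ := hnE
    exact ⟨k, by rw [hG, hpow, ← conjTranspose_pow, hk, conjTranspose_zero, map_zero]⟩
  have hadj : ∀ x y, inner ℂ (G x) y = inner ℂ x (F y) := by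
    intro x y
    rw [hG, toEuclideanLin_conjTranspose_eq_adjoint, LinearMap.adjoint_inner_left]
  obtain ⟨m, p, b, hp, hb0, hb1⟩ := exists_chain_basis hadj hXF hXG hnF hnG
  have hcard : ∑ i, p i = n := by
    have h1 := Module.finrank_eq_card_basis b.toBasis
    rw [finrank_euclideanSpace_fin, Fintype.card_sigma] at h1
    simpa using h1.symm
  let π : n.Partition := ⟨Finset.univ.val.map p, by
    intro i hi
    obtain ⟨j, -, rfl⟩ := Multiset.mem_map.1 hi
    exact hp j, hcard⟩
  obtain ⟨σ, hσ⟩ := exists_equiv_of_map_univ_eq (f := p) (g := (partList π).get)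
    (map_get_partList π).symm
  obtain ⟨b', hb0', hb1'⟩ := exists_chain_basis_reindex hσ b hb0 hb1
  exact ⟨π, usim_diagBlocks_eMat_of_basis b' hb0' hb1'⟩

end Blocks

end OrbitK

namespace OrbitK

/-! ### Standard triples, their weights and their Jordan type -/

section StandardBlocks

variable {n : ℕ}

theorem diagBlocks_mul (π : n.Partition) (f g : ∀ k : ℕ, Matrix (Fin k) (Fin k) ℂ) :
    diagBlocks π f * diagBlocks π g = diagBlocks π fun k => f k * g k := by
  simp only [diagBlocks, reindex_apply, submatrix_mul_equiv, ← blockDiagonal'_mul]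

theorem diagBlocks_conjTranspose (π : n.Partition) (f : ∀ k : ℕ, Matrix (Fin k) (Fin k) ℂ) :
    (diagBlocks π f)ᴴ = diagBlocks π fun k => (f k)ᴴ := by
  simp only [diagBlocks, reindex_apply, conjTranspose_submatrix, blockDiagonal'_conjTranspose]

theorem diagBlocks_sub (π : n.Partition) (f g : ∀ k : ℕ, Matrix (Fin k) (Fin k) ℂ) :
    diagBlocks π f - diagBlocks π g = diagBlocks π fun k => f k - g k := by
  ext x y
  simp only [diagBlocks, reindex_apply, submatrix_apply, Matrix.sub_apply, blockDiagonal'_apply]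
  split_ifs <;> simp

theorem diagBlocks_add (π : n.Partition) (f g : ∀ k : ℕ, Matrix (Fin k) (Fin k) ℂ) :
    diagBlocks π f + diagBlocks π g = diagBlocks π fun k => f k + g k := by
  ext x y
  simp only [diagBlocks, reindex_apply, submatrix_apply, Matrix.add_apply, blockDiagonal'_apply]
  split_ifs <;> simp

theorem diagBlocks_smul (π : n.Partition) (c : ℂ) (f : ∀ k : ℕ, Matrix (Fin k) (Fin k) ℂ) :
    c • diagBlocks π f = diagBlocks π fun k => c • f k := by
  ext x y
  simp only [diagBlocks, reindex_apply, submatrix_apply, Matrix.smul_apply, blockDiagonal'_apply]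
  split_ifs <;> simp

theorem diagBlocks_one (π : n.Partition) : diagBlocks π (fun _ => 1) = 1 := by
  have : (fun i : Fin (partList π).length => (1 : Matrix (Fin ((partList π).get i)) (Fin ((partList π).get i)) ℂ))
      = 1 := rfl
  rw [diagBlocks, this, blockDiagonal'_one, reindex_apply, submatrix_one_equiv]

theorem diagBlocks_pow (π : n.Partition) (f : ∀ k : ℕ, Matrix (Fin k) (Fin k) ℂ) (j : ℕ) :
    diagBlocks π f ^ j = diagBlocks π fun k => f k ^ j := by
  induction j with
  | zero => simp only [pow_zero, diagBlocks_one]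
  | succ j ih => simp only [pow_succ, ih, diagBlocks_mul]

theorem diagBlocks_diagonal (π : n.Partition) (d : ∀ k : ℕ, Fin k → ℂ) :
    diagBlocks π (fun k => diagonal (d k)) =
      diagonal fun x => d _ ((blockEquiv π).symm x).2 := by
  rw [diagBlocks, blockDiagonal'_diagonal, reindex_apply, submatrix_diagonal_equiv]
  rfl

theorem eMat_conjTranspose (k : ℕ) : (eMat k)ᴴ = (eMat k)ᵀ := by
  ext i j
  simp only [eMat, conjTranspose_apply, transpose_apply, of_apply]
  split_ifs <;> simp

theorem eMat_mul_transpose (k : ℕ) : eMat k * (eMat k)ᵀ =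
    diagonal fun a : Fin k => ((a : ℕ) + 1 : ℂ) * (k - ((a : ℕ) + 1)) := by
  ext a b
  rw [mul_apply]
  by_cases ha : (a : ℕ) + 1 < k
  · have h0 : 0 ≤ (((a : ℕ) : ℝ) + 1) * ((k : ℝ) - (((a : ℕ) : ℝ) + 1)) := by
      have : ((a : ℕ) : ℝ) + 1 < k := by exact_mod_cast ha
      have h5 : 0 < (k : ℝ) - (((a : ℕ) : ℝ) + 1) := by linarith
      positivity
    rw [Finset.sum_eq_single ⟨(a : ℕ) + 1, ha⟩]
    · by_cases hab : a = b
      · subst hab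
        simp only [eMat, transpose_apply, of_apply, if_true, diagonal_apply_eq]
        rw [← Complex.ofReal_mul, Real.mul_self_sqrt h0]
        push_cast; rfl
      · have : ¬ ((b : ℕ) + 1 = (a : ℕ) + 1) := fun h => hab (Fin.ext (by omega))
        simp only [eMat, transpose_apply, of_apply, diagonal_apply_ne _ hab]
        rw [if_neg this, mul_zero]
    · intro c _ hc
      have : ¬ ((a : ℕ) + 1 = c) := fun h => hc (Fin.ext h.symm)
      simp [eMat, this]
    · simp
  · have hk : (a : ℕ) + 1 = k := by omega
    rw [Finset.sum_eq_zero]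
    · by_cases hab : a = b
      · subst hab
        have : ((a : ℕ) + 1 : ℂ) = k := by exact_mod_cast hk
        rw [diagonal_apply_eq, this, sub_self, mul_zero]
      · rw [diagonal_apply_ne _ hab]
    · intro c _
      have : ¬ ((a : ℕ) + 1 = c) := by have := c.2; omega
      simp [eMat, this]

theorem transpose_mul_eMat (k : ℕ) : (eMat k)ᵀ * eMat k =
    diagonal fun a : Fin k => ((a : ℕ) : ℂ) * (k - (a : ℕ)) := by
  ext a b
  rw [mul_apply]
  rcases Nat.eq_zero_or_pos (a : ℕ) with ha | ha
  · rw [Finset.sum_eq_zero]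
    · by_cases hab : a = b
      · subst hab
        rw [diagonal_apply_eq, ha]; simp
      · rw [diagonal_apply_ne _ hab]
    · intro c _
      have : ¬ ((c : ℕ) + 1 = a) := by omega
      simp [eMat, this]
  · obtain ⟨a', ha'⟩ := Nat.exists_eq_add_of_lt ha
    rw [zero_add] at ha'
    have hlt := a.2
    have h0 : 0 ≤ ((a' : ℝ) + 1) * ((k : ℝ) - ((a' : ℝ) + 1)) := by
      have : (a' : ℝ) + 1 < k := by exact_mod_cast (by omega : a' + 1 < k)
      have h5 : 0 < (k : ℝ) - ((a' : ℝ) + 1) := by linarith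
      positivity
    rw [Finset.sum_eq_single ⟨a', by omega⟩]
    · by_cases hab : a = b
      · subst hab
        simp only [eMat, transpose_apply, of_apply, ha', if_true, diagonal_apply_eq]
        rw [← Complex.ofReal_mul, Real.mul_self_sqrt h0]
        push_cast; rfl
      · have : ¬ (a' + 1 = (b : ℕ)) := fun h => hab (Fin.ext (by omega))
        simp [eMat, this, diagonal_apply_ne _ hab]
    · intro c _ hc
      have : ¬ ((c : ℕ) + 1 = a) := fun h => hc (Fin.ext (by change (c : ℕ) = a'; omega))
      simp [eMat, this]
    · simp

theorem eMat_bracket (k : ℕ) : eMat k * (eMat k)ᴴ - (eMat k)ᴴ * eMat k = xMat k := by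
  rw [eMat_conjTranspose, eMat_mul_transpose, transpose_mul_eMat, diagonal_sub, xMat]
  congr 1
  ext a
  ring

theorem xMat_bracket (k : ℕ) : xMat k * eMat k - eMat k * xMat k = (2 : ℂ) • eMat k := by
  ext a b
  simp only [xMat, Matrix.sub_apply, diagonal_mul, mul_diagonal, Matrix.smul_apply, smul_eq_mul]
  by_cases h : (a : ℕ) + 1 = b
  · rw [← h]; push_cast; ring
  · simp [eMat, h]

theorem mom_diagBlocks_eMat (π : n.Partition) :
    mom (diagBlocks π eMat) = diagBlocks π xMat := by
  rw [mom, diagBlocks_conjTranspose, diagBlocks_mul, diagBlocks_mul, diagBlocks_sub]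
  simp only [eMat_bracket]

theorem isTriple_diagBlocks_eMat (π : n.Partition) : IsTriple (diagBlocks π eMat) := by
  rw [IsTriple, mom_diagBlocks_eMat, diagBlocks_mul, diagBlocks_mul, diagBlocks_sub,
    diagBlocks_smul]
  simp only [xMat_bracket]

theorem diagBlocks_jRep (π : n.Partition) (M : Matrix (Fin 2) (Fin 2) ℂ) :
    diagBlocks π (jRep M) = tripleComb (diagBlocks π eMat) (M 0 1) (M 1 0) (M 0 0) := by
  rw [tripleComb, mom_diagBlocks_eMat, diagBlocks_conjTranspose, diagBlocks_smul, diagBlocks_smul,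
    diagBlocks_smul, diagBlocks_add, diagBlocks_add]
  simp only [eMat_conjTranspose]
  rfl

/-- `stdSl2 π` consists of the combinations of the standard triple. -/
theorem mem_stdSl2_iff {π : n.Partition} {B : Matrix (Fin n) (Fin n) ℂ} :
    B ∈ stdSl2 π ↔ ∃ a b c : ℂ, B = tripleComb (diagBlocks π eMat) a b c := by
  constructor
  · rintro ⟨M, -, rfl⟩
    exact ⟨_, _, _, diagBlocks_jRep π M⟩
  · rintro ⟨a, b, c, rfl⟩
    refine ⟨!![c, a; b, -c], by simp [trace_fin_two], ?_⟩
    rw [diagBlocks_jRep]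
    simp

/-- The weights of the standard triple: the diagonal entries of `diag(x_{n_1}, …, x_{n_s})`. -/
def weight (π : n.Partition) (x : Fin n) : ℤ :=
  ((partList π).get ((blockEquiv π).symm x).1 : ℤ) - 1 - 2 * (((blockEquiv π).symm x).2 : ℕ)

theorem weight_blockEquiv (π : n.Partition)
    (x : Σ i : Fin (partList π).length, Fin ((partList π).get i)) :
    weight π (blockEquiv π x) = ((partList π).get x.1 : ℤ) - 1 - 2 * (x.2 : ℕ) := by
  rw [weight, Equiv.symm_apply_apply]

theorem diagBlocks_xMat (π : n.Partition) :
    diagBlocks π xMat = diagonal fun x => (weight π x : ℂ) := by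
  have : xMat = fun k => diagonal fun i : Fin k => (k : ℂ) - 1 - 2 * ((i : ℕ) : ℂ) := rfl
  rw [this, diagBlocks_diagonal]
  congr 1
  ext x
  simp [weight]

theorem Lam_eq (k : ℕ) :
    Lam k = (Multiset.range k).map fun i : ℕ => (k : ℤ) - 1 - 2 * (i : ℤ) := by
  simp [Lam]

theorem map_weight (π : n.Partition) :
    (Finset.univ : Finset (Fin n)).val.map (weight π) = π.parts.bind Lam := by
  have hsum : ∀ {ι : Type} [Fintype ι] (f : ι → ℤ),
      (Finset.univ : Finset ι).val.map f = ∑ i, ({f i} : Multiset ℤ) := fun f => by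
    rw [← Multiset.sum_map_singleton (Multiset.map f _), Multiset.map_map]; rfl
  rw [hsum, ← (blockEquiv π).sum_comp, Fintype.sum_sigma, ← map_get_partList, Multiset.bind_map]
  change _ = ∑ i, Lam ((partList π).get i)
  refine Finset.sum_congr rfl fun i _ => ?_
  have : (Multiset.range ((partList π).get i)) =
      (Finset.univ : Finset (Fin ((partList π).get i))).val.map Fin.val := by
    rw [Fin.univ_val_map, List.ofFn_eq_map, List.map_coe_finRange_eq_range]; rfl
  rw [Lam_eq, this, Multiset.map_map, hsum]
  refine Finset.sum_congr rfl fun a _ => ?_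
  rw [weight_blockEquiv]
  rfl

theorem sum_Lam_sq (k : ℕ) :
    ((Lam k).map fun a : ℤ => (a : ℝ) ^ 2).sum = (k : ℝ) * ((k : ℝ) ^ 2 - 1) / 3 := by
  have h : ∀ (m : ℕ) (c : ℝ), ∑ i ∈ Finset.range m, (c - 2 * (i : ℝ)) ^ 2 =
      m * c ^ 2 - 2 * c * (m * (m - 1)) + 2 / 3 * (m - 1) * m * (2 * m - 1) := by
    intro m c
    induction m with
    | zero => simp
    | succ m ih => rw [Finset.sum_range_succ, ih]; push_cast; ring
  have h2 := h k (k - 1)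
  rw [Lam_eq, Multiset.map_map]
  change ∑ i ∈ Finset.range k, (((k : ℤ) - 1 - 2 * (i : ℤ) : ℤ) : ℝ) ^ 2 = _
  push_cast
  rw [h2]
  ring

theorem sum_weight_sq (π : n.Partition) : ∑ x, (weight π x : ℝ) ^ 2 =
    (π.parts.map fun p : ℕ => (p : ℝ) * ((p : ℝ) ^ 2 - 1)).sum / 3 := by
  have : ∑ x, (weight π x : ℝ) ^ 2 =
      (((Finset.univ : Finset (Fin n)).val.map (weight π)).map fun a : ℤ => (a : ℝ) ^ 2).sum := by
    rw [Multiset.map_map]; rfl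
  rw [this, map_weight, Multiset.map_bind, Multiset.sum_bind]
  simp only [sum_Lam_sq]
  rw [Multiset.sum_map_div]

theorem C_eq (π : n.Partition) : C π = 4 / ∑ x, (weight π x : ℝ) ^ 2 := by
  rw [sum_weight_sq, C, div_div_eq_mul_div]
  norm_num

theorem normSq_diagonal (d : Fin n → ℂ) : normSq (diagonal d) = ∑ x, ‖d x‖ ^ 2 := by
  rw [normSq_eq_sum]
  refine Finset.sum_congr rfl fun i _ => ?_
  rw [Finset.sum_eq_single i]
  · simp
  · intro j _ hj; simp [diagonal_apply_ne _ hj.symm]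
  · simp

theorem normSq_diagBlocks_xMat (π : n.Partition) :
    normSq (diagBlocks π xMat) = ∑ x, (weight π x : ℝ) ^ 2 := by
  rw [diagBlocks_xMat, normSq_diagonal]
  simp

theorem C_eq_normSq (π : n.Partition) : C π = 2 / normSq (diagBlocks π eMat) := by
  have h := (isTriple_diagBlocks_eMat π).normSq_mom
  rw [mom_diagBlocks_eMat, normSq_diagBlocks_xMat] at h
  rw [C_eq, h, ← mul_div_mul_left 2 _ two_ne_zero]
  norm_num

theorem sim_diagBlocks (π : n.Partition) {f g P Q : ∀ k : ℕ, Matrix (Fin k) (Fin k) ℂ}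
    (h1 : ∀ k, P k * Q k = 1) (h2 : ∀ k, g k = P k * f k * Q k) :
    Sim (diagBlocks π f) (diagBlocks π g) := by
  refine ⟨diagBlocks π P, diagBlocks π Q, ?_, ?_⟩
  · rw [diagBlocks_mul]; simp only [h1, diagBlocks_one]
  · rw [diagBlocks_mul, diagBlocks_mul]; simp only [← h2]

/-- The Jordan blocks are similar to the standard nilpotent matrices. -/
theorem sim_diagBlocks_jordanBlock (π : n.Partition) :
    Sim (diagBlocks π jordanBlock) (diagBlocks π eMat) := by
  set E := diagBlocks π eMat with hE
  have hT : IsTriple E := isTriple_diagBlocks_eMat π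
  have h1 : Sim (diagBlocks π jordanBlock) Eᴴ := by
    rw [hE, diagBlocks_conjTranspose]
    let s : ℕ → ℕ → ℂ := fun k i => ((Real.sqrt (((i : ℕ) + 1 : ℝ) * ((k : ℝ) - ((i : ℕ) + 1 : ℝ))) : ℝ) : ℂ)
    -- Conjugating by the diagonal matrix of these partial products turns the subdiagonal entries 1
    -- into d_{i+1}/d_i = s_i.
    let d : ℕ → ℕ → ℂ := fun k i => ∏ l ∈ Finset.range i, s k l
    have hs : ∀ k i, i + 1 < k → s k i ≠ 0 := by
      intro k i h
      have : (i : ℝ) + 1 < k := by exact_mod_cast h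
      have h5 : 0 < (k : ℝ) - ((i : ℝ) + 1) := by linarith
      refine Complex.ofReal_ne_zero.2 (Real.sqrt_pos.2 ?_).ne'
      positivity
    have hd : ∀ k (i : Fin k), d k i ≠ 0 := by
      intro k i
      refine Finset.prod_ne_zero_iff.2 fun l hl => hs k l ?_
      have := Finset.mem_range.1 hl
      have := i.2
      omega
    refine sim_diagBlocks π (P := fun k => diagonal fun i : Fin k => d k i)
      (Q := fun k => diagonal fun i : Fin k => (d k i)⁻¹) (fun k => ?_) (fun k => ?_)
    · rw [diagonal_mul_diagonal, ← diagonal_one]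
      congr 1
      ext i
      exact mul_inv_cancel₀ (hd k i)
    · ext i j
      rw [mul_diagonal, diagonal_mul, eMat_conjTranspose]
      by_cases h : (i : ℕ) = (j : ℕ) + 1
      · have e1 : d k i = d k j * s k j := by
          simp only [d]; rw [h, Finset.prod_range_succ]
        simp only [eMat, jordanBlock, transpose_apply, of_apply, h, if_true, mul_one]
        rw [← h, e1, mul_comm (d k j), mul_assoc, mul_inv_cancel₀ (hd k j), mul_one]
      · have h' : ¬ ((j : ℕ) + 1 = i) := fun h' => h h'.symm
        simp [eMat, jordanBlock, h, h']
  by_cases h0 : Eᴴ = 0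
  · have : E = 0 := by simpa using h0
    rw [h0] at h1
    rwa [this]
  -- E* is a nonzero nilpotent element of the sl(2) of E, hence similar to E.
  · have h2 := (hT.sim_tripleComb (a := 0) (b := 1) (c := 0) (z := 0)
      (by simpa [tripleComb] using h0) (by simp)).2 rfl
    simp only [tripleComb, zero_smul, one_smul, zero_add, add_zero] at h2
    exact h1.trans h2

theorem jordanBlock_pow_apply (k j : ℕ) (a b : Fin k) :
    (jordanBlock k ^ j) a b = if (a : ℕ) = b + j then 1 else 0 := by
  induction j generalizing a b with
  | zero => simp [one_apply, Fin.ext_iff]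
  | succ j ih =>
    rw [pow_succ, mul_apply]
    simp only [ih]
    simp only [jordanBlock, of_apply]
    by_cases hb : (b : ℕ) + 1 < k
    · rw [Finset.sum_eq_single ⟨(b : ℕ) + 1, hb⟩]
      · simp [add_assoc, add_comm 1]
      · intro c _ hc
        have : ¬ ((c : ℕ) = b + 1) := fun h => hc (Fin.ext h)
        simp [this]
      · simp
    · have hb' := a.2
      rw [Finset.sum_eq_zero, if_neg (by omega)]
      intro c _
      have : ¬ ((c : ℕ) = b + 1) := by have := c.2; omega
      simp [this]

open scoped ComplexOrder in
-- For a block J of size k, (J^j)* J^j is a diagonal 0-1 matrix with k - j ones (truncated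
-- subtraction).
theorem rank_jordanBlock_pow (π : n.Partition) (j : ℕ) :
    (diagBlocks π jordanBlock ^ j).rank = (π.parts.map fun p => p - j).sum := by
  have h1 : ∀ k, (jordanBlock k ^ j)ᴴ * jordanBlock k ^ j =
      diagonal fun b : Fin k => if (b : ℕ) + j < k then (1 : ℂ) else 0 := by
    intro k
    ext b b'
    rw [mul_apply]
    simp only [conjTranspose_apply, jordanBlock_pow_apply]
    by_cases hb : (b : ℕ) + j < k
    · rw [Finset.sum_eq_single ⟨(b : ℕ) + j, hb⟩]
      · by_cases hbb : b = b'
        · subst hbb; simp [hb]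
        · have : ¬ ((b : ℕ) = b') := fun h => hbb (Fin.ext h)
          simp [diagonal_apply_ne _ hbb, this]
      · intro c _ hc
        have : ¬ ((c : ℕ) = b + j) := fun h => hc (Fin.ext h)
        simp [this]
      · simp
    · rw [Finset.sum_eq_zero]
      · by_cases hbb : b = b'
        · subst hbb; simp [hb]
        · rw [diagonal_apply_ne _ hbb]
      · intro c _
        have : ¬ ((c : ℕ) = b + j) := by have := c.2; omega
        simp [this]
  rw [← rank_conjTranspose_mul_self, diagBlocks_pow, diagBlocks_conjTranspose, diagBlocks_mul]
  simp only [h1]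
  rw [diagBlocks_diagonal, rank_diagonal]
  have h2 : Fintype.card {x : Fin n // (if (((blockEquiv π).symm x).2 : ℕ) + j <
      (partList π).get ((blockEquiv π).symm x).1 then (1 : ℂ) else 0) ≠ 0} =
      Fintype.card {x : Σ i : Fin (partList π).length, Fin ((partList π).get i) //
        (x.2 : ℕ) + j < (partList π).get x.1} := by
    refine Fintype.card_congr ((blockEquiv π).symm.subtypeEquiv fun x => ?_)
    simp
  rw [h2, Fintype.card_subtype, Finset.card_filter, Fintype.sum_sigma, ← map_get_partList,
    Multiset.map_map]
  change _ = ∑ i, ((partList π).get i - j)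
  refine Finset.sum_congr rfl fun i _ => ?_
  rw [← Finset.card_filter]
  have h3 : ∀ k, (Finset.univ.filter fun a : Fin k => (a : ℕ) + j < k).card = k - j := by
    intro k
    rw [← Finset.card_range (k - j), ← Finset.card_map Fin.valEmbedding]
    congr 1
    ext a
    simp only [Finset.mem_map, Finset.mem_filter, Finset.mem_univ, true_and, Fin.valEmbedding_apply,
      Finset.mem_range]
    constructor
    · rintro ⟨b, hb, rfl⟩; omega
    · intro h; exact ⟨⟨a, by omega⟩, by simpa using by omega, rfl⟩
  exact h3 _

/-- The Jordan type of a nilpotent matrix is determined by its similarity class. -/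
theorem partition_eq_of_sim {π π' : n.Partition}
    (h : Sim (diagBlocks π eMat) (diagBlocks π' eMat)) : π = π' := by
  have h1 := (sim_diagBlocks_jordanBlock π).trans (h.trans (sim_diagBlocks_jordanBlock π').symm)
  have hr : ∀ j, (π.parts.map fun p => p - j).sum = (π'.parts.map fun p => p - j).sum := fun j => by
    rw [← rank_jordanBlock_pow, ← rank_jordanBlock_pow, (h1.pow j).rank_eq]
  -- The truncated difference p - j, as a function of j, has second difference 1 at p = j + 1 and 0
  -- elsewhere; so ranks of powers count the parts.
  have hc : ∀ (s : Multiset ℕ) (j : ℕ), (s.map fun p => p - j).sum + (s.map fun p => p - (j + 2)).sum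
      = 2 * (s.map fun p => p - (j + 1)).sum + s.count (j + 1) := by
    intro s j
    induction s using Multiset.induction_on with
    | empty => simp
    | cons p s ih =>
      simp only [Multiset.map_cons, Multiset.sum_cons, Multiset.count_cons]
      split_ifs <;> omega
  ext1
  ext j
  rcases j with _ | j
  · rw [Multiset.count_eq_zero.2 fun h => (π.parts_pos h).ne' rfl,
      Multiset.count_eq_zero.2 fun h => (π'.parts_pos h).ne' rfl]
  · have e1 := hc π.parts j
    have e2 := hc π'.parts j
    rw [hr, hr, hr] at e1
    omega

end StandardBlocks

end OrbitK

namespace OrbitK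

/-! ### Triangular forms and lower bounds for `K` -/

section Bounds

variable {n : ℕ}

/-- The QR decomposition. -/
theorem exists_unitary_mul_upper (Q : Matrix (Fin n) (Fin n) ℂ) :
    ∃ U ∈ unitaryGroup (Fin n) ℂ, ∃ R : Matrix (Fin n) (Fin n) ℂ, (∀ i j, j < i → R i j = 0) ∧
      Q = U * R := by
  let f : Fin n → EuclideanSpace ℂ (Fin n) := fun j => WithLp.toLp 2 fun i => Q i j
  have h : Module.finrank ℂ (EuclideanSpace ℂ (Fin n)) = Fintype.card (Fin n) := by simp
  let b := InnerProductSpace.gramSchmidtOrthonormalBasis h f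
  set U : Matrix (Fin n) (Fin n) ℂ := of fun i j => b j i with hU
  have hUu : star U * U = 1 := by
    ext j k
    have := orthonormal_iff_ite.1 b.orthonormal j k
    rw [PiLp.inner_apply] at this
    simp only [mul_apply, star_apply, hU, of_apply, one_apply]
    simpa [mul_comm] using this
  refine ⟨U, mem_unitaryGroup_iff'.2 hUu, star U * Q, fun i j hij => ?_, ?_⟩
  · have := InnerProductSpace.gramSchmidtOrthonormalBasis_inv_triangular h f hij
    rw [PiLp.inner_apply] at this
    rw [mul_apply]
    simp only [star_apply, hU, of_apply]
    simpa [f, mul_comm] using this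
  · rw [← mul_assoc, mul_eq_one_comm.1 hUu, one_mul]

theorem upper_of_mul_eq_one {R S : Matrix (Fin n) (Fin n) ℂ} (hR : ∀ i j, j < i → R i j = 0)
    (h : R * S = 1) : ∀ i j, j < i → S i j = 0 := by
  have hu : IsUnit R.det := isUnit_iff_ne_zero.2 fun h0 => by
    have := congrArg det h
    simp [h0] at this
  have : Invertible R := invertibleOfIsUnitDet R hu
  have hS : S = R⁻¹ := (inv_eq_right_inv h).symm
  have hb : BlockTriangular R id := fun i j hij => hR i j hij
  intro i j hij
  rw [hS]
  exact blockTriangular_inv_of_blockTriangular hb hij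

/-- Similarity reduces to similarity by an upper triangular matrix, up to unitary similarity. -/
theorem Sim.exists_upper {E B : Matrix (Fin n) (Fin n) ℂ} (h : Sim E B) :
    ∃ R S : Matrix (Fin n) (Fin n) ℂ, (∀ i j, j < i → R i j = 0) ∧ (∀ i j, j < i → S i j = 0) ∧
      R * S = 1 ∧ USim (R * E * S) B := by
  obtain ⟨Q, Q', h1, rfl⟩ := h
  obtain ⟨U, hU, R, hR, rfl⟩ := exists_unitary_mul_upper Q
  have h2 : R * (Q' * U) = 1 := by
    rw [← mul_assoc, mul_eq_one_comm, ← mul_assoc, h1]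
  refine ⟨R, Q' * U, hR, upper_of_mul_eq_one hR h2, h2, U, hU, ?_⟩
  calc U * R * E * Q' = U * R * E * Q' * (U * star U) := by
        rw [mem_unitaryGroup_iff.1 hU, mul_one]
    _ = _ := by noncomm_ring

theorem exists_antitone_comp_perm (w : Fin n → ℝ) : ∃ σ : Equiv.Perm (Fin n), Antitone (w ∘ σ) := by
  refine ⟨Tuple.sort fun i => -w i, fun i j hij => ?_⟩
  have := Tuple.monotone_sort (fun i => -w i) hij
  simpa using this

/-- Upper triangular conjugation only moves entries up and to the right. When the grading decreases
with the index, the degree of a matrix can thus only grow. -/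
theorem exists_ne_zero_of_upper_conj {R E S : Matrix (Fin n) (Fin n) ℂ}
    (hR : ∀ i j, j < i → R i j = 0) (hS : ∀ i j, j < i → S i j = 0) {i j : Fin n}
    (h : (R * E * S) i j ≠ 0) : ∃ k l, i ≤ k ∧ l ≤ j ∧ E k l ≠ 0 := by
  rw [mul_apply] at h
  obtain ⟨l, -, hl⟩ := Finset.exists_ne_zero_of_sum_ne_zero h
  have h1 := left_ne_zero_of_mul hl
  rw [mul_apply] at h1
  obtain ⟨k, -, hk⟩ := Finset.exists_ne_zero_of_sum_ne_zero h1
  refine ⟨k, l, ?_, ?_, right_ne_zero_of_mul hk⟩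
  · by_contra hki
    exact left_ne_zero_of_mul hk (hR i k (not_le.1 hki))
  · by_contra hlj
    exact right_ne_zero_of_mul hl (hS l j (not_le.1 hlj))

/-- A matrix similar to one of degree `d` for a real grading is unitarily similar to one of degree
at least `d`. -/
theorem Sim.exists_usim_of_graded {E B : Matrix (Fin n) (Fin n) ℂ} (h : Sim E B) {w : Fin n → ℝ}
    {d : ℝ} (hE : ∀ i j, E i j ≠ 0 → w j + d ≤ w i) :
    ∃ T : Matrix (Fin n) (Fin n) ℂ, (∀ i j, T i j ≠ 0 → w j + d ≤ w i) ∧ USim T B := by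
  obtain ⟨σ, hσ⟩ := exists_antitone_comp_perm w
  obtain ⟨R, S, hR, hS, -, hB⟩ := ((sim_submatrix_perm E σ).symm.trans h).exists_upper
  refine ⟨(R * E.submatrix σ σ * S).submatrix σ.symm σ.symm, fun i j hij => ?_,
    (usim_submatrix_perm _ σ.symm).symm.trans hB⟩
  obtain ⟨k, l, hk, hl, hkl⟩ := exists_ne_zero_of_upper_conj hR hS hij
  have h1 := hσ hk
  have h2 := hσ hl
  have h3 := hE _ _ hkl
  simp only [Function.comp_apply, Equiv.apply_symm_apply] at h1 h2
  linarith

/-- Only indices between i and j contribute to this entry; the diagonal matrix acts on them as a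
scalar, and RS = 1. -/
theorem upper_conj_diagonal_apply {R S : Matrix (Fin n) (Fin n) ℂ}
    (hR : ∀ i j, j < i → R i j = 0) (hS : ∀ i j, j < i → S i j = 0) (hRS : R * S = 1)
    (d : Fin n → ℂ) {i j : Fin n} (hd : ∀ k, i ≤ k → k ≤ j → d k = d i) :
    (R * diagonal d * S) i j = diagonal d i j := by
  have h1 : (R * diagonal d * S) i j = d i * (R * S) i j := by
    rw [mul_apply, mul_apply, Finset.mul_sum]
    refine Finset.sum_congr rfl fun k _ => ?_
    rw [mul_diagonal]
    by_cases hik : i ≤ k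
    · by_cases hkj : k ≤ j
      · rw [hd k hik hkj]; ring
      · rw [hS k j (not_le.1 hkj)]; ring
    · rw [hR i k (not_le.1 hik)]; ring
  rw [h1, hRS]
  by_cases hij : i = j
  · subst hij; simp
  · rw [one_apply_ne hij, diagonal_apply_ne _ hij, mul_zero]

/-- A matrix similar to a real diagonal one is unitarily similar to the sum of the diagonal matrix
and one raising the eigenvalues. -/
theorem Sim.exists_usim_diagonal_add {B : Matrix (Fin n) (Fin n) ℂ} {r : Fin n → ℝ}
    (h : Sim (diagonal fun i => (r i : ℂ)) B) :
    ∃ N : Matrix (Fin n) (Fin n) ℂ, (∀ i j, N i j ≠ 0 → r j < r i) ∧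
      USim ((diagonal fun i => (r i : ℂ)) + N) B := by
  obtain ⟨σ, hσ⟩ := exists_antitone_comp_perm r
  have e : (diagonal fun i => (r i : ℂ)).submatrix σ σ = diagonal fun i => (r (σ i) : ℂ) := by
    rw [submatrix_diagonal_equiv]; rfl
  have h' := (sim_submatrix_perm (diagonal fun i => (r i : ℂ)) σ).symm.trans h
  rw [e] at h'
  obtain ⟨R, S, hR, hS, hRS, hB⟩ := h'.exists_upper
  have hT : ∀ i j, r (σ i) ≤ r (σ j) →
      (R * (diagonal fun i => (r (σ i) : ℂ)) * S) i j = (diagonal fun i => (r (σ i) : ℂ)) i j := by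
    intro i j hij
    refine upper_conj_diagonal_apply hR hS hRS _ fun k hik hkj => ?_
    have h1 := hσ hik
    have h2 := hσ hkj
    simp only [Function.comp_apply] at h1 h2
    have : r (σ k) = r (σ i) := le_antisymm h1 (hij.trans h2)
    simp [this]
  have e2 : (diagonal fun i => (r i : ℂ)) = (diagonal fun i => (r (σ i) : ℂ)).submatrix σ.symm σ.symm := by
    rw [submatrix_diagonal_equiv]
    congr 1
    ext i; simp
  refine ⟨(R * (diagonal fun i => (r (σ i) : ℂ)) * S).submatrix σ.symm σ.symm -
    diagonal fun i => (r i : ℂ), fun i j hij => ?_, ?_⟩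
  · by_contra hlt
    apply hij
    rw [Matrix.sub_apply, submatrix_apply, hT _ _ (by simpa using hlt), e2, submatrix_apply, sub_self]
  · rw [add_sub_cancel]
    exact (usim_submatrix_perm _ σ.symm).symm.trans hB

/-- The source of all the lower bounds: against a real diagonal matrix, the moment [T, T*] sees the
entries of T weighted by how much they raise the grade. -/
theorem trace_mom_mul_diagonal (T : Matrix (Fin n) (Fin n) ℂ) (w : Fin n → ℝ) :
    trace (mom T * diagonal fun i => (w i : ℂ)) =
      ((∑ i, ∑ j, (w i - w j) * ‖T i j‖ ^ 2 : ℝ) : ℂ) := by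
  have h1 : trace (T * Tᴴ * diagonal fun i => (w i : ℂ)) = ∑ i, ∑ j, (w i * ‖T i j‖ ^ 2 : ℂ) := by
    simp only [trace, diag_apply, mul_diagonal]
    simp only [mul_apply, conjTranspose_apply, RCLike.star_def,
      Complex.mul_conj, Complex.normSq_eq_norm_sq, Finset.sum_mul]
    refine Finset.sum_congr rfl fun i _ => Finset.sum_congr rfl fun j _ => ?_
    push_cast; ring
  have h2 : trace (Tᴴ * T * diagonal fun i => (w i : ℂ)) = ∑ i, ∑ j, (w j * ‖T i j‖ ^ 2 : ℂ) := by
    rw [Finset.sum_comm]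
    simp only [trace, diag_apply, mul_diagonal]
    simp only [mul_apply, conjTranspose_apply, RCLike.star_def,
      mul_comm (starRingEnd ℂ _), Complex.mul_conj, Complex.normSq_eq_norm_sq, Finset.sum_mul]
    refine Finset.sum_congr rfl fun i _ => Finset.sum_congr rfl fun j _ => ?_
    push_cast; ring
  rw [mom, sub_mul, trace_sub, h1, h2]
  push_cast
  simp only [← Finset.sum_sub_distrib, sub_mul]

/-- The Cauchy–Schwarz inequality against a Hermitian matrix. -/
theorem sq_re_trace_mul_le {H W : Matrix (Fin n) (Fin n) ℂ} (hW : Wᴴ = W) :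
    (trace (H * W)).re ^ 2 ≤ normSq H * normSq W := by
  have h := norm_trace_mul_conjTranspose_sq_le H W
  rw [hW] at h
  refine le_trans ?_ h
  rw [← sq_abs]
  exact pow_le_pow_left₀ (abs_nonneg _) (Complex.abs_re_le_norm _) 2

theorem USim.mom {A B : Matrix (Fin n) (Fin n) ℂ} (h : USim A B) : USim (mom A) (mom B) := by
  obtain ⟨U, hU, rfl⟩ := h
  refine ⟨U, hU, ?_⟩
  rw [OrbitK.mom, conjTranspose_unitary_conj, unitary_conj_mul hU, unitary_conj_mul hU, OrbitK.mom]
  noncomm_ring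

theorem diagonal_ofReal_conjTranspose (w : Fin n → ℝ) :
    (diagonal fun i => (w i : ℂ))ᴴ = diagonal fun i => (w i : ℂ) := by
  rw [diagonal_conjTranspose]
  congr 1
  ext i; simp

theorem normSq_diagonal_ofReal (w : Fin n → ℝ) :
    normSq (diagonal fun i => (w i : ℂ)) = ∑ i, w i ^ 2 := by
  rw [normSq_diagonal]; simp

/-- The sharp lower bound for `K` on nilpotent orbits. -/
theorem C_le_K_of_sim {π : n.Partition} {B : Matrix (Fin n) (Fin n) ℂ}
    (h : Sim (diagBlocks π eMat) B) (hB : B ≠ 0) : C π ≤ K B := by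
  have hE := isTriple_diagBlocks_eMat π
  have hw : ∀ i j, diagBlocks π eMat i j ≠ 0 → (weight π j : ℝ) + 2 ≤ weight π i := by
    intro i j hij
    have h1 := congrFun (congrFun hE i) j
    rw [mom_diagBlocks_eMat, diagBlocks_xMat, Matrix.sub_apply, diagonal_mul, mul_diagonal,
      Matrix.smul_apply, smul_eq_mul, mul_comm _ (weight π j : ℂ), ← sub_mul] at h1
    have h2 := mul_right_cancel₀ hij h1
    have h3 : (weight π i : ℤ) - weight π j = 2 := by exact_mod_cast h2
    have h4 : weight π j + 2 = weight π i := by omega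
    rw [← h4]; push_cast; rfl
  obtain ⟨T, hT, hTB⟩ := h.exists_usim_of_graded (w := fun i => (weight π i : ℝ)) hw
  have hT0 : T ≠ 0 := by
    rintro rfl
    obtain ⟨U, -, rfl⟩ := hTB
    exact hB (by simp)
  have hE0 : diagBlocks π eMat ≠ 0 := by
    intro h0
    rw [h0] at h
    obtain ⟨P, Q, -, rfl⟩ := h
    exact hB (by simp)
  have hq := normSq_pos hT0
  have hS : 0 < ∑ x, (weight π x : ℝ) ^ 2 := by
    rw [← normSq_diagBlocks_xMat, ← mom_diagBlocks_eMat, hE.normSq_mom]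
    exact mul_pos two_pos (normSq_pos hE0)
  have htr : trace (T * T) = 0 := by
    rw [hTB.sim.trace_mul_self_eq, ← h.trace_mul_self_eq, hE.trace_mul_self]
  -- Cauchy–Schwarz against the weights. All entries of T raise the weight by at least 2, so the
  -- pairing is at least 2|T|², and K ≥ 4/∑w² because tr(T²) = 0.
  have hcs := sq_re_trace_mul_le (H := mom T)
    (diagonal_ofReal_conjTranspose fun i => (weight π i : ℝ))
  rw [trace_mom_mul_diagonal, Complex.ofReal_re, normSq_diagonal_ofReal] at hcs
  have hlow : 2 * normSq T ≤ ∑ i, ∑ j, ((weight π i : ℝ) - weight π j) * ‖T i j‖ ^ 2 := by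
    rw [normSq_eq_sum, Finset.mul_sum]
    refine Finset.sum_le_sum fun i _ => ?_
    rw [Finset.mul_sum]
    refine Finset.sum_le_sum fun j _ => ?_
    by_cases hij : T i j = 0
    · simp [hij]
    · have := hT i j hij
      exact mul_le_mul_of_nonneg_right (by linarith) (by positivity)
  rw [← hTB.K_eq, C_eq, K_eq_div, htr, norm_zero, zero_pow two_ne_zero, sub_zero,
    div_le_div_iff₀ hS (by positivity)]
  nlinarith [mul_self_le_mul_self (by linarith) hlow]

/-- The sharp lower bound for `K` on the orbits of real diagonal matrices. -/
theorem le_K_of_sim_diagonal {r : Fin n → ℝ} {d : ℝ} (hd0 : 0 ≤ d)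
    (hd : ∀ i j, r j < r i → d ≤ r i - r j) {B : Matrix (Fin n) (Fin n) ℂ}
    (h : Sim (diagonal fun i => (r i : ℂ)) B)
    (hD : 0 < normSq B ^ 2 - ‖trace (B * B)‖ ^ 2) : d ^ 2 / ∑ i, r i ^ 2 ≤ K B := by
  obtain ⟨N, hN, hNB⟩ := h.exists_usim_diagonal_add
  set L : Matrix (Fin n) (Fin n) ℂ := diagonal fun i => (r i : ℂ) with hL
  set S := ∑ i, r i ^ 2 with hS
  have hS0 : 0 ≤ S := Finset.sum_nonneg fun i _ => sq_nonneg _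
  set v := normSq N with hv
  have hLs : Lᴴ = L := diagonal_ofReal_conjTranspose r
  have hNd : ∀ i, N i i = 0 := fun i => by
    by_contra h0
    exact lt_irrefl _ (hN i i h0)
  have hLN : trace (L * N) = 0 := by
    simp [hL, trace, diagonal_mul, hNd]
  have hLNs : trace (L * Nᴴ) = 0 := by
    simp [hL, trace, diagonal_mul, hNd]
  have hNN : trace (N * N) = 0 := by
    rw [trace]
    refine Finset.sum_eq_zero fun i _ => ?_
    rw [diag_apply, mul_apply]
    refine Finset.sum_eq_zero fun j _ => ?_
    by_contra h0
    exact lt_asymm (hN i j (left_ne_zero_of_mul h0)) (hN j i (right_ne_zero_of_mul h0))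
  have hLL : normSq L = S := normSq_diagonal_ofReal r
  have hq : normSq (L + N) = S + v := by
    rw [normSq_add, hLNs, hLL]; simp [hv]
  have htr : ‖trace (B * B)‖ = S := by
    rw [← h.trace_mul_self_eq]
    nth_rewrite 2 [← hLs]
    rw [trace_mul_conjTranspose_self, hLL, Complex.norm_real, Real.norm_eq_abs, abs_of_nonneg hS0]
  have hD' : normSq B ^ 2 - ‖trace (B * B)‖ ^ 2 = v * (2 * S + v) := by
    rw [← hNB.normSq_eq, hq, htr]; ring
  have hv0 : 0 ≤ v := normSq_nonneg N
  have hvpos : 0 < v := by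
    refine lt_of_le_of_ne hv0 fun h0 => ?_
    rw [hD', ← h0, zero_mul] at hD
    exact lt_irrefl _ hD
  set t : ℝ := ∑ i, ∑ j, (r i - r j) * ‖N i j‖ ^ 2 with ht
  have htlow : d * v ≤ t := by
    rw [hv, normSq_eq_sum, Finset.mul_sum]
    refine Finset.sum_le_sum fun i _ => ?_
    rw [Finset.mul_sum]
    refine Finset.sum_le_sum fun j _ => ?_
    by_cases hij : N i j = 0
    · simp [hij]
    · exact mul_le_mul_of_nonneg_right (hd i j (hN i j hij)) (by positivity)
  have hHL : trace (mom (L + N) * L) = t := by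
    rw [hL, trace_mom_mul_diagonal]
    congr 1
    refine Finset.sum_congr rfl fun i _ => Finset.sum_congr rfl fun j _ => ?_
    by_cases hij : i = j
    · subst hij; simp
    · simp [diagonal_apply_ne _ hij]
  have hNL : trace (mom N * L) = t := trace_mom_mul_diagonal N r
  -- Amounts to the orthogonality of [B, B*] to B for B = L + N, since its pairing with L is t.
  have hHN : trace (mom (L + N) * N) = -t := by
    rw [← hNL, mom, mom, conjTranspose_add, hLs]
    have e1 : trace (L * Nᴴ * N) = trace (Nᴴ * N * L) := by rw [mul_assoc, trace_mul_comm]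
    have e2 : trace (Nᴴ * L * N) = trace (N * Nᴴ * L) := by
      rw [trace_mul_comm, ← mul_assoc]
    have e3 : trace (N * L * N) = trace (L * N * N) := by
      rw [trace_mul_comm, ← mul_assoc, trace_mul_comm, ← mul_assoc]
    have e4 : trace (N * Nᴴ * N) = trace (Nᴴ * N * N) := by
      rw [trace_mul_comm, ← mul_assoc, trace_mul_comm, ← mul_assoc]
    simp only [add_mul, mul_add, sub_mul, trace_add, trace_sub, e1, e2, e3, e4]
    ring
  have hHNs : trace (mom (L + N) * Nᴴ) = -t := by
    rw [trace_conjTranspose_mul, conjTranspose_mom, trace_mul_comm, hHN]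
    simp
  -- Testing against L alone is not sharp: H is orthogonal to B + B* = 2L + N + N*. In the span of L
  -- and N + N*, the matrix W is, up to scale, the part of L orthogonal to B + B*.
  set W : Matrix (Fin n) (Fin n) ℂ := (v : ℂ) • L - (S : ℂ) • (N + Nᴴ) with hW
  have hWs : Wᴴ = W := by
    rw [hW]
    simp only [conjTranspose_sub, conjTranspose_smul, conjTranspose_add, hLs,
      conjTranspose_conjTranspose, RCLike.star_def, Complex.conj_ofReal, add_comm]
  have hcs := sq_re_trace_mul_le (H := mom (L + N)) hWs
  have hWtr : trace (mom (L + N) * W) = ((v + 2 * S) * t : ℝ) := by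
    rw [hW, mul_sub, Matrix.mul_smul, Matrix.mul_smul, mul_add, trace_sub, trace_smul, trace_smul,
      trace_add, hHL, hHN, hHNs]
    simp only [smul_eq_mul]
    push_cast; ring
  have hWn : normSq W = v * S * (v + 2 * S) := by
    have e1 : normSq (N + Nᴴ) = 2 * v := by
      rw [normSq_add, normSq_conjTranspose, conjTranspose_conjTranspose, hNN]
      simp [hv, two_mul]
    rw [hW, sub_eq_add_neg, normSq_add, normSq_neg, normSq_smul, normSq_smul, e1, hLL,
      conjTranspose_neg, conjTranspose_smul, conjTranspose_add, conjTranspose_conjTranspose,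
      Matrix.mul_neg, Matrix.mul_smul, Matrix.smul_mul, mul_add, trace_neg, trace_smul, trace_smul,
      trace_add, hLN, hLNs]
    simp
    ring
  rw [hWtr, hWn, Complex.ofReal_re] at hcs
  rw [K_eq_div, ← hNB.mom.normSq_eq, hD']
  rcases hS0.eq_or_lt with h0 | hSpos
  · rw [← h0, div_zero]
    exact div_nonneg (normSq_nonneg _) (by positivity)
  rw [div_le_div_iff₀ hSpos (by positivity)]
  have hpos : 0 < v + 2 * S := by positivity
  have h1 : (v + 2 * S) * t ^ 2 ≤ normSq (mom (L + N)) * (v * S) := by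
    refine le_of_mul_le_mul_left ?_ hpos
    nlinarith
  have h2 : d ^ 2 * v ^ 2 ≤ t ^ 2 := by
    rw [← mul_pow]; exact pow_le_pow_left₀ (by positivity) htlow 2
  refine le_of_mul_le_mul_left ?_ hvpos
  calc v * (d ^ 2 * (v * (2 * S + v))) = (v + 2 * S) * (d ^ 2 * v ^ 2) := by ring
    _ ≤ (v + 2 * S) * t ^ 2 := mul_le_mul_of_nonneg_left h2 hpos.le
    _ ≤ _ := h1
    _ = _ := by ring

/-- A normal matrix similar to a diagonal one is unitarily similar to it. -/
theorem usim_diagonal_of_mom_eq_zero {lam : Fin n → ℂ} {B : Matrix (Fin n) (Fin n) ℂ}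
    (h : Sim (diagonal lam) B) (hB : mom B = 0) : USim (diagonal lam) B := by
  obtain ⟨R, S, hR, hS, hRS, hT⟩ := h.exists_upper
  have hT0 : mom (R * diagonal lam * S) = 0 := by
    rw [← normSq_eq_zero, hT.mom.normSq_eq, hB, normSq_zero]
  have hlow : ∀ i j, j < i → (R * diagonal lam * S) i j = 0 := by
    intro i j hij
    by_contra h0
    obtain ⟨k, l, hk, hl, hkl⟩ := exists_ne_zero_of_upper_conj hR hS h0
    have : k = l := by
      by_contra hne
      exact hkl (diagonal_apply_ne _ hne)
    subst this
    exact absurd (hk.trans hl) (not_le.2 hij)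
  -- With the grading -i every entry above the diagonal contributes positively, so a normal upper
  -- triangular matrix is diagonal.
  have htr := trace_mom_mul_diagonal (R * diagonal lam * S) fun i => -((i : ℕ) : ℝ)
  rw [hT0, zero_mul, trace_zero, eq_comm, Complex.ofReal_eq_zero] at htr
  have hnn : ∀ i j : Fin n, 0 ≤ (-((i : ℕ) : ℝ) - -((j : ℕ) : ℝ)) * ‖(R * diagonal lam * S) i j‖ ^ 2 := by
    intro i j
    rcases lt_or_ge j i with hij | hij
    · simp [hlow i j hij]
    · have : ((i : ℕ) : ℝ) ≤ ((j : ℕ) : ℝ) := by exact_mod_cast hij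
      exact mul_nonneg (by linarith) (by positivity)
  have hoff : ∀ i j, i ≠ j → (R * diagonal lam * S) i j = 0 := by
    intro i j hij
    rcases lt_or_gt_of_ne hij with hlt | hgt
    · have h1 := (Finset.sum_eq_zero_iff_of_nonneg
        (fun i _ => Finset.sum_nonneg fun j _ => hnn i j)).1 htr i (Finset.mem_univ _)
      have h2 := (Finset.sum_eq_zero_iff_of_nonneg (fun j _ => hnn i j)).1 h1 j (Finset.mem_univ _)
      have h3 : ((i : ℕ) : ℝ) < ((j : ℕ) : ℝ) := by exact_mod_cast hlt
      rw [mul_eq_zero] at h2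
      simpa using h2.resolve_left (by linarith)
    · exact hlow i j hgt
  have hdiag : R * diagonal lam * S = diagonal lam := by
    ext i j
    by_cases hij : i = j
    · subst hij
      exact upper_conj_diagonal_apply hR hS hRS lam fun k h1 h2 => by rw [le_antisymm h2 h1]
    · rw [hoff i j hij, diagonal_apply_ne _ hij]
  rwa [hdiag] at hT

end Bounds

end OrbitK

namespace OrbitK

/-! ### Degenerations -/

section Degenerations

variable {n : ℕ}

theorem normSq_mul_le (X Y : Matrix (Fin n) (Fin n) ℂ) :
    normSq (X * Y) ≤ normSq X * normSq Y := by
  have h : ∀ i j, ‖(X * Y) i j‖ ^ 2 ≤ (∑ k, ‖X i k‖ ^ 2) * ∑ k, ‖Y k j‖ ^ 2 := by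
    intro i j
    refine le_trans ?_ (Finset.sum_mul_sq_le_sq_mul_sq Finset.univ (fun k => ‖X i k‖) fun k => ‖Y k j‖)
    refine pow_le_pow_left₀ (norm_nonneg _) ?_ 2
    rw [mul_apply]
    exact (norm_sum_le _ _).trans_eq (Finset.sum_congr rfl fun k _ => norm_mul _ _)
  rw [normSq_eq_sum, normSq_eq_sum X, normSq_eq_sum Y, Finset.sum_comm (f := fun i j => ‖Y i j‖ ^ 2),
    Finset.sum_mul_sum]
  exact Finset.sum_le_sum fun i _ => Finset.sum_le_sum fun j _ => h i j

/-- The parallelogram law for XX* and X*X, dropping the square of their sum. -/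
theorem normSq_mom_le (X : Matrix (Fin n) (Fin n) ℂ) : normSq (mom X) ≤ 4 * normSq X ^ 2 := by
  have h1 := normSq_add (X * Xᴴ) (-(Xᴴ * X))
  have h2 := normSq_add (X * Xᴴ) (Xᴴ * X)
  rw [normSq_neg, conjTranspose_neg, Matrix.mul_neg, trace_neg, Complex.neg_re,
    ← sub_eq_add_neg] at h1
  have h3 := normSq_nonneg (X * Xᴴ + Xᴴ * X)
  have h4 := normSq_mul_le X Xᴴ
  have h5 := normSq_mul_le Xᴴ X
  rw [normSq_conjTranspose] at h4 h5
  rw [mom]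
  nlinarith

theorem commute_diagonal_iff {d : Fin n → ℂ} {X : Matrix (Fin n) (Fin n) ℂ} :
    Commute (diagonal d) X ↔ ∀ i j, d i * X i j = X i j * d j := by
  rw [commute_iff_eq, ← Matrix.ext_iff]
  simp only [diagonal_mul, mul_diagonal]

/-- Commuting with diag(d) means that X_ij vanishes unless d_i = d_j, a condition symmetric in i and
j. -/
theorem commute_diagonal_conjTranspose {d : Fin n → ℂ} {X : Matrix (Fin n) (Fin n) ℂ}
    (h : Commute (diagonal d) X) : Commute (diagonal d) Xᴴ := by
  rw [commute_diagonal_iff] at h ⊢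
  intro i j
  rw [conjTranspose_apply]
  by_cases h0 : X j i = 0
  · simp [h0]
  · have : d j = d i := mul_right_cancel₀ h0 ((h j i).trans (mul_comm _ _))
    rw [this, mul_comm]

theorem commute_diagonal_star {d : Fin n → ℂ} {X : Matrix (Fin n) (Fin n) ℂ}
    (h : Commute (diagonal d) X) : Commute (diagonal d)ᴴ X := by
  have := commute_diagonal_conjTranspose h
  have h2 := congrArg conjTranspose this.eq
  rw [conjTranspose_mul, conjTranspose_mul, conjTranspose_conjTranspose] at h2
  exact h2.symm

theorem trace_mul_eq_zero_of_commute {X Y : Matrix (Fin n) (Fin n) ℂ} (h : Commute X Y)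
    (hY : IsNilpotent Y) : trace (X * Y) = 0 :=
  (isNilpotent_trace_of_isNilpotent (h.isNilpotent_mul_left hY)).eq_zero

open scoped MatrixOrder ComplexOrder Matrix.Norms.L2Operator in
/-- A nilpotent matrix can be made arbitrarily small by conjugations that fix a diagonal matrix
commuting with it. -/
theorem exists_small_conj {d : Fin n → ℂ} {N : Matrix (Fin n) (Fin n) ℂ}
    (hc : Commute (diagonal d) N) (hN : IsNilpotent N) {ε : ℝ} (hε : 0 < ε) :
    ∃ N' : Matrix (Fin n) (Fin n) ℂ, Sim (diagonal d + N) (diagonal d + N') ∧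
      Commute (diagonal d) N' ∧ Sim N N' ∧ normSq N' ≤ ε * n := by
  obtain ⟨m, hm⟩ := hN
  -- The sum P of these terms is a new Hermitian metric in which N is small; its square root h
  -- conjugates that metric to the standard one.
  let f : ℕ → Matrix (Fin n) (Fin n) ℂ := fun k => ((ε⁻¹ ^ k : ℝ) : ℂ) • ((N ^ k)ᴴ * N ^ k)
  set P : Matrix (Fin n) (Fin n) ℂ := ∑ k ∈ Finset.range (m + 1), f k with hP
  have hf : ∀ k, (f k).PosSemidef := fun k =>
    (posSemidef_conjTranspose_mul_self (N ^ k)).smul (by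
      rw [Complex.zero_le_real]; positivity)
  have hP1 : P = (∑ k ∈ Finset.range m, f (k + 1)) + 1 := by
    rw [hP, Finset.sum_range_succ']
    simp [f]
  have hPpos : P.PosDef := by
    rw [hP1]
    exact PosDef.posSemidef_add (posSemidef_sum _ fun k _ => hf _) PosDef.one
  have hPc : Commute P (diagonal d) := by
    refine Commute.sum_left _ _ _ fun k _ => Commute.smul_left ?_ _
    have h1 := hc.pow_right k
    exact ((commute_diagonal_conjTranspose h1).mul_right h1).symm
  -- Conjugating a term by N shifts it to the next one times ε; the last shift vanishes by
  -- nilpotency, and the missing first term is 1.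
  have hNPN : Nᴴ * P * N = (ε : ℂ) • (P - 1) := by
    have e1 : ∀ k, Nᴴ * f k * N = (ε : ℂ) • f (k + 1) := by
      intro k
      simp only [f, Matrix.mul_smul, Matrix.smul_mul, smul_smul, pow_succ N, conjTranspose_mul]
      congr 1
      · push_cast
        rw [pow_succ]
        have : (ε : ℂ) ≠ 0 := by exact_mod_cast hε.ne'
        field_simp
      · noncomm_ring
    have e2 : f (m + 1) = 0 := by simp [f, pow_succ, hm]
    rw [hP, Finset.mul_sum, Finset.sum_mul]
    simp only [e1]
    rw [← Finset.smul_sum, ← hP, hP1, add_sub_cancel_right, Finset.sum_range_succ, e2, add_zero]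
  have hP0 : 0 ≤ P := hPpos.posSemidef.nonneg
  set h := CFC.sqrt P with hh
  have hhh : h * h = P := CFC.sqrt_mul_sqrt_self P hP0
  have hhs : hᴴ = h := (IsSelfAdjoint.of_nonneg (CFC.sqrt_nonneg P)).star_eq
  -- P commutes with diag(d), hence so does its square root, and conjugation by h leaves diag(d)
  -- fixed.
  have hhc : Commute h (diagonal d) := by
    rw [hh, CFC.sqrt_eq_cfc]
    exact hPc.cfc_nnreal _
  have hdet : IsUnit h.det := by
    have h1 : IsUnit P.det := (isUnit_iff_isUnit_det P).1 hPpos.isUnit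
    rw [← hhh, det_mul] at h1
    exact isUnit_of_mul_isUnit_left h1
  have hi1 : h * h⁻¹ = 1 := mul_nonsing_inv h hdet
  have hi2 : h⁻¹ * h = 1 := nonsing_inv_mul h hdet
  have his : (h⁻¹)ᴴ = h⁻¹ := by rw [conjTranspose_nonsing_inv, hhs]
  have hdd : h * diagonal d * h⁻¹ = diagonal d := by
    rw [hhc.eq, mul_assoc, hi1, mul_one]
  have hs1 : Sim (diagonal d + N) (diagonal d + h * N * h⁻¹) :=
    ⟨h, h⁻¹, hi1, by rw [mul_add, add_mul, hdd]⟩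
  refine ⟨h * N * h⁻¹, hs1, ?_, ⟨h, h⁻¹, hi1, rfl⟩, ?_⟩
  · have h2 : diagonal d * (h * N * h⁻¹) = h * (diagonal d * N) * h⁻¹ := by
      rw [← mul_assoc, ← mul_assoc, ← hhc.eq, mul_assoc h]
    have h3 : h * N * h⁻¹ * diagonal d = h * (N * diagonal d) * h⁻¹ := by
      nth_rewrite 1 [← hdd]
      calc _ = h * N * (h⁻¹ * h) * diagonal d * h⁻¹ := by noncomm_ring
        _ = _ := by rw [hi2]; noncomm_ring
    rw [commute_iff_eq, h2, h3, hc.eq]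
  · have h4 : ((normSq (h * N * h⁻¹) : ℝ) : ℂ) = ((ε * (n - normSq h⁻¹) : ℝ) : ℂ) := by
      rw [← trace_conjTranspose_mul_self, conjTranspose_mul, conjTranspose_mul, his, hhs]
      have e1 : h⁻¹ * (Nᴴ * h) * (h * N * h⁻¹) = h⁻¹ * (Nᴴ * (h * h) * N) * h⁻¹ := by noncomm_ring
      have e2 : h⁻¹ * (h * h) * h⁻¹ = 1 := by
        rw [← mul_assoc, hi2, one_mul, hi1]
      have e3 : trace (h⁻¹ * h⁻¹) = normSq h⁻¹ := by
        nth_rewrite 2 [← his]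
        exact trace_mul_conjTranspose_self _
      rw [e1, hhh, hNPN, Matrix.mul_smul, Matrix.smul_mul, trace_smul, mul_sub, sub_mul, ← hhh, e2,
        mul_one, trace_sub, trace_one, e3]
      simp
    have h5 : normSq (h * N * h⁻¹) = ε * (n - normSq h⁻¹) := by exact_mod_cast h4
    rw [h5]
    have := normSq_nonneg h⁻¹
    nlinarith

/-- The Jordan decomposition in matrix form. -/
theorem exists_sim_diagonal_add_nilpotent (A : Matrix (Fin n) (Fin n) ℂ) :
    ∃ (d : Fin n → ℂ) (N : Matrix (Fin n) (Fin n) ℂ), Commute (diagonal d) N ∧ IsNilpotent N ∧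
      Sim A (diagonal d + N) := by
  obtain ⟨f, hfA, g, hgA, hf, hg, hA⟩ :=
    Module.End.exists_isNilpotent_isSemisimple (f := (toLin' A : Module.End ℂ (Fin n → ℂ)))
  -- The semisimple part g is a polynomial in A, so it commutes with A and with f = A - g; an
  -- eigenbasis of g then makes it diagonal.
  have hfg : Commute g f := by
    have h1 : Commute (toLin' A : Module.End ℂ (Fin n → ℂ)) g := Algebra.commute_of_mem_adjoin_self hgA
    rw [hA] at h1
    have h2 := h1.sub_left (Commute.refl g)
    rw [add_sub_cancel_right] at h2
    exact h2.symm
  have hint : DirectSum.IsInternal g.eigenspace :=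
    DirectSum.isInternal_submodule_of_iSupIndep_of_iSup_eq_top g.eigenspaces_iSupIndep
      hg.iSup_eigenspace_eq_top
  let b₀ := hint.collectedBasis fun μ => Module.Basis.ofVectorSpace ℂ (g.eigenspace μ)
  let b := b₀.reindex (b₀.indexEquiv (Pi.basisFun ℂ (Fin n)))
  have hb : ∀ i, ∃ μ : ℂ, g (b i) = μ • b i := by
    intro i
    set x := (b₀.indexEquiv (Pi.basisFun ℂ (Fin n))).symm i
    refine ⟨x.1, ?_⟩
    have := hint.collectedBasis_mem (fun μ => Module.Basis.ofVectorSpace ℂ (g.eigenspace μ)) x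
    rw [Module.Basis.reindex_apply]
    exact Module.End.mem_eigenspace_iff.1 this
  choose d hd using hb
  have hgd : LinearMap.toMatrix b b g = diagonal d := by
    ext i j
    rw [LinearMap.toMatrix_apply, hd, map_smul, Module.Basis.repr_self, Finsupp.smul_apply,
      Finsupp.single_apply, diagonal_apply]
    by_cases hij : i = j
    · subst hij; simp
    · simp [hij, Ne.symm hij]
  have hmul : ∀ f g : Module.End ℂ (Fin n → ℂ), LinearMap.toMatrix b b (f * g) =
      LinearMap.toMatrix b b f * LinearMap.toMatrix b b g := fun f g => LinearMap.toMatrix_mul b f g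
  refine ⟨d, LinearMap.toMatrix b b f, ?_, ?_, ?_⟩
  · rw [commute_iff_eq, ← hgd, ← hmul, ← hmul, hfg.eq]
  · obtain ⟨k, hk⟩ := hf
    refine ⟨k, ?_⟩
    have : ∀ k, LinearMap.toMatrix b b (f ^ k) = LinearMap.toMatrix b b f ^ k := by
      intro k
      induction k with
      | zero => simp
      | succ k ih => rw [pow_succ, pow_succ, hmul, ih]
    rw [← this, hk, map_zero]
  · rw [← hgd, ← map_add, add_comm, ← hA]
    refine ⟨b.toMatrix (Pi.basisFun ℂ (Fin n)), (Pi.basisFun ℂ (Fin n)).toMatrix b, ?_, ?_⟩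
    · rw [Module.Basis.toMatrix_mul_toMatrix_flip]
    · rw [← basis_toMatrix_mul_linearMap_toMatrix_mul_basis_toMatrix b (Pi.basisFun ℂ (Fin n)) b
        (Pi.basisFun ℂ (Fin n)) (toLin' A), LinearMap.toMatrix_eq_toMatrix',
        LinearMap.toMatrix'_toLin']

/-- Orbits of matrices that are neither diagonalizable nor nilpotent contain points outside `Z`
with arbitrarily small `K`. -/
theorem exists_K_le_of_commute {d : Fin n → ℂ} {N : Matrix (Fin n) (Fin n) ℂ}
    (hc : Commute (diagonal d) N) (hN : IsNilpotent N) (hd : diagonal d ≠ 0) (hN0 : N ≠ 0) {η : ℝ}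
    (hη : 0 < η) : ∃ B, Sim (diagonal d + N) B ∧
      0 < normSq B ^ 2 - ‖trace (B * B)‖ ^ 2 ∧ K B ≤ η := by
  set δ := normSq (diagonal d) with hδ
  have hδ0 : 0 < δ := normSq_pos hd
  -- The choice of ε gives |M|² ≤ ηδ/2, also for n = 0. The numerator of K is at most 4v² and the
  -- denominator at least 2δv, so K ≤ 2v/δ ≤ η.
  obtain ⟨M, hM1, hM2, hM3, hM4⟩ := exists_small_conj hc hN
    (ε := η * δ / (2 * (n + 1))) (by positivity)
  have hM0 : M ≠ 0 := by
    rintro rfl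
    obtain ⟨P, Q, -, h⟩ := hM3.symm
    exact hN0 (by simpa using h)
  have hMn := hM3.isNilpotent hN
  set v := normSq M with hv
  have hv0 : 0 < v := normSq_pos hM0
  have hq : normSq (diagonal d + M) = δ + v := by
    have h1 : trace ((diagonal d)ᴴ * M) = 0 :=
      trace_mul_eq_zero_of_commute (commute_diagonal_star hM2) hMn
    have h2 : trace (diagonal d * Mᴴ) = 0 := by
      rw [trace_conjTranspose_mul, trace_mul_comm, h1, star_zero]
    rw [normSq_add, h2]; simp [hδ, hv]
  have hτ : trace ((diagonal d + M) * (diagonal d + M)) = trace (diagonal d * diagonal d) := by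
    have h1 := trace_mul_eq_zero_of_commute hM2 hMn
    have h2 := trace_mul_eq_zero_of_commute (Commute.refl M) hMn
    simp only [add_mul, mul_add, trace_add]
    rw [trace_mul_comm M, h1, h2]; ring
  have hτδ : ‖trace (diagonal d * diagonal d)‖ ≤ δ := norm_trace_mul_self_le _
  have hD : 2 * δ * v ≤
      normSq (diagonal d + M) ^ 2 - ‖trace ((diagonal d + M) * (diagonal d + M))‖ ^ 2 := by
    rw [hq, hτ]
    nlinarith [norm_nonneg (trace (diagonal d * diagonal d)), sq_nonneg v]
  -- The diagonal part is normal and commutes with M and M*, so it contributes nothing to the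
  -- moment.
  have hmom : mom (diagonal d + M) = mom M := by
    have h1 : diagonal d * Mᴴ = Mᴴ * diagonal d := (commute_diagonal_conjTranspose hM2).eq
    have h2 : (diagonal d)ᴴ * M = M * (diagonal d)ᴴ := (commute_diagonal_star hM2).eq
    have h3 : diagonal d * (diagonal d)ᴴ = (diagonal d)ᴴ * diagonal d := by
      rw [diagonal_conjTranspose, diagonal_mul_diagonal, diagonal_mul_diagonal]
      simp only [mul_comm]
    simp only [mom, conjTranspose_add, mul_add, add_mul, h1, h2, h3]
    abel
  have hDpos := lt_of_lt_of_le (by positivity : 0 < 2 * δ * v) hD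
  refine ⟨diagonal d + M, hM1, hDpos, ?_⟩
  rw [K_eq_div, hmom, div_le_iff₀ hDpos]
  have h1 := normSq_mom_le M
  have h2 : v ≤ η * δ / 2 := by
    refine hM4.trans ?_
    rw [div_mul_eq_mul_div, div_le_div_iff₀ (by positivity) two_pos]
    nlinarith [mul_pos hη hδ0]
  calc normSq (mom M) ≤ 4 * v ^ 2 := h1
    _ ≤ η * (2 * δ * v) := by nlinarith
    _ ≤ _ := mul_le_mul_of_nonneg_left hD hη.le

/-- The curve `diag(r) + t E_{ij}` in the orbit of `diag(r)`. -/
theorem exists_K_eq_of_ne {r : Fin n → ℝ} {i j : Fin n} (hij : r i ≠ r j) {t : ℝ} (ht : t ≠ 0) :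
    ∃ B, Sim (diagonal fun i => (r i : ℂ)) B ∧ 0 < normSq B ^ 2 - ‖trace (B * B)‖ ^ 2 ∧
      K B = (2 * (r i - r j) ^ 2 + 2 * t ^ 2) / (2 * ∑ k, r k ^ 2 + t ^ 2) := by
  have hne : i ≠ j := fun h => hij (by rw [h])
  set L : Matrix (Fin n) (Fin n) ℂ := diagonal fun i => (r i : ℂ) with hL
  set E : Matrix (Fin n) (Fin n) ℂ := single i j 1 with hE
  set F : Matrix (Fin n) (Fin n) ℂ := single j i 1 with hF
  have hEF : Eᴴ = F := by simp [hE, hF, conjTranspose_single]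
  have hFE : Fᴴ = E := by rw [← hEF, conjTranspose_conjTranspose]
  have hLs : Lᴴ = L := diagonal_ofReal_conjTranspose r
  have hLE : L * E = (r i : ℂ) • E := by
    ext k l
    rw [hL, diagonal_mul, Matrix.smul_apply, smul_eq_mul, hE, single_apply]
    split_ifs with h
    · rw [h.1]
    · simp
  have hEL : E * L = (r j : ℂ) • E := by
    ext k l
    rw [hL, mul_diagonal, Matrix.smul_apply, smul_eq_mul, hE, single_apply]
    split_ifs with h
    · rw [h.2, mul_comm]
    · simp
  have hFL : F * L = (r i : ℂ) • F := by
    have := congrArg conjTranspose hLE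
    simpa [hEF, hLs] using this
  have hLF : L * F = (r j : ℂ) • F := by
    have := congrArg conjTranspose hEL
    simpa [hEF, hLs] using this
  have hEE : E * E = 0 := single_mul_single_of_ne _ _ _ _ hne.symm _
  have hFF : F * F = 0 := single_mul_single_of_ne _ _ _ _ hne _
  have hEFE : E * F * E = E := by simp [hE, hF]
  have hFEF : F * E * F = F := by simp [hE, hF]
  have htE : trace E = 0 := trace_single_eq_of_ne _ _ _ hne
  have htF : trace F = 0 := trace_single_eq_of_ne _ _ _ hne.symm
  have hnE : normSq E = 1 := by
    have := trace_mul_conjTranspose_self E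
    rw [hEF] at this
    simp only [hE, hF, single_mul_single_same, mul_one, trace_single_eq_same] at this
    exact_mod_cast this.symm
  set S := ∑ k, r k ^ 2 with hS
  have hSnn : 0 ≤ S := Finset.sum_nonneg fun i _ => sq_nonneg _
  have hLL : normSq L = S := normSq_diagonal_ofReal r
  have hrr : (r j : ℂ) - r i ≠ 0 := by
    rw [← Complex.ofReal_sub, Complex.ofReal_ne_zero]
    exact sub_ne_zero.2 hij.symm
  have hsim : Sim L (L + (t : ℂ) • E) := by
    -- Since E² = 0 and [E, L] = (r_j - r_i)E, conjugation by 1 + sE adds s(r_j - r_i)E to L.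
    refine ⟨1 + ((t : ℂ) / (r j - r i)) • E, 1 - ((t : ℂ) / (r j - r i)) • E, ?_, ?_⟩
    · simp only [add_mul, mul_sub, one_mul, mul_one, smul_mul_smul_comm, hEE, smul_zero]
      abel
    · simp only [add_mul, mul_sub, one_mul, mul_one, smul_mul_smul_comm, Matrix.mul_smul,
        Matrix.smul_mul, hEL, hLE, hEE, smul_zero, smul_smul]
      match_scalars
      · simp
      · field_simp
  have hq : normSq (L + (t : ℂ) • E) = S + t ^ 2 := by
    rw [normSq_add, normSq_smul, hnE, hLL, conjTranspose_smul, hEF, Matrix.mul_smul, hLF, trace_smul,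
      trace_smul, htF]
    simp
  have hτ : ‖trace ((L + (t : ℂ) • E) * (L + (t : ℂ) • E))‖ = S := by
    rw [← hsim.trace_mul_self_eq]
    nth_rewrite 2 [← hLs]
    rw [trace_mul_conjTranspose_self, hLL, Complex.norm_real, Real.norm_eq_abs, abs_of_nonneg hSnn]
  have hD : normSq (L + (t : ℂ) • E) ^ 2 -
      ‖trace ((L + (t : ℂ) • E) * (L + (t : ℂ) • E))‖ ^ 2 = t ^ 2 * (2 * S + t ^ 2) := by
    rw [hq, hτ]; ring
  have hmom : mom (L + (t : ℂ) • E) = ((t ^ 2 : ℝ) : ℂ) • (E * F - F * E) +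
      ((t * (r j - r i) : ℝ) : ℂ) • (E + F) := by
    rw [mom, conjTranspose_add, conjTranspose_smul, hEF, hLs]
    simp only [add_mul, mul_add, Matrix.mul_smul, Matrix.smul_mul, hEL, hLE, hLF, hFL,
      RCLike.star_def, Complex.conj_ofReal]
    push_cast
    module
  have hn1 : normSq (E * F - F * E) = 2 := by
    have e : trace (E * F * (-(F * E))ᴴ) = 0 := by
      rw [conjTranspose_neg, conjTranspose_mul, hEF, hFE, Matrix.mul_neg, mul_assoc, ← mul_assoc F F,
        hFF]
      simp
    have e1 : normSq (E * F) = 1 := by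
      have := trace_mul_conjTranspose_self (E * F)
      rw [conjTranspose_mul, hEF, hFE, ← mul_assoc, hEFE,
        show trace (E * F) = 1 by simp [hE, hF]] at this
      exact_mod_cast this.symm
    have e2 : normSq (F * E) = 1 := by
      have := trace_mul_conjTranspose_self (F * E)
      rw [conjTranspose_mul, hEF, hFE, ← mul_assoc, hFEF,
        show trace (F * E) = 1 by simp [hE, hF]] at this
      exact_mod_cast this.symm
    rw [sub_eq_add_neg, normSq_add, normSq_neg, e, e1, e2]
    norm_num
  have hn2 : normSq (E + F) = 2 := by
    rw [normSq_add, hFE, hEE, ← hEF, normSq_conjTranspose, hnE]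
    norm_num
  have hn : normSq (mom (L + (t : ℂ) • E)) = t ^ 2 * (2 * (r i - r j) ^ 2 + 2 * t ^ 2) := by
    have e : trace ((E * F - F * E) * (E + F)) = 0 := by
      have : (E * F - F * E) * (E + F) = E - F := by
        calc _ = E * F * E - F * E * F + E * (F * F) - F * (E * E) := by noncomm_ring
          _ = _ := by rw [hEFE, hFEF, hFF, hEE]; simp
      rw [this, trace_sub, htE, htF, sub_zero]
    rw [hmom, normSq_add, normSq_smul, normSq_smul, hn1, hn2, conjTranspose_smul, conjTranspose_add,
      hEF, hFE, add_comm F E, Matrix.mul_smul, Matrix.smul_mul, trace_smul, trace_smul, e]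
    simp only [smul_zero, Complex.zero_re, Complex.norm_real, Real.norm_eq_abs, sq_abs]
    ring
  have ht2 : 0 < t ^ 2 := by positivity
  refine ⟨_, hsim, by rw [hD]; positivity, ?_⟩
  rw [K_eq_div, hn, hD, mul_div_mul_left _ _ ht2.ne']

end Degenerations

end OrbitK

namespace OrbitK

/-! ### Combinatorics of the multisets Λ_π -/

variable {n : ℕ}

theorem mem_Lam {p : ℕ} {a : ℤ} : a ∈ Lam p ↔ ∃ i < p, (p : ℤ) - 1 - 2 * (i : ℤ) = a := by
  simp [Lam]

theorem nodup_Lam (p : ℕ) : (Lam p).Nodup := by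
  rw [Lam_eq]
  refine (Multiset.nodup_range p).map fun i j h => ?_
  have : (p : ℤ) - 1 - 2 * (i : ℤ) = (p : ℤ) - 1 - 2 * (j : ℤ) := h
  omega

theorem count_Lam (p : ℕ) (a : ℤ) : (Lam p).count a = if a ∈ Lam p then 1 else 0 :=
  Multiset.count_eq_of_nodup (nodup_Lam p)

theorem mem_Lam_iff {p : ℕ} {a : ℤ} :
    a ∈ Lam p ↔ -(p : ℤ) < a ∧ a < p ∧ (a + p) % 2 = 1 := by
  rw [mem_Lam]
  constructor
  · rintro ⟨i, hi, rfl⟩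
    omega
  · rintro ⟨h1, h2, h3⟩
    exact ⟨((p - 1 - a) / 2).toNat, by omega, by omega⟩

/-- Λ_p contains k - 1 without k + 1 only if p = k, and never the reverse. Thus the multiplicities
in Λ_π recover the parts of π. -/
theorem count_bind_Lam (s : Multiset ℕ) {k : ℕ} (hk : k ≠ 0) :
    (s.bind Lam).count ((k : ℤ) - 1) = (s.bind Lam).count ((k : ℤ) + 1) + s.count k := by
  induction s using Multiset.induction with
  | empty => simp
  | cons p s ih =>
    have h : (Lam p).count ((k : ℤ) - 1) =
        (Lam p).count ((k : ℤ) + 1) + if k = p then 1 else 0 := by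
      simp only [count_Lam, mem_Lam_iff]
      split_ifs <;> omega
    rw [Multiset.cons_bind, Multiset.count_add, Multiset.count_add, Multiset.count_cons, h, ih]
    ring

theorem eq_of_bind_Lam_eq {s t : Multiset ℕ} (hs : 0 ∉ s) (ht : 0 ∉ t)
    (h : s.bind Lam = t.bind Lam) : s = t := by
  ext k
  rcases eq_or_ne k 0 with rfl | hk
  · rw [Multiset.count_eq_zero_of_notMem hs, Multiset.count_eq_zero_of_notMem ht]
  · have h1 := count_bind_Lam s hk
    have h2 := count_bind_Lam t hk
    rw [h] at h1
    omega

theorem zero_notMem_parts (π : n.Partition) : 0 ∉ π.parts := fun h =>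
  (π.parts_pos h).ne' rfl

theorem partition_eq_of_bind_Lam_eq {π π' : n.Partition}
    (h : π.parts.bind Lam = π'.parts.bind Lam) : π = π' :=
  Nat.Partition.ext (eq_of_bind_Lam_eq (zero_notMem_parts π) (zero_notMem_parts π') h)

theorem map_neg_Lam (p : ℕ) : (Lam p).map (fun a => -a) = Lam p := by
  refine (Multiset.Nodup.ext ((nodup_Lam p).map neg_injective) (nodup_Lam p)).2 fun a => ?_
  simp only [Multiset.mem_map, mem_Lam_iff]
  constructor
  · rintro ⟨b, hb, rfl⟩
    omega
  · intro h
    exact ⟨-a, by omega, by omega⟩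

theorem map_neg_bind_Lam (s : Multiset ℕ) : (s.bind Lam).map (fun a => -a) = s.bind Lam := by
  rw [Multiset.map_bind]
  exact Multiset.bind_congr fun p _ => map_neg_Lam p

/-- The halves k, k - 1, …, -k of the entries of Λ_{2k+1} split by parity: those congruent to k mod
2 form Λ_{k+1}, the others Λ_k. -/
theorem map_two_mul_Lam (k : ℕ) :
    (Lam k + Lam (k + 1)).map (fun a => 2 * a) = Lam (2 * k + 1) := by
  have hinj : Function.Injective fun a : ℤ => 2 * a := fun a b h => by
    have : 2 * a = 2 * b := h
    omega
  have hd : Disjoint (Lam k) (Lam (k + 1)) := by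
    rw [Multiset.disjoint_left]
    intro a h1 h2
    rw [mem_Lam_iff] at h1 h2
    omega
  refine (Multiset.Nodup.ext (Multiset.Nodup.map hinj ?_) (nodup_Lam _)).2 fun a => ?_
  · exact Multiset.nodup_add.2 ⟨nodup_Lam _, nodup_Lam _, hd⟩
  · simp only [Multiset.mem_map, Multiset.mem_add, mem_Lam_iff]
    constructor
    · rintro ⟨b, hb, rfl⟩
      push_cast
      omega
    · intro h
      push_cast at h
      exact ⟨a / 2, by push_cast; omega, by omega⟩

theorem bind_Lam_filter (s : Multiset ℕ) : (s.filter (· ≠ 0)).bind Lam = s.bind Lam := by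
  induction s using Multiset.induction with
  | empty => simp
  | cons p s ih =>
    by_cases hp : p = 0
    · subst hp
      rw [Multiset.filter_cons_of_neg (p := (· ≠ 0)) _ (by simp), ih, Multiset.cons_bind]
      simp [Lam]
    · rw [Multiset.filter_cons_of_pos (p := (· ≠ 0)) _ hp, Multiset.cons_bind, Multiset.cons_bind, ih]

theorem map_two_mul_bind_consecutivePairs (m : Multiset ℕ) :
    ((consecutivePairs m).bind Lam).map (fun a => 2 * a) =
      (m.map fun k => 2 * k + 1).bind Lam := by
  rw [consecutivePairs, bind_Lam_filter]
  induction m using Multiset.induction with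
  | empty => simp
  | cons p s ih =>
    rw [Multiset.add_bind] at ih
    simp only [Multiset.map_cons, Multiset.cons_bind, Multiset.add_bind, Multiset.map_add,
      ← map_two_mul_Lam, ← ih]
    abel

theorem sum_consecutivePairs (m : Multiset ℕ) :
    (consecutivePairs m).sum = (m.map fun k => 2 * k + 1).sum := by
  have hf : ∀ s : Multiset ℕ, (s.filter (· ≠ 0)).sum = s.sum := fun s => by
    induction s using Multiset.induction with
    | empty => simp
    | cons p s ih =>
      by_cases hp : p = 0
      · subst hp
        rw [Multiset.filter_cons_of_neg (p := (· ≠ 0)) _ (by simp), ih, Multiset.sum_cons, zero_add]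
      · rw [Multiset.filter_cons_of_pos (p := (· ≠ 0)) _ hp, Multiset.sum_cons, Multiset.sum_cons, ih]
  rw [consecutivePairs, hf]
  induction m using Multiset.induction with
  | empty => simp
  | cons p s ih =>
    rw [Multiset.sum_add] at ih
    simp only [Multiset.map_cons, Multiset.sum_cons, Multiset.sum_add] at ih ⊢
    omega

theorem exists_partition_consecutivePairs {π : n.Partition} {m : Multiset ℕ}
    (hm : π.parts = m.map fun k => 2 * k + 1) :
    ∃ π' : n.Partition, π'.parts = consecutivePairs m :=
  ⟨⟨consecutivePairs m, fun {i} hi => Nat.pos_of_ne_zero (Multiset.mem_filter.1 hi).2, by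
    rw [sum_consecutivePairs, ← hm, π.parts_sum]⟩, rfl⟩

theorem map_two_mul_bind_Lam_of_parts {π π' : n.Partition} {m : Multiset ℕ}
    (hm : π.parts = m.map fun k => 2 * k + 1) (hm' : π'.parts = consecutivePairs m) :
    (π'.parts.bind Lam).map (fun a => 2 * a) = π.parts.bind Lam := by
  rw [hm, hm', map_two_mul_bind_consecutivePairs]

theorem sum_weight_sq_eq_sum_map (π : n.Partition) :
    ∑ x, (weight π x : ℝ) ^ 2 = ((π.parts.bind Lam).map fun a : ℤ => (a : ℝ) ^ 2).sum := by
  rw [← map_weight, Multiset.map_map]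
  rfl

theorem C_eq_four_mul {π π' : n.Partition} {m : Multiset ℕ}
    (hm : π.parts = m.map fun k => 2 * k + 1) (hm' : π'.parts = consecutivePairs m) :
    C π' = 4 * C π := by
  have h : ∑ x, (weight π x : ℝ) ^ 2 = 4 * ∑ x, (weight π' x : ℝ) ^ 2 := by
    rw [sum_weight_sq_eq_sum_map, sum_weight_sq_eq_sum_map,
      ← map_two_mul_bind_Lam_of_parts hm hm', Multiset.map_map, ← Multiset.sum_map_mul_left]
    refine congrArg Multiset.sum (Multiset.map_congr rfl fun a _ => ?_)
    simp only [Function.comp_apply]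
    push_cast
    ring
  rw [C_eq, C_eq, h, ← mul_div_assoc, mul_div_mul_left _ _ (by norm_num : (4 : ℝ) ≠ 0)]

theorem weight_mem (π : n.Partition) (x : Fin n) : weight π x ∈ π.parts.bind Lam := by
  rw [← map_weight]
  exact Multiset.mem_map_of_mem _ (Finset.mem_univ_val x)

theorem one_mem_bind_Lam {π : n.Partition} {p : ℕ} (hp : p ∈ π.parts) (h : p % 2 = 0) :
    (1 : ℤ) ∈ π.parts.bind Lam := by
  have := π.parts_pos hp
  exact Multiset.mem_bind.2 ⟨p, hp, mem_Lam_iff.2 (by omega)⟩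

theorem zero_mem_bind_Lam {s : Multiset ℕ} {p : ℕ} (hp : p ∈ s) (h : p % 2 = 1) :
    (0 : ℤ) ∈ s.bind Lam :=
  Multiset.mem_bind.2 ⟨p, hp, mem_Lam_iff.2 (by omega)⟩

theorem emod_two_of_mem_bind_Lam {s : Multiset ℕ} {r : ℕ} (hs : ∀ p ∈ s, p % 2 = r) {a : ℤ}
    (ha : a ∈ s.bind Lam) : (a + r) % 2 = 1 := by
  obtain ⟨p, hp, h⟩ := Multiset.mem_bind.1 ha
  have := hs p hp
  rw [mem_Lam_iff] at h
  omega

theorem two_mem_bind_Lam {s : Multiset ℕ} (hs : ∀ p ∈ s, p % 2 = 1) {a : ℤ}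
    (ha : a ∈ s.bind Lam) (h0 : a ≠ 0) : (2 : ℤ) ∈ s.bind Lam := by
  obtain ⟨p, hp, h⟩ := Multiset.mem_bind.1 ha
  have := hs p hp
  rw [mem_Lam_iff] at h
  exact Multiset.mem_bind.2 ⟨p, hp, mem_Lam_iff.2 (by omega)⟩

/-! ### Two descriptions cΛ_π and c'Λ_π' of one spectrum -/

section Scaling

variable {π π' : n.Partition} {c c' : ℂ}

theorem exists_mem_of_map_mul_eq {s t : Multiset ℤ}
    (h : t.map (fun a : ℤ => c' * (a : ℂ)) = s.map fun a : ℤ => c * (a : ℂ)) {a : ℤ} (ha : a ∈ s) :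
    ∃ b ∈ t, c' * (b : ℂ) = c * (a : ℂ) := by
  have : c * (a : ℂ) ∈ t.map (fun a : ℤ => c' * (a : ℂ)) := by
    rw [h]
    exact Multiset.mem_map_of_mem _ ha
  exact Multiset.mem_map.1 this

theorem map_intCast_mul_injective (hc : c ≠ 0) :
    Function.Injective (Multiset.map fun a : ℤ => c * (a : ℂ)) :=
  Multiset.map_injective fun a b h => by
    simpa [hc] using h

/-- Once the ratio of the scales is known to be rational, clearing it gives an identity of integer
multisets; the sign q is absorbed by the symmetry of each Λ_p under negation. -/
theorem map_mul_eq_of_scale {s t : Multiset ℕ} (hc : c' ≠ 0) {q : ℤ} (hq : q = 1 ∨ q = -1) {j k : ℤ}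
    (hk : (k : ℂ) * c = q * j * c')
    (h : (t.bind Lam).map (fun a : ℤ => c' * (a : ℂ)) =
      (s.bind Lam).map fun a : ℤ => c * (a : ℂ)) :
    (t.bind Lam).map (fun a => k * a) = (s.bind Lam).map fun a => j * a := by
  apply map_intCast_mul_injective hc
  have h' := congrArg (Multiset.map fun x : ℂ => (k : ℂ) * x) h
  rw [Multiset.map_map, Multiset.map_map] at h'
  have h1 : ((t.bind Lam).map (fun a => k * a)).map (fun a : ℤ => c' * (a : ℂ)) =
      (t.bind Lam).map ((fun x : ℂ => (k : ℂ) * x) ∘ fun a : ℤ => c' * (a : ℂ)) := by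
    rw [Multiset.map_map]
    refine Multiset.map_congr rfl fun a _ => ?_
    simp only [Function.comp_apply]
    push_cast
    ring
  rw [h1, h']
  have h2 : (s.bind Lam).map ((fun x : ℂ => (k : ℂ) * x) ∘ fun a : ℤ => c * (a : ℂ)) =
      (((s.bind Lam).map fun a => q * a).map fun a => j * a).map
        (fun a : ℤ => c' * (a : ℂ)) := by
    rw [Multiset.map_map, Multiset.map_map]
    refine Multiset.map_congr rfl fun a _ => ?_
    simp only [Function.comp_apply]
    push_cast
    linear_combination (a : ℂ) * hk
  have h3 : (s.bind Lam).map (fun a => q * a) = s.bind Lam := by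
    rcases hq with rfl | rfl
    · simp
    · simpa using map_neg_bind_Lam s
  rw [h2, h3]

theorem partition_eq_of_scale (hc : c' ≠ 0) {q : ℤ} (hq : q = 1 ∨ q = -1) (hk : c = q * c')
    (h : (π'.parts.bind Lam).map (fun a : ℤ => c' * (a : ℂ)) =
      (π.parts.bind Lam).map fun a : ℤ => c * (a : ℂ)) : π' = π := by
  apply partition_eq_of_bind_Lam_eq
  have := map_mul_eq_of_scale (k := 1) (j := 1) hc hq (by simpa using hk) h
  simpa using this

theorem exists_odd_of_zero_mem (hc : c' ≠ 0)
    (h : (π'.parts.bind Lam).map (fun a : ℤ => c' * (a : ℂ)) =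
      (π.parts.bind Lam).map fun a : ℤ => c * (a : ℂ)) (h0 : (0 : ℤ) ∈ π.parts.bind Lam) :
    ∃ p ∈ π'.parts, p % 2 = 1 := by
  obtain ⟨b, hb, hbe⟩ := exists_mem_of_map_mul_eq h h0
  have hb0 : b = 0 := by simpa [hc] using hbe
  subst hb0
  obtain ⟨p, hp, hp'⟩ := Multiset.mem_bind.1 hb
  rw [mem_Lam_iff] at hp'
  exact ⟨p, hp, by omega⟩

/-- Zero is not an eigenvalue, so the parts of π' are even too. Both weight multisets contain 1,
hence c/c' and c'/c are both integers and the ratio is ±1. -/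
theorem partition_eq_of_even_parts (hc : c ≠ 0) (hc' : c' ≠ 0) (hev : ∀ p ∈ π.parts, p % 2 = 0)
    (hne : ∃ a ∈ π.parts.bind Lam, a ≠ 0)
    (h : (π'.parts.bind Lam).map (fun a : ℤ => c' * (a : ℂ)) =
      (π.parts.bind Lam).map fun a : ℤ => c * (a : ℂ)) : π' = π := by
  obtain ⟨a, ha, -⟩ := hne
  obtain ⟨p, hp, -⟩ := Multiset.mem_bind.1 ha
  obtain ⟨q, hq, hqe⟩ := exists_mem_of_map_mul_eq h (one_mem_bind_Lam hp (hev p hp))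
  obtain ⟨p', hp', -⟩ := Multiset.mem_bind.1 hq
  have hev' : ∀ p ∈ π'.parts, p % 2 = 0 := fun p hp => by
    by_contra hodd
    obtain ⟨r, hr, hr1⟩ := exists_odd_of_zero_mem hc h.symm
      (zero_mem_bind_Lam hp (by omega : p % 2 = 1))
    have := hev r hr
    omega
  obtain ⟨b, hb, hbe⟩ := exists_mem_of_map_mul_eq h.symm (one_mem_bind_Lam hp' (hev' p' hp'))
  have hqc : c = q * c' := by linear_combination -hqe
  refine partition_eq_of_scale hc' (Int.isUnit_iff.1 (IsUnit.of_mul_eq_one b ?_)) hqc h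
  have : c' * ((q : ℂ) * b - 1) = 0 := by
    rw [hqc] at hbe
    linear_combination hbe
  have := (mul_eq_zero.1 this).resolve_left hc'
  exact_mod_cast sub_eq_zero.1 this

/-- Since π has the weight 1, q = c/c' is an integer. If π' has an even part, then it has the weight
1 and q divides 1. Otherwise its weights are even and include 2, which forces q = ±2, and halving
Λ_π' exhibits π as a list of consecutive pairs, which is excluded. -/
theorem partition_eq_of_not_even (hc : c ≠ 0) (hc' : c' ≠ 0) (hev : ¬ IsEvenPartition π)
    (hcp : ¬ ∃ m : Multiset ℕ, π.parts = consecutivePairs m)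
    (h : (π'.parts.bind Lam).map (fun a : ℤ => c' * (a : ℂ)) =
      (π.parts.bind Lam).map fun a : ℤ => c * (a : ℂ)) : π' = π := by
  obtain ⟨⟨p0, hp0, hp0e⟩, p1, hp1, hp1e⟩ :
      (∃ p ∈ π.parts, p % 2 = 0) ∧ ∃ p ∈ π.parts, p % 2 = 1 := by
    rw [IsEvenPartition] at hev
    push Not at hev
    obtain ⟨p, hp, q, hq, hpq⟩ := hev
    rcases Nat.mod_two_eq_zero_or_one p with h1 | h1
    · exact ⟨⟨p, hp, h1⟩, q, hq, by omega⟩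
    · exact ⟨⟨q, hq, by omega⟩, p, hp, h1⟩
  obtain ⟨q, hq, hqe⟩ := exists_mem_of_map_mul_eq h (one_mem_bind_Lam hp0 hp0e)
  have hqc : c = q * c' := by linear_combination -hqe
  have key : ∀ j : ℤ, j ∈ π'.parts.bind Lam → ∃ b ∈ π.parts.bind Lam, q * b = j := fun j hj => by
    obtain ⟨b, hb, hbe⟩ := exists_mem_of_map_mul_eq h.symm hj
    refine ⟨b, hb, ?_⟩
    have : c' * ((q : ℂ) * b - j) = 0 := by
      rw [hqc] at hbe
      linear_combination hbe
    have := (mul_eq_zero.1 this).resolve_left hc'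
    exact_mod_cast sub_eq_zero.1 this
  by_cases hodd : ∃ p ∈ π'.parts, p % 2 = 0
  · obtain ⟨p', hp', he⟩ := hodd
    obtain ⟨b, -, hb⟩ := key 1 (one_mem_bind_Lam hp' he)
    exact partition_eq_of_scale hc' (Int.isUnit_iff.1 (IsUnit.of_mul_eq_one b hb)) hqc h
  · have hodd' : ∀ p ∈ π'.parts, p % 2 = 1 := fun p hp => by
      by_contra h'
      exact hodd ⟨p, hp, by omega⟩
    have hq0 : q ≠ 0 := by
      rintro rfl
      exact hc (by simpa using hqc)
    have hq2 := emod_two_of_mem_bind_Lam hodd' hq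
    obtain ⟨b, -, hb⟩ := key 2 (two_mem_bind_Lam hodd' hq hq0)
    obtain ⟨u, hu⟩ : ∃ u, q = 2 * u := ⟨q / 2, by omega⟩
    have hu1 : u = 1 ∨ u = -1 := Int.isUnit_iff.1 (IsUnit.of_mul_eq_one b (by
      rw [hu, mul_assoc] at hb
      omega))
    exfalso
    obtain ⟨m, hm⟩ : ∃ m : Multiset ℕ, π'.parts = m.map fun k => 2 * k + 1 := by
      refine ⟨π'.parts.map fun p => p / 2, ?_⟩
      rw [Multiset.map_map]
      conv_lhs => rw [← Multiset.map_id π'.parts]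
      refine Multiset.map_congr rfl fun p hp => ?_
      have := hodd' p hp
      simp only [id, Function.comp_apply]
      omega
    have h2 := map_mul_eq_of_scale (k := 1) (j := 2) hc' hu1
      (by rw [hqc, hu]; push_cast; ring) h
    obtain ⟨π₁, hπ₁⟩ := exists_partition_consecutivePairs hm
    rw [← map_two_mul_bind_Lam_of_parts hm hπ₁] at h2
    have hinj : Function.Injective fun a : ℤ => 2 * a := fun a b h => by
      have : 2 * a = 2 * b := h
      omega
    have h3 := Multiset.map_injective hinj (by simpa using h2)
    exact hcp ⟨m, by rw [← partition_eq_of_bind_Lam_eq h3, hπ₁]⟩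

/-- The weights of π are even and include 2, so q = 2c/c' is an integer, and it divides every weight
of π'. An even part of π' gives the weight 1 and q = ±1, the halved description; if all parts are
odd, then q = ±2 and the scales agree up to sign. -/
theorem partition_eq_or_of_odd_parts (hc : c ≠ 0) (hc' : c' ≠ 0) {m : Multiset ℕ}
    (hm : π.parts = m.map fun k => 2 * k + 1) (hne : ∃ a ∈ π.parts.bind Lam, a ≠ 0)
    (h : (π'.parts.bind Lam).map (fun a : ℤ => c' * (a : ℂ)) =
      (π.parts.bind Lam).map fun a : ℤ => c * (a : ℂ)) :
    π' = π ∨ π'.parts = consecutivePairs m := by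
  have hodd : ∀ p ∈ π.parts, p % 2 = 1 := fun p hp => by
    rw [hm] at hp
    obtain ⟨k, -, rfl⟩ := Multiset.mem_map.1 hp
    omega
  obtain ⟨a, ha, ha0⟩ := hne
  obtain ⟨q, hq, hqe⟩ := exists_mem_of_map_mul_eq h (two_mem_bind_Lam hodd ha ha0)
  have key : ∀ j : ℤ, j ∈ π'.parts.bind Lam → ∃ b, q * b = j := fun j hj => by
    obtain ⟨b, hb, hbe⟩ := exists_mem_of_map_mul_eq h.symm hj
    have := emod_two_of_mem_bind_Lam hodd hb
    obtain ⟨d, rfl⟩ : ∃ d, b = 2 * d := ⟨b / 2, by omega⟩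
    refine ⟨d, ?_⟩
    have : c' * ((q : ℂ) * d - j) = 0 := by
      push_cast at hbe hqe
      linear_combination hbe + d * hqe
    have := (mul_eq_zero.1 this).resolve_left hc'
    exact_mod_cast sub_eq_zero.1 this
  by_cases hodd2 : ∃ p ∈ π'.parts, p % 2 = 0
  · right
    obtain ⟨p', hp', he⟩ := hodd2
    obtain ⟨b, hb⟩ := key 1 (one_mem_bind_Lam hp' he)
    have h2 := map_mul_eq_of_scale (k := 2) (j := 1) hc'
      (Int.isUnit_iff.1 (IsUnit.of_mul_eq_one b hb)) (by
        push_cast at hqe ⊢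
        linear_combination -hqe) h
    obtain ⟨π₁, hπ₁⟩ := exists_partition_consecutivePairs hm
    have hinj : Function.Injective fun a : ℤ => 2 * a := fun a b h => by
      have : 2 * a = 2 * b := h
      omega
    simp only [one_mul, Multiset.map_id'] at h2
    rw [← map_two_mul_bind_Lam_of_parts hm hπ₁] at h2
    have h3 := Multiset.map_injective hinj h2
    rw [partition_eq_of_bind_Lam_eq h3, hπ₁]
  · left
    have hodd' : ∀ p ∈ π'.parts, p % 2 = 1 := fun p hp => by
      by_contra h'
      exact hodd2 ⟨p, hp, by omega⟩
    have hq2 := emod_two_of_mem_bind_Lam hodd' hq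
    have hq0 : q ≠ 0 := by
      rintro rfl
      exact hc (by simpa using hqe.symm)
    obtain ⟨u, rfl⟩ : ∃ u, q = 2 * u := ⟨q / 2, by omega⟩
    obtain ⟨b, hb⟩ := key 2 (two_mem_bind_Lam hodd' hq hq0)
    refine partition_eq_of_scale hc' (Int.isUnit_iff.1 (IsUnit.of_mul_eq_one (a := u) b (by
      rw [mul_assoc] at hb
      omega))) ?_ h
    push_cast at hqe
    linear_combination (-1 / 2 : ℂ) * hqe

end Scaling

end OrbitK

namespace OrbitK

variable {n : ℕ}

/-! ### Diagonalizable matrices and their spectra -/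

theorem isDiagonalizable_iff {A : Matrix (Fin n) (Fin n) ℂ} :
    IsDiagonalizable A ↔ ∃ d, Sim (diagonal d) A := by
  constructor
  · rintro ⟨P, d, hP, rfl⟩
    exact ⟨d, P, P⁻¹, mul_nonsing_inv P hP, rfl⟩
  · rintro ⟨d, P, Q, h, rfl⟩
    refine ⟨P, d, ?_, by rw [inv_eq_right_inv h]⟩
    exact (isUnit_iff_isUnit_det P).1 (IsUnit.of_mul_eq_one Q h)

theorem roots_charpoly_diagonal (d : Fin n → ℂ) :
    (diagonal d).charpoly.roots = Finset.univ.val.map d := by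
  rw [charpoly_diagonal, ← Polynomial.roots_multiset_prod_X_sub_C (Finset.univ.val.map d),
    Multiset.map_map]
  rfl

theorem sim_diagonal_iff {A : Matrix (Fin n) (Fin n) ℂ} {lam : Fin n → ℂ} :
    Sim (diagonal lam) A ↔ IsDiagonalizable A ∧ HasEigenvalues A lam := by
  constructor
  · intro h
    exact ⟨isDiagonalizable_iff.2 ⟨lam, h⟩, by
      rw [HasEigenvalues, ← h.charpoly_eq, roots_charpoly_diagonal]⟩
  · rintro ⟨h1, h2⟩
    obtain ⟨d, hd⟩ := isDiagonalizable_iff.1 h1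
    rw [HasEigenvalues, ← hd.charpoly_eq, roots_charpoly_diagonal] at h2
    obtain ⟨σ, hσ⟩ := exists_equiv_of_map_univ_eq h2
    have h3 := sim_submatrix_perm (diagonal lam) σ
    have h4 : (diagonal lam).submatrix σ σ = diagonal d := by
      rw [submatrix_diagonal_equiv]
      exact congrArg diagonal (funext fun i => (hσ i).symm)
    rw [h4] at h3
    exact h3.trans hd

theorem eigenvaluesOfForm_iff {A : Matrix (Fin n) (Fin n) ℂ} {c : ℂ} {π : n.Partition} :
    EigenvaluesOfForm A c π ↔ HasEigenvalues A fun x => c * (weight π x : ℂ) := by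
  rw [EigenvaluesOfForm, HasEigenvalues, ← map_weight, Multiset.map_map]
  rfl

theorem sim_diagonal_weight_iff {A : Matrix (Fin n) (Fin n) ℂ} {c : ℂ} {π : n.Partition} :
    Sim (diagonal fun x => c * (weight π x : ℂ)) A ↔
      IsDiagonalizable A ∧ EigenvaluesOfForm A c π := by
  rw [sim_diagonal_iff, eigenvaluesOfForm_iff]

theorem smul_mom_diagBlocks_eMat (π : n.Partition) (c : ℂ) :
    c • mom (diagBlocks π eMat) = diagonal fun x => c * (weight π x : ℂ) := by
  rw [mom_diagBlocks_eMat, diagBlocks_xMat, ← diagonal_smul]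
  rfl

theorem HasJordanType.sim {A : Matrix (Fin n) (Fin n) ℂ} {π : n.Partition}
    (h : HasJordanType A π) : Sim (diagBlocks π eMat) A := by
  obtain ⟨P, hP, rfl⟩ := h
  exact (sim_diagBlocks_jordanBlock π).symm.trans ⟨P, P⁻¹, mul_nonsing_inv P hP, rfl⟩

theorem Sim.eq_smul_one {A : Matrix (Fin n) (Fin n) ℂ} (h : Sim 0 A) :
    ∃ c : ℂ, A = c • (1 : Matrix (Fin n) (Fin n) ℂ) := by
  obtain ⟨P, Q, -, rfl⟩ := h
  exact ⟨0, by simp⟩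

theorem diagonal_eq_zero_of_isNilpotent {d : Fin n → ℂ} (h : IsNilpotent (diagonal d)) :
    diagonal d = 0 := by
  obtain ⟨k, hk⟩ := h
  rw [diagonal_pow, diagonal_eq_zero] at hk
  rw [diagonal_eq_zero]
  exact funext fun i => eq_zero_of_pow_eq_zero (congrFun hk i)

open scoped ComplexOrder in
-- A normal C and its adjoint have the same kernel, so C(CX) = 0 gives C*CX = 0 and hence CX = 0.
theorem mul_eq_zero_of_normal {C X : Matrix (Fin n) (Fin n) ℂ} (hC : C * Cᴴ = Cᴴ * C)
    (h : C * (C * X) = 0) : C * X = 0 := by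
  have h1 : Cᴴ * (C * X) = 0 := by
    rw [← self_mul_conjTranspose_mul_eq_zero, hC, mul_assoc, h, Matrix.mul_zero]
  rwa [← mul_assoc, conjTranspose_mul_self_mul_eq_zero] at h1

/-- Normal matrices are diagonalizable. -/
theorem isDiagonalizable_of_mom_eq_zero {B : Matrix (Fin n) (Fin n) ℂ} (hB : mom B = 0) :
    IsDiagonalizable B := by
  obtain ⟨d, N, hc, hN, hs⟩ := exists_sim_diagonal_add_nilpotent B
  obtain ⟨P, Q, hPQ, hBe⟩ := hs.symm
  have hQP : Q * P = 1 := mul_eq_one_comm.1 hPQ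
  suffices hN0 : N = 0 by
    rw [hN0, add_zero] at hs
    exact isDiagonalizable_iff.2 ⟨d, hs.symm⟩
  by_contra hN0
  -- Take the last nonzero power of N and a basis vector e_i that it does not kill. On the vectors
  -- N^m e_i the matrix B - d_i acts, up to the change of basis P, as N; this contradicts
  -- `mul_eq_zero_of_normal`.
  have hex : ∃ k, N ^ (k + 1) ≠ 0 ∧ N ^ (k + 2) = 0 := by
    by_contra hcon
    push Not at hcon
    have : ∀ k, N ^ (k + 1) ≠ 0 := fun k => by
      induction k with
      | zero => simpa using hN0
      | succ k ih => exact hcon k ih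
    obtain ⟨k, hk⟩ := hN
    exact this k (by rw [pow_succ, hk, Matrix.zero_mul])
  obtain ⟨k, hk1, hk2⟩ := hex
  obtain ⟨i, hi⟩ : ∃ i, N ^ (k + 1) * single i i (1 : ℂ) ≠ 0 := by
    by_contra hcon
    push Not at hcon
    apply hk1
    ext a b
    have := congrFun (congrFun (hcon b) a) b
    simpa using this
  set X := N ^ k * single i i (1 : ℂ) with hX
  set C := B - d i • (1 : Matrix (Fin n) (Fin n) ℂ) with hC
  have hCn : C * Cᴴ = Cᴴ * C := by
    have h1 : B * Bᴴ = Bᴴ * B := sub_eq_zero.1 hB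
    simp only [hC, conjTranspose_sub, conjTranspose_smul, conjTranspose_one, mul_sub, sub_mul, h1,
      Matrix.mul_smul, Matrix.smul_mul, mul_one, one_mul, smul_smul]
    rw [mul_comm (star (d i))]
    abel
  have hCe : C = P * (diagonal d - d i • 1 + N) * Q := by
    rw [hC, hBe]
    simp only [mul_add, add_mul, mul_sub, sub_mul, Matrix.mul_smul, Matrix.smul_mul, mul_one, hPQ]
    abel
  have hd : (diagonal d - d i • (1 : Matrix (Fin n) (Fin n) ℂ)) * single i i (1 : ℂ) = 0 := by
    rw [sub_mul, Matrix.smul_mul, one_mul, sub_eq_zero]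
    ext a b
    rw [diagonal_mul, Matrix.smul_apply, single_apply]
    split_ifs with h
    · rw [h.1]; rfl
    · simp
  have hdN : ∀ m, (diagonal d - d i • (1 : Matrix (Fin n) (Fin n) ℂ)) * (N ^ m * single i i (1 : ℂ))
      = 0 := fun m => by
    have : Commute (diagonal d - d i • (1 : Matrix (Fin n) (Fin n) ℂ)) (N ^ m) :=
      (hc.sub_left ((Commute.one_left N).smul_left _)).pow_right m
    rw [← mul_assoc, this.eq, mul_assoc, hd, Matrix.mul_zero]
  have step : ∀ m, C * (P * (N ^ m * single i i (1 : ℂ))) =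
      P * (N ^ (m + 1) * single i i (1 : ℂ)) := fun m => by
    calc C * (P * (N ^ m * single i i (1 : ℂ)))
        = P * (diagonal d - d i • 1 + N) * (Q * P) * (N ^ m * single i i (1 : ℂ)) := by
          rw [hCe]; simp only [mul_assoc]
      _ = P * ((diagonal d - d i • 1) * (N ^ m * single i i (1 : ℂ)) +
          N * (N ^ m * single i i (1 : ℂ))) := by
          rw [hQP, mul_one, mul_assoc, add_mul]
      _ = _ := by rw [hdN, zero_add, ← mul_assoc N, ← pow_succ']
  have h0 : C * (C * (P * X)) = 0 := by
    rw [hX, step, step, hk2]; simp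
  have h1 := mul_eq_zero_of_normal hCn h0
  rw [hX, step] at h1
  apply hi
  calc N ^ (k + 1) * single i i (1 : ℂ) = Q * (P * (N ^ (k + 1) * single i i (1 : ℂ))) := by
        rw [← mul_assoc, hQP, one_mul]
    _ = 0 := by rw [h1, Matrix.mul_zero]

/-! ### The standard critical points -/

theorem USim.refl (A : Matrix (Fin n) (Fin n) ℂ) : USim A A := ⟨1, one_mem _, by simp⟩

theorem unitary_conj_tripleComb {U E : Matrix (Fin n) (Fin n) ℂ}
    (hU : U ∈ unitaryGroup (Fin n) ℂ) (a b c : ℂ) :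
    U * tripleComb E a b c * star U = tripleComb (U * E * star U) a b c := by
  have hm : mom (U * E * star U) = U * mom E * star U := by
    rw [mom, conjTranspose_unitary_conj, unitary_conj_mul hU, unitary_conj_mul hU, mom, mul_sub,
      sub_mul]
  simp only [tripleComb, hm, conjTranspose_unitary_conj, mul_add, add_mul, Matrix.mul_smul,
    Matrix.smul_mul]

theorem IsTriple.of_usim {E F : Matrix (Fin n) (Fin n) ℂ} (hE : IsTriple E) (h : USim E F) :
    IsTriple F := by
  obtain ⟨U, hU, rfl⟩ := h
  have hm : OrbitK.mom (U * E * star U) = U * OrbitK.mom E * star U := by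
    rw [OrbitK.mom, conjTranspose_unitary_conj, unitary_conj_mul hU, unitary_conj_mul hU,
      OrbitK.mom, mul_sub, sub_mul]
  have h1 : OrbitK.mom E * E - E * OrbitK.mom E = (2 : ℂ) • E := hE
  rw [IsTriple, hm, unitary_conj_mul hU, unitary_conj_mul hU, ← sub_mul, ← mul_sub, h1,
    Matrix.mul_smul, Matrix.smul_mul]

theorem mem_suOrbit_stdSl2_diff_iff {π : n.Partition} {B : Matrix (Fin n) (Fin n) ℂ} :
    B ∈ suOrbit (stdSl2 π \ Z n) ↔ B ∉ Z n ∧ ∃ E a b c, USim (diagBlocks π eMat) E ∧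
      B = tripleComb E a b c := by
  rw [mem_suOrbit_iff]
  constructor
  · rintro ⟨M, ⟨hM, hMZ⟩, hMB⟩
    refine ⟨fun h => hMZ (hMB.mem_Z_iff.2 h), ?_⟩
    obtain ⟨a, b, c, rfl⟩ := mem_stdSl2_iff.1 hM
    obtain ⟨U, hU, rfl⟩ := hMB
    exact ⟨_, a, b, c, ⟨U, hU, rfl⟩, unitary_conj_tripleComb hU a b c⟩
  · rintro ⟨hBZ, E, a, b, c, ⟨U, hU, rfl⟩, rfl⟩
    have h : USim (tripleComb (diagBlocks π eMat) a b c)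
        (tripleComb (U * diagBlocks π eMat * star U) a b c) :=
      ⟨U, hU, (unitary_conj_tripleComb hU a b c).symm⟩
    exact ⟨_, ⟨mem_stdSl2_iff.2 ⟨a, b, c, rfl⟩, fun h' => hBZ (h.mem_Z_iff.1 h')⟩, h⟩

theorem suOrbit_diff_Z (S : Set (Matrix (Fin n) (Fin n) ℂ)) : suOrbit
    (S \ Z n) = suOrbit S \ Z n := by
  ext B
  simp only [mem_suOrbit_iff, Set.mem_sdiff]
  constructor
  · rintro ⟨M, ⟨hM, hMZ⟩, hMB⟩
    exact ⟨⟨M, hM, hMB⟩, fun h => hMZ (hMB.mem_Z_iff.2 h)⟩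
  · rintro ⟨⟨M, hM, hMB⟩, hBZ⟩
    exact ⟨M, ⟨hM, fun h => hBZ (hMB.mem_Z_iff.1 h)⟩, hMB⟩

theorem K_eq_C_of_mem {π : n.Partition} {B : Matrix (Fin n) (Fin n) ℂ}
    (h : B ∈ suOrbit (stdSl2 π \ Z n)) : K B = C π ∧ IsCriticalPoint B := by
  obtain ⟨hBZ, E, a, b, c, hE, rfl⟩ := mem_suOrbit_stdSl2_diff_iff.1 h
  rw [C_eq_normSq, hE.normSq_eq]
  exact ((isTriple_diagBlocks_eMat π).of_usim hE).K_tripleComb hBZ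

theorem zero_mem_Z : (0 : Matrix (Fin n) (Fin n) ℂ) ∈ Z n := by
  refine ⟨trace_zero _ _, ?_⟩
  simp [normSq_zero]

theorem sim_of_mem_suOrbit_stdSl2 {π : n.Partition} {B : Matrix (Fin n) (Fin n) ℂ}
    (h : B ∈ suOrbit (stdSl2 π \ Z n)) :
    (∃ z : ℂ, z ≠ 0 ∧ Sim (diagonal fun x => z * (weight π x : ℂ)) B) ∨
      Sim (diagBlocks π eMat) B := by
  obtain ⟨M, ⟨hM, hMZ⟩, hMB⟩ := mem_suOrbit_iff.1 h
  obtain ⟨a, b, c, rfl⟩ := mem_stdSl2_iff.1 hM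
  obtain ⟨z, hz⟩ := IsAlgClosed.exists_pow_nat_eq (c ^ 2 + a * b) (n := 2) two_pos
  obtain ⟨h1, h2⟩ := (isTriple_diagBlocks_eMat π).sim_tripleComb
    (fun h0 => hMZ (h0 ▸ zero_mem_Z)) hz
  by_cases hz0 : z = 0
  · exact Or.inr ((h2 hz0).symm.trans hMB.sim)
  · refine Or.inl ⟨z, hz0, ?_⟩
    rw [← smul_mom_diagBlocks_eMat]
    exact (h1 hz0).symm.trans hMB.sim

theorem mom_eq_zero_or_exists_mem_of_isCriticalPoint {B : Matrix (Fin n) (Fin n) ℂ}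
    (ht : trace B = 0) (hZ : B ∉ Z n) (hc : IsCriticalPoint B) :
    mom B = 0 ∨ ∃ π : n.Partition, B ∈ suOrbit (stdSl2 π \ Z n) := by
  by_cases hm : mom B = 0
  · exact Or.inl hm
  · right
    have hD := denom_pos ht hZ
    obtain ⟨E, a, b, hE, hB⟩ := exists_triple_of_gradK hD ((isCriticalPoint_iff hD).1 hc) hm
    obtain ⟨π, hπ⟩ := hE.exists_usim
    exact ⟨π, mem_suOrbit_stdSl2_diff_iff.2 ⟨hZ, E, a, b, 0, hπ, hB⟩⟩

/-- The semisimple element c[E, E*] may lie in Z, so cE + c[E, E*] is used: it is similar to the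
former, and its Gram determinant is (3² - 2²)|c|⁴|E|⁴ > 0. -/
theorem nonempty_of_sim {A : Matrix (Fin n) (Fin n) ℂ} {π : n.Partition} {c : ℂ} (hc : c ≠ 0)
    (h0 : diagBlocks π eMat ≠ 0) (h : Sim (diagonal fun x => c * (weight π x : ℂ)) A) :
    (suOrbit (stdSl2 π \ Z n) ∩ slOrbit A).Nonempty := by
  have hE := isTriple_diagBlocks_eMat π
  have hq := normSq_pos h0
  have hZ : tripleComb (diagBlocks π eMat) c 0 c ∉ Z n := by
    apply notMem_Z_of_denom_pos
    rw [hE.normSq_tripleComb, hE.trace_tripleComb_mul_self]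
    simp only [norm_zero, norm_mul, Complex.norm_real, Real.norm_eq_abs, abs_of_pos hq, mul_zero,
      add_zero, norm_pow, Complex.norm_ofNat]
    have h1 : 0 < ‖c‖ := norm_pos_iff.2 hc
    have h2 : 0 < ‖c‖ ^ 4 * normSq (diagBlocks π eMat) ^ 2 := by positivity
    nlinarith
  refine ⟨_, mem_suOrbit_iff.2 ⟨_, ⟨mem_stdSl2_iff.2 ⟨c, 0, c, rfl⟩, hZ⟩, USim.refl _⟩,
    mem_slOrbit_iff.2 ?_⟩
  have h1 := (hE.sim_tripleComb (a := c) (b := 0) (c := c) (z := c)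
    (fun h' => hZ (h' ▸ zero_mem_Z)) (by ring)).1 hc
  rw [smul_mom_diagBlocks_eMat] at h1
  exact h.symm.trans h1.symm

theorem diagBlocks_eMat_ne_zero_iff {π : n.Partition} :
    diagBlocks π eMat ≠ 0 ↔ ∃ a ∈ π.parts.bind Lam, a ≠ 0 := by
  have h1 := (isTriple_diagBlocks_eMat π).normSq_mom
  rw [mom_diagBlocks_eMat, diagBlocks_xMat] at h1
  constructor
  · intro h
    by_contra hcon
    push Not at hcon
    have h2 : ∀ x, (weight π x : ℂ) = 0 := fun x => by rw [hcon _ (weight_mem π x), Int.cast_zero]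
    rw [diagonal_eq_zero.2 (funext h2), normSq_zero] at h1
    have := normSq_pos h
    linarith
  · rintro ⟨a, ha, ha0⟩ h
    rw [h, normSq_zero, mul_zero, normSq_eq_zero, diagonal_eq_zero] at h1
    rw [← map_weight] at ha
    obtain ⟨x, -, rfl⟩ := Multiset.mem_map.1 ha
    have h2 : (weight π x : ℂ) = 0 := congrFun h1 x
    exact ha0 (by exact_mod_cast h2)

theorem C_pos {π : n.Partition} (h : diagBlocks π eMat ≠ 0) : 0 < C π := by
  rw [C_eq_normSq]
  exact div_pos two_pos (normSq_pos h)

theorem diagBlocks_eMat_ne_zero_of_sim {A : Matrix (Fin n) (Fin n) ℂ} {π : n.Partition} {c : ℂ}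
    (hA : ¬ ∃ c : ℂ, A = c • (1 : Matrix (Fin n) (Fin n) ℂ))
    (h : Sim (diagonal fun x => c * (weight π x : ℂ)) A) : diagBlocks π eMat ≠ 0 := by
  intro h0
  rw [← smul_mom_diagBlocks_eMat, h0] at h
  exact hA (Sim.eq_smul_one (by simpa [mom] using h))

end OrbitK

namespace OrbitK

variable {n : ℕ} {A B : Matrix (Fin n) (Fin n) ℂ}

/-! ### Critical points and extremal values on an orbit -/

theorem slOrbit.sim (h : B ∈ slOrbit A \ Z n) : Sim A B := mem_slOrbit_iff.1 h.1

theorem denom_pos_of_mem (htr : trace A = 0) (h : B ∈ slOrbit A \ Z n) :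
    0 < normSq B ^ 2 - ‖trace (B * B)‖ ^ 2 :=
  denom_pos (by rw [← (slOrbit.sim h).trace_eq, htr]) h.2

theorem mem_slOrbit_diff_Z_of_denom_pos (h : Sim A B)
    (hD : 0 < normSq B ^ 2 - ‖trace (B * B)‖ ^ 2) : B ∈ slOrbit A \ Z n :=
  ⟨mem_slOrbit_iff.2 h, notMem_Z_of_denom_pos hD⟩

theorem mem_criticalSet_of_mem_suOrbit {π : n.Partition}
    (h : B ∈ suOrbit (stdSl2 π \ Z n) ∩ slOrbit A) : B ∈ criticalSet A :=
  ⟨⟨h.2, (mem_suOrbit_stdSl2_diff_iff.1 h.1).1⟩, (K_eq_C_of_mem h.1).2⟩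

theorem mem_criticalSet_of_forall_le (htr : trace A = 0) (hB : B ∈ slOrbit A \ Z n)
    (h : ∀ B' ∈ slOrbit A \ Z n, K B ≤ K B') : B ∈ criticalSet A :=
  ⟨hB, isCriticalPoint_of_isMinOn htr hB h⟩

theorem mom_eq_zero_or_exists_mem_of_mem_criticalSet (htr : trace A = 0) (h : B ∈ criticalSet A) :
    mom B = 0 ∨ ∃ π : n.Partition, B ∈ suOrbit (stdSl2 π \ Z n) :=
  mom_eq_zero_or_exists_mem_of_isCriticalPoint (by rw [← (slOrbit.sim h.1).trace_eq, htr]) h.1.2 h.2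

theorem K_eq_zero_iff (hD : 0 < normSq B ^ 2 - ‖trace (B * B)‖ ^ 2) : K B = 0 ↔ mom B = 0 := by
  rw [K_eq_div, div_eq_zero_iff, normSq_eq_zero, or_iff_left hD.ne']

theorem not_isNilpotent_of_sim_diagonal (hA : ¬ ∃ c : ℂ, A = c • (1 : Matrix (Fin n) (Fin n) ℂ))
    {d : Fin n → ℂ} (h : Sim (diagonal d) A) : ¬ IsNilpotent A := fun hnil => by
  rw [diagonal_eq_zero_of_isNilpotent (h.symm.isNilpotent hnil)] at h
  exact hA h.eq_smul_one

theorem isNilpotent_diagBlocks_eMat (π : n.Partition) : IsNilpotent (diagBlocks π eMat) := by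
  open scoped Matrix.Norms.Operator in
  exact isNilpotent_of_bracket (X := mom (diagBlocks π eMat)) (isTriple_diagBlocks_eMat π)

theorem hasMinimumExactlyOn_of_forall {v : ℝ} {S : Set (Matrix (Fin n) (Fin n) ℂ)}
    (hS : S.Nonempty) (h1 : ∀ B ∈ S, B ∈ slOrbit A \ Z n ∧ K B = v)
    (h2 : ∀ B ∈ slOrbit A \ Z n, v ≤ K B) (h3 : ∀ B ∈ slOrbit A \ Z n, K B = v → B ∈ S) :
    HasMinimumExactlyOn A v S := by
  refine ⟨⟨?_, ?_⟩, ?_⟩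
  · obtain ⟨B, hB⟩ := hS
    exact ⟨B, h1 B hB⟩
  · rintro _ ⟨B, hB, rfl⟩
    exact h2 B hB
  · ext B
    exact ⟨fun h => h3 B h.1 h.2, h1 B⟩

/-! ### Orbits with uni-real spectrum -/

section UniReal

variable {c : ℂ} {r : Fin n → ℝ}

theorem sim_inv_smul (hc : c ≠ 0) (h : Sim (diagonal fun x => c * (r x : ℂ)) B) :
    Sim (diagonal fun x => (r x : ℂ)) (c⁻¹ • B) := by
  have h1 := h.smul c⁻¹
  rw [← diagonal_smul] at h1
  convert h1 using 2
  ext x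
  simp [hc]

theorem sim_smul_of_sim (h : Sim (diagonal fun x => (r x : ℂ)) B) :
    Sim (diagonal fun x => c * (r x : ℂ)) (c • B) := by
  have h1 := h.smul c
  rwa [← diagonal_smul] at h1

theorem denom_smul_pos (hc : c ≠ 0) (hD : 0 < normSq B ^ 2 - ‖trace (B * B)‖ ^ 2) :
    0 < normSq (c • B) ^ 2 - ‖trace (c • B * (c • B))‖ ^ 2 := by
  have h : normSq (c • B) ^ 2 - ‖trace (c • B * (c • B))‖ ^ 2 =
      ‖c‖ ^ 4 * (normSq B ^ 2 - ‖trace (B * B)‖ ^ 2) := by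
    rw [normSq_smul, smul_mul_smul_comm, trace_smul, norm_smul, norm_mul]
    ring
  rw [h]
  have := norm_pos_iff.2 hc
  positivity

theorem le_K_of_mem (htr : trace A = 0) (hc : c ≠ 0)
    (h : Sim (diagonal fun x => c * (r x : ℂ)) A) {d : ℝ} (hd0 : 0 ≤ d)
    (hd : ∀ i j, r j < r i → d ≤ r i - r j) (hB : B ∈ slOrbit A \ Z n) :
    d ^ 2 / ∑ i, r i ^ 2 ≤ K B := by
  rw [← K_smul (inv_ne_zero hc) B]
  exact le_K_of_sim_diagonal hd0 hd (sim_inv_smul hc (h.trans (slOrbit.sim hB)))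
    (denom_smul_pos (inv_ne_zero hc) (denom_pos_of_mem htr hB))

theorem hasInfimum_of_sim_diagonal (htr : trace A = 0) (hc : c ≠ 0)
    (h : Sim (diagonal fun x => c * (r x : ℂ)) A) {i j : Fin n} (hij : r i ≠ r j)
    (hmin : ∀ k l, r l < r k → |r i - r j| ≤ r k - r l) :
    HasInfimum A ((r i - r j) ^ 2 / ∑ k, r k ^ 2) := by
  constructor
  · rintro _ ⟨B, hB, rfl⟩
    rw [← sq_abs]
    exact le_K_of_mem htr hc h (abs_nonneg _) hmin hB
  · intro b hb
    have hS : 0 < ∑ k, r k ^ 2 := by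
      refine lt_of_le_of_ne (Finset.sum_nonneg fun k _ => sq_nonneg _) fun h0 => hij ?_
      have h1 := (Finset.sum_eq_zero_iff_of_nonneg fun k _ => sq_nonneg (r k)).1 h0.symm
      rw [pow_eq_zero_iff two_ne_zero |>.1 (h1 i (Finset.mem_univ _)),
        pow_eq_zero_iff two_ne_zero |>.1 (h1 j (Finset.mem_univ _))]
    -- A lower bound b holds along diag(r) + tE_ij, up to the scalar c; letting t tend to 0 bounds
    -- it by the claimed infimum.
    have hle : ∀ t : ℝ, t ≠ 0 → b ≤ (2 * (r i - r j) ^ 2 + 2 * t ^ 2) / (2 * ∑ k, r k ^ 2 + t ^ 2) := by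
      intro t ht
      obtain ⟨B, hB, hD, hK⟩ := exists_K_eq_of_ne hij ht
      rw [← hK, ← K_smul hc B]
      exact hb ⟨c • B, mem_slOrbit_diff_Z_of_denom_pos (h.symm.trans (sim_smul_of_sim hB))
        (denom_smul_pos hc hD), rfl⟩
    have hcont : ContinuousAt (fun t : ℝ =>
        (2 * (r i - r j) ^ 2 + 2 * t ^ 2) / (2 * ∑ k, r k ^ 2 + t ^ 2)) 0 :=
      ContinuousAt.div (by fun_prop) (by fun_prop) (by positivity)
    have hlim := hcont.tendsto.mono_left (nhdsWithin_le_nhds (s := {0}ᶜ))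
    have h1 := ge_of_tendsto hlim (eventually_nhdsWithin_of_forall hle)
    simpa [mul_div_mul_left] using h1

/-- A normal element of a uni-real orbit is unitarily similar to a multiple of a real diagonal
matrix, where the denominator of K vanishes. -/
theorem mom_ne_zero_of_mem (htr : trace A = 0) (h : Sim (diagonal fun x => c * (r x : ℂ)) A)
    (hB : B ∈ slOrbit A \ Z n) : mom B ≠ 0 := fun h0 => by
  have h1 := usim_diagonal_of_mom_eq_zero (h.trans (slOrbit.sim hB)) h0
  refine hB.2 (h1.mem_Z_iff.1 ⟨?_, ?_⟩)
  · rw [h.trace_eq, htr]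
  · have h2 : (diagonal fun x => c * (r x : ℂ)) = c • diagonal fun x => (r x : ℂ) := by
      rw [← diagonal_smul]
      rfl
    rw [h2]
    exact denom_smul_isHermitian (diagonal_ofReal_conjTranspose r) c

/-- Normal points are excluded by Z, and the nilpotent alternative by diagonalizability and
nonscalarity; what remains is a description of the spectrum by some π and z, to be compared with the
given one. -/
theorem exists_partition_of_mem_criticalSet (htr : trace A = 0)
    (hA : ¬ ∃ c : ℂ, A = c • (1 : Matrix (Fin n) (Fin n) ℂ))
    (h : Sim (diagonal fun x => c * (r x : ℂ)) A) (hB : B ∈ criticalSet A) :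
    ∃ (π : n.Partition) (z : ℂ), z ≠ 0 ∧ B ∈ suOrbit (stdSl2 π \ Z n) ∩ slOrbit A ∧
      Sim (diagonal fun x => z * (weight π x : ℂ)) A := by
  obtain ⟨π, hπ⟩ := (mom_eq_zero_or_exists_mem_of_mem_criticalSet htr hB).resolve_left
    (mom_ne_zero_of_mem htr h hB.1)
  have hAB := slOrbit.sim hB.1
  rcases sim_of_mem_suOrbit_stdSl2 hπ with ⟨z, hz, hs⟩ | hs
  · exact ⟨π, z, hz, ⟨hπ, hB.1.1⟩, hs.trans hAB.symm⟩
  · exact absurd ((hs.trans hAB.symm).isNilpotent (isNilpotent_diagBlocks_eMat π))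
      (not_isNilpotent_of_sim_diagonal hA h)

theorem map_mul_eq_of_sim {π π' : n.Partition} {z : ℂ}
    (h : Sim (diagonal fun x => c * (weight π x : ℂ)) A)
    (h' : Sim (diagonal fun x => z * (weight π' x : ℂ)) A) :
    (π'.parts.bind Lam).map (fun a : ℤ => z * (a : ℂ)) =
      (π.parts.bind Lam).map fun a : ℤ => c * (a : ℂ) :=
  (sim_diagonal_weight_iff.1 h').2.symm.trans (sim_diagonal_weight_iff.1 h).2

theorem sim_ofReal_weight {π : n.Partition} (h : Sim (diagonal fun x => c * (weight π x : ℂ)) A) :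
    Sim (diagonal fun x => c * (((weight π x : ℝ)) : ℂ)) A := by
  simpa using h

/-- When all parts have the same parity, distinct weights differ by at least 2, so the spectral
bound 2²/∑w² equals C_π. -/
theorem C_le_K_of_emod {π : n.Partition} (htr : trace A = 0) (hc : c ≠ 0)
    (h : Sim (diagonal fun x => c * (weight π x : ℂ)) A) {ρ : ℕ} (hπ : ∀ p ∈ π.parts, p % 2 = ρ)
    (hB : B ∈ slOrbit A \ Z n) : C π ≤ K B := by
  have h1 := le_K_of_mem htr hc (sim_ofReal_weight h) (d := 2) two_pos.le (fun i j hij => by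
    have h2 := emod_two_of_mem_bind_Lam hπ (weight_mem π i)
    have h3 := emod_two_of_mem_bind_Lam hπ (weight_mem π j)
    have h4 : weight π j < weight π i := by exact_mod_cast hij
    have h5 : (2 : ℤ) ≤ weight π i - weight π j := by omega
    exact_mod_cast h5) hB
  rw [C_eq]
  norm_num at h1 ⊢
  exact h1

end UniReal

/-! ### `K` on each type of orbit -/

theorem hasMinimum_of_even_parts (htr : trace A = 0)
    (hA : ¬ ∃ c : ℂ, A = c • (1 : Matrix (Fin n) (Fin n) ℂ)) {m : Multiset ℕ} {π : n.Partition}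
    {c : ℂ}
    (hm : π.parts = m.map fun k => 2 * k) (hd : IsDiagonalizable A) (hc : c ≠ 0)
    (hev : EigenvaluesOfForm A c π) :
    HasMinimumExactlyOn A (C π) (suOrbit (stdSl2 π \ Z n) ∩ slOrbit A) ∧
      criticalSet A = suOrbit (stdSl2 π \ Z n) ∩ slOrbit A := by
  have h := sim_diagonal_weight_iff.2 ⟨hd, hev⟩
  have h0 := diagBlocks_eMat_ne_zero_of_sim hA h
  have hp : ∀ p ∈ π.parts, p % 2 = 0 := fun p hp => by
    rw [hm] at hp
    obtain ⟨k, -, rfl⟩ := Multiset.mem_map.1 hp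
    omega
  have hle : ∀ B ∈ slOrbit A \ Z n, C π ≤ K B := fun B hB => C_le_K_of_emod htr hc h hp hB
  have hcrit : ∀ B ∈ criticalSet A, B ∈ suOrbit (stdSl2 π \ Z n) ∩ slOrbit A := fun B hB => by
    obtain ⟨π', z, hz, hB', hs⟩ := exists_partition_of_mem_criticalSet htr hA (sim_ofReal_weight h) hB
    rwa [partition_eq_of_even_parts hc hz hp (diagBlocks_eMat_ne_zero_iff.1 h0)
      (map_mul_eq_of_sim h hs)] at hB'
  refine ⟨hasMinimumExactlyOn_of_forall (nonempty_of_sim hc h0 h) (fun B hB => ?_) hle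
    fun B hB hK => ?_, Set.Subset.antisymm hcrit fun B => mem_criticalSet_of_mem_suOrbit⟩
  · exact ⟨(mem_criticalSet_of_mem_suOrbit hB).1, (K_eq_C_of_mem hB.1).1⟩
  · exact hcrit B (mem_criticalSet_of_forall_le htr hB (by rwa [hK]))

theorem hasMinimum_of_odd_parts (htr : trace A = 0)
    (hA : ¬ ∃ c : ℂ, A = c • (1 : Matrix (Fin n) (Fin n) ℂ)) {m : Multiset ℕ} {π : n.Partition}
    {c : ℂ}
    (hm : π.parts = m.map fun k => 2 * k + 1) (hd : IsDiagonalizable A) (hc : c ≠ 0)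
    (hev : EigenvaluesOfForm A c π) :
    ∃ π' : n.Partition, π'.parts = consecutivePairs m ∧
      EigenvaluesOfForm A (2 * c) π' ∧
      HasMinimumExactlyOn A (C π) (suOrbit (stdSl2 π \ Z n) ∩ slOrbit A) ∧
      criticalSet A = (suOrbit (stdSl2 π \ Z n) ∩ slOrbit A) ∪
        (suOrbit (stdSl2 π' \ Z n) ∩ slOrbit A) ∧
      (suOrbit (stdSl2 π' \ Z n) ∩ slOrbit A).Nonempty ∧
      (∀ B ∈ suOrbit (stdSl2 π' \ Z n) ∩ slOrbit A, K B = C π') ∧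
      C π' = 4 * C π := by
  have h := sim_diagonal_weight_iff.2 ⟨hd, hev⟩
  have h0 := diagBlocks_eMat_ne_zero_of_sim hA h
  obtain ⟨π', hπ'⟩ := exists_partition_consecutivePairs hm
  have hp : ∀ p ∈ π.parts, p % 2 = 1 := fun p hp => by
    rw [hm] at hp
    obtain ⟨k, -, rfl⟩ := Multiset.mem_map.1 hp
    omega
  have hC := C_eq_four_mul hm hπ'
  have hCpos := C_pos h0
  have hev' : EigenvaluesOfForm A (2 * c) π' := by
    rw [EigenvaluesOfForm, hev, ← map_two_mul_bind_Lam_of_parts hm hπ', Multiset.map_map]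
    refine Multiset.map_congr rfl fun a _ => ?_
    simp only [Function.comp_apply]
    push_cast
    ring
  have h' := sim_diagonal_weight_iff.2 ⟨hd, hev'⟩
  have hle : ∀ B ∈ slOrbit A \ Z n, C π ≤ K B := fun B hB => C_le_K_of_emod htr hc h hp hB
  have hcrit : ∀ B ∈ criticalSet A, B ∈ (suOrbit (stdSl2 π \ Z n) ∩ slOrbit A) ∪
      (suOrbit (stdSl2 π' \ Z n) ∩ slOrbit A) := fun B hB => by
    obtain ⟨π₁, z, hz, hB', hs⟩ := exists_partition_of_mem_criticalSet htr hA (sim_ofReal_weight h) hB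
    rcases partition_eq_or_of_odd_parts hc hz hm (diagBlocks_eMat_ne_zero_iff.1 h0)
      (map_mul_eq_of_sim h hs) with rfl | h1
    · exact Or.inl hB'
    · rw [← hπ'] at h1
      rw [Nat.Partition.ext h1] at hB'
      exact Or.inr hB'
  refine ⟨π', hπ', hev', ?_, ?_, ?_, fun B hB => (K_eq_C_of_mem hB.1).1, hC⟩
  · refine hasMinimumExactlyOn_of_forall (nonempty_of_sim hc h0 h) (fun B hB => ?_) hle
      fun B hB hK => ?_
    · exact ⟨(mem_criticalSet_of_mem_suOrbit hB).1, (K_eq_C_of_mem hB.1).1⟩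
    · rcases hcrit B (mem_criticalSet_of_forall_le htr hB (by rwa [hK])) with h1 | h1
      · exact h1
      -- On the second family K = 4C_π, which is not the minimum value because C_π > 0.
      · have := (K_eq_C_of_mem h1.1).1
        linarith
  · exact Set.Subset.antisymm hcrit fun B hB =>
      hB.elim mem_criticalSet_of_mem_suOrbit mem_criticalSet_of_mem_suOrbit
  · exact nonempty_of_sim (mul_ne_zero two_ne_zero hc) (diagBlocks_eMat_ne_zero_of_sim hA h') h'

/-- Parts of both parities make 1 and 0 weights, so the smallest gap is 1 and the infimum is 1/∑w² =
C_π/4. A minimum point would be critical, but K = C_π at every critical point. -/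
theorem hasInfimum_of_not_even (htr : trace A = 0)
    (hA : ¬ ∃ c : ℂ, A = c • (1 : Matrix (Fin n) (Fin n) ℂ)) {π : n.Partition} {c : ℂ}
    (hodd : ¬ IsEvenPartition π)
    (hcp : ¬ ∃ m : Multiset ℕ, π.parts = consecutivePairs m) (hd : IsDiagonalizable A) (hc : c ≠ 0)
    (hev : EigenvaluesOfForm A c π) :
    HasInfimum A (C π / 4) ∧ ¬ AttainsMinimum A ∧
      criticalSet A = suOrbit (stdSl2 π \ Z n) ∩ slOrbit A ∧
      (suOrbit (stdSl2 π \ Z n) ∩ slOrbit A).Nonempty ∧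
      ∀ B ∈ suOrbit (stdSl2 π \ Z n) ∩ slOrbit A, K B = C π := by
  have h := sim_diagonal_weight_iff.2 ⟨hd, hev⟩
  have h0 := diagBlocks_eMat_ne_zero_of_sim hA h
  have hCpos := C_pos h0
  have hcrit : ∀ B ∈ criticalSet A, B ∈ suOrbit (stdSl2 π \ Z n) ∩ slOrbit A := fun B hB => by
    obtain ⟨π', z, hz, hB', hs⟩ := exists_partition_of_mem_criticalSet htr hA (sim_ofReal_weight h) hB
    rwa [partition_eq_of_not_even hc hz hodd hcp (map_mul_eq_of_sim h hs)] at hB'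
  have hK : ∀ B ∈ suOrbit (stdSl2 π \ Z n) ∩ slOrbit A, K B = C π :=
    fun B hB => (K_eq_C_of_mem hB.1).1
  have hinf : HasInfimum A (C π / 4) := by
    obtain ⟨i, hi⟩ : ∃ i, weight π i = 1 := by
      obtain ⟨p, hp, hpe⟩ : ∃ p ∈ π.parts, p % 2 = 0 := by
        by_contra hcon
        push Not at hcon
        refine hodd fun p hp q hq => ?_
        have := hcon p hp
        have := hcon q hq
        omega
      have h1 := one_mem_bind_Lam hp hpe
      rw [← map_weight] at h1
      obtain ⟨i, -, hi⟩ := Multiset.mem_map.1 h1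
      exact ⟨i, hi⟩
    obtain ⟨j, hj⟩ : ∃ j, weight π j = 0 := by
      obtain ⟨p, hp, hpe⟩ : ∃ p ∈ π.parts, p % 2 = 1 := by
        by_contra hcon
        push Not at hcon
        refine hodd fun p hp q hq => ?_
        have := hcon p hp
        have := hcon q hq
        omega
      have h1 := zero_mem_bind_Lam hp hpe
      rw [← map_weight] at h1
      obtain ⟨j, -, hj⟩ := Multiset.mem_map.1 h1
      exact ⟨j, hj⟩
    have h1 := hasInfimum_of_sim_diagonal htr hc (sim_ofReal_weight h) (i := i) (j := j)
      (by rw [hi, hj]; norm_num) (fun k l hkl => by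
        have h4 : weight π l < weight π k := by exact_mod_cast hkl
        have h5 : (1 : ℤ) ≤ weight π k - weight π l := by omega
        rw [hi, hj, Int.cast_one, Int.cast_zero, sub_zero, abs_one]
        exact_mod_cast h5)
    rw [hi, hj] at h1
    rw [C_eq, div_right_comm]
    simpa using h1
  refine ⟨hinf, ?_, Set.Subset.antisymm hcrit fun B => mem_criticalSet_of_mem_suOrbit,
    nonempty_of_sim hc h0 h, hK⟩
  rintro ⟨B, hB, hmin⟩
  have h1 := hK B (hcrit B ⟨hB, isCriticalPoint_of_isMinOn htr hB hmin⟩)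
  have h2 : K B ≤ C π / 4 := hinf.2 (by
    rintro _ ⟨B', hB', rfl⟩
    exact hmin hB')
  linarith

theorem hasInfimum_of_uniReal (htr : trace A = 0)
    (hA : ¬ ∃ c : ℂ, A = c • (1 : Matrix (Fin n) (Fin n) ℂ)) {lam : Fin n → ℂ}
    (hd : IsDiagonalizable A)
    (hev : HasEigenvalues A lam) (hu : UniReal lam)
    (hno : ¬ ∃ (c : ℂ) (π : n.Partition), c ≠ 0 ∧ EigenvaluesOfForm A c π) :
    (∃ δ : ℝ, IsLeast {r : ℝ | ∃ i j, lam i ≠ lam j ∧ r = ‖lam i - lam j‖ ^ 2} δ ∧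
      HasInfimum A (δ / ∑ i, ‖lam i‖ ^ 2)) ∧
      ¬ AttainsMinimum A ∧ criticalSet A = ∅ := by
  obtain ⟨c, r, hr⟩ := hu
  obtain rfl : lam = fun x => c * (r x : ℂ) := funext hr
  have h := sim_diagonal_iff.2 ⟨hd, hev⟩
  have hcrit : criticalSet A = ∅ := by
    rw [Set.eq_empty_iff_forall_notMem]
    intro B hB
    obtain ⟨π, z, hz, -, hs⟩ := exists_partition_of_mem_criticalSet htr hA h hB
    exact hno ⟨z, π, hz, (sim_diagonal_weight_iff.1 hs).2⟩
  have hc : c ≠ 0 := by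
    rintro rfl
    simp only [zero_mul] at h
    rw [diagonal_zero] at h
    exact hA h.eq_smul_one
  refine ⟨?_, ?_, hcrit⟩
  · have hne : ∃ i j, r i ≠ r j := by
      by_contra hcon
      push Not at hcon
      apply hA
      obtain ⟨P, Q, hPQ, rfl⟩ := h
      rcases isEmpty_or_nonempty (Fin n) with he | ⟨⟨i⟩⟩
      · exact ⟨0, Subsingleton.elim _ _⟩
      · refine ⟨c * r i, ?_⟩
        have : (diagonal fun x => c * (r x : ℂ)) = (c * (r i : ℂ)) • (1 : Matrix (Fin n) (Fin n) ℂ) := by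
          rw [smul_one_eq_diagonal]
          exact congrArg diagonal (funext fun x => by rw [hcon x i])
        rw [this, Matrix.mul_smul, Matrix.smul_mul, mul_one, hPQ]
    obtain ⟨i₀, j₀, h₀⟩ := hne
    obtain ⟨⟨i, j⟩, hij, hmin⟩ := Finset.exists_min_image
      (Finset.univ.filter fun p : Fin n × Fin n => r p.1 ≠ r p.2) (fun p => |r p.1 - r p.2|)
      ⟨(i₀, j₀), by simpa using h₀⟩
    have hij' : r i ≠ r j := (Finset.mem_filter.1 hij).2
    have hmin' : ∀ k l, r k ≠ r l → |r i - r j| ≤ |r k - r l| := fun k l hkl =>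
      hmin (k, l) (by simpa using hkl)
    have hn : ∀ k l, ‖c * (r k : ℂ) - c * (r l : ℂ)‖ ^ 2 = ‖c‖ ^ 2 * |r k - r l| ^ 2 := fun k l => by
      rw [← mul_sub, norm_mul, mul_pow, ← Complex.ofReal_sub, Complex.norm_real, Real.norm_eq_abs]
    refine ⟨‖c * (r i : ℂ) - c * (r j : ℂ)‖ ^ 2, ⟨⟨i, j, ?_, rfl⟩, ?_⟩, ?_⟩
    · simpa [hc] using hij'
    · rintro _ ⟨k, l, hkl, rfl⟩
      simp only [hn]
      have : r k ≠ r l := fun h' => hkl (by simp only [h'])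
      exact mul_le_mul_of_nonneg_left (pow_le_pow_left₀ (abs_nonneg _) (hmin' k l this) 2)
        (sq_nonneg _)
    · have h1 := hasInfimum_of_sim_diagonal htr hc h hij' fun k l hkl => by
        have := hmin' k l hkl.ne'
        rwa [abs_of_pos (sub_pos.2 hkl)] at this
      have h2 : ∑ x, ‖c * (r x : ℂ)‖ ^ 2 = ‖c‖ ^ 2 * ∑ x, r x ^ 2 := by
        rw [Finset.mul_sum]
        refine Finset.sum_congr rfl fun x _ => ?_
        rw [norm_mul, mul_pow, Complex.norm_real, Real.norm_eq_abs, sq_abs]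
      rw [hn, sq_abs, h2, mul_div_mul_left _ _ (pow_ne_zero 2 (norm_ne_zero_iff.2 hc))]
      exact h1
  · rintro ⟨B, hB, hmin⟩
    have : B ∈ criticalSet A := ⟨hB, isCriticalPoint_of_isMinOn htr hB hmin⟩
    rw [hcrit] at this
    exact this

theorem hasMinimum_of_isNilpotent (htr : trace A = 0)
    (hA : ¬ ∃ c : ℂ, A = c • (1 : Matrix (Fin n) (Fin n) ℂ)) {π : n.Partition}
    (hnil : IsNilpotent A) (hJ : HasJordanType A π) :
    HasMinimumExactlyOn A (C π) (suOrbit (stdSl2 π) ∩ slOrbit A) ∧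
      criticalSet A = suOrbit (stdSl2 π) ∩ slOrbit A := by
  have h := hJ.sim
  have hE := isTriple_diagBlocks_eMat π
  have h0 : diagBlocks π eMat ≠ 0 := fun h0 => hA (by rw [h0] at h; exact h.eq_smul_one)
  have hne : ∀ B, Sim A B → B ≠ 0 := by
    rintro B hB rfl
    exact hA hB.symm.eq_smul_one
  -- On a nonzero nilpotent orbit tr(B²) = 0, so the denominator is |B|⁴ > 0 and Z is never met.
  have hmem : ∀ B, Sim A B → B ∈ slOrbit A \ Z n := fun B hB => by
    refine mem_slOrbit_diff_Z_of_denom_pos hB ?_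
    rw [← hB.trace_mul_self_eq, ← h.trace_mul_self_eq, hE.trace_mul_self]
    have := normSq_pos (hne B hB)
    rw [norm_zero]
    nlinarith
  have hS : suOrbit (stdSl2 π) ∩ slOrbit A = suOrbit (stdSl2 π \ Z n) ∩ slOrbit A := by
    rw [suOrbit_diff_Z]
    ext B
    exact ⟨fun hB => ⟨⟨hB.1, (hmem B (mem_slOrbit_iff.1 hB.2)).2⟩, hB.2⟩, fun hB => ⟨hB.1.1, hB.2⟩⟩
  rw [hS]
  have hCpos := C_pos h0
  have hle : ∀ B ∈ slOrbit A \ Z n, C π ≤ K B := fun B hB =>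
    C_le_K_of_sim (h.trans (slOrbit.sim hB)) (hne B (slOrbit.sim hB))
  have hcrit : ∀ B ∈ criticalSet A, B ∈ suOrbit (stdSl2 π \ Z n) ∩ slOrbit A := fun B hB => by
    have hAB := slOrbit.sim hB.1
    rcases mom_eq_zero_or_exists_mem_of_mem_criticalSet htr hB with hm | ⟨π', hπ'⟩
    · have := hle B hB.1
      rw [(K_eq_zero_iff (denom_pos_of_mem htr hB.1)).2 hm] at this
      linarith
    · rcases sim_of_mem_suOrbit_stdSl2 hπ' with ⟨z, -, hs⟩ | hs
      · exact absurd hnil (not_isNilpotent_of_sim_diagonal hA (hs.trans hAB.symm))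
      · rw [partition_eq_of_sim (h.trans (hAB.trans hs.symm))]
        exact ⟨hπ', hB.1.1⟩
  refine ⟨hasMinimumExactlyOn_of_forall ?_ (fun B hB => ?_) hle fun B hB hK => ?_,
    Set.Subset.antisymm hcrit fun B => mem_criticalSet_of_mem_suOrbit⟩
  · rw [← hS]
    exact ⟨diagBlocks π eMat, mem_suOrbit_iff.2 ⟨_, mem_stdSl2_iff.2 ⟨1, 0, 0, by simp [tripleComb]⟩,
      USim.refl _⟩, mem_slOrbit_iff.2 h.symm⟩
  · exact ⟨(mem_criticalSet_of_mem_suOrbit hB).1, (K_eq_C_of_mem hB.1).1⟩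
  · exact hcrit B (mem_criticalSet_of_forall_le htr hB (by rwa [hK]))

/-- Both Jordan components are nonzero, so K can be made arbitrarily small. Critical points cannot
exist: normal matrices are diagonalizable, and elements of an sl(2) are diagonalizable or nilpotent.
-/
theorem hasInfimum_zero_of_not_diagonalizable (htr : trace A = 0) (hd : ¬ IsDiagonalizable A)
    (hnil : ¬ IsNilpotent A) :
    HasInfimum A 0 ∧ criticalSet A = ∅ := by
  constructor
  · refine ⟨?_, fun b hb => ?_⟩
    · rintro _ ⟨B, -, rfl⟩
      exact K_nonneg B
    · obtain ⟨d, N, hc, hN, hs⟩ := exists_sim_diagonal_add_nilpotent A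
      have hN0 : N ≠ 0 := by
        rintro rfl
        rw [add_zero] at hs
        exact hd (isDiagonalizable_iff.2 ⟨d, hs.symm⟩)
      have hd0 : diagonal d ≠ 0 := by
        intro h0
        rw [h0, zero_add] at hs
        exact hnil (hs.symm.isNilpotent hN)
      refine le_of_forall_pos_le_add fun η hη => ?_
      obtain ⟨B, hB, hD, hK⟩ := exists_K_le_of_commute hc hN hd0 hN0 hη
      rw [zero_add]
      exact (hb ⟨B, mem_slOrbit_diff_Z_of_denom_pos (hs.trans hB) hD, rfl⟩).trans hK
  · rw [Set.eq_empty_iff_forall_notMem]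
    intro B hB
    have hAB := slOrbit.sim hB.1
    rcases mom_eq_zero_or_exists_mem_of_mem_criticalSet htr hB with hm | ⟨π, hπ⟩
    · obtain ⟨d, hd'⟩ := isDiagonalizable_iff.1 (isDiagonalizable_of_mom_eq_zero hm)
      exact hd (isDiagonalizable_iff.2 ⟨d, hd'.trans hAB.symm⟩)
    · rcases sim_of_mem_suOrbit_stdSl2 hπ with ⟨z, -, hs⟩ | hs
      · exact hd (isDiagonalizable_iff.2 ⟨_, hs.trans hAB.symm⟩)
      · exact hnil ((hs.trans hAB.symm).isNilpotent (isNilpotent_diagBlocks_eMat π))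

/-- Equality in `|∑ λᵢ²| ≤ ∑ |λᵢ|²` forces the tuple to be uni-real. -/
theorem uniReal_of_norm_sum_sq {lam : Fin n → ℂ} (h : ‖∑ i, lam i ^ 2‖ = ∑ i, ‖lam i‖ ^ 2) :
    UniReal lam := by
  by_cases h0 : ∑ i, ‖lam i‖ ^ 2 = 0
  · refine ⟨0, fun _ => 0, fun i => ?_⟩
    have h1 := (Finset.sum_eq_zero_iff_of_nonneg fun k _ => sq_nonneg ‖lam k‖).1 h0 i
      (Finset.mem_univ _)
    simpa using h1
  have hτ0 : ∑ i, lam i ^ 2 ≠ 0 := by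
    rw [← norm_ne_zero_iff, h]
    exact h0
  set q := ∑ i, ‖lam i‖ ^ 2 with hq
  -- The unit scalar c removes the phase: then ∑(λ_i/c)² = ∑|λ_i/c|², and comparing real parts kills
  -- the imaginary parts of all λ_i/c.
  obtain ⟨c, hc⟩ := IsAlgClosed.exists_pow_nat_eq ((∑ i, lam i ^ 2) / q) (n := 2) two_pos
  have hqC : (q : ℂ) ≠ 0 := by exact_mod_cast h0
  have hq0 : 0 ≤ q := Finset.sum_nonneg fun k _ => sq_nonneg _
  have hc0 : c ≠ 0 := by
    rintro rfl
    rw [zero_pow two_ne_zero, eq_comm, div_eq_zero_iff] at hc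
    exact hc.elim hτ0 hqC
  have hcn : ‖c‖ = 1 := by
    have h1 := congrArg norm hc
    rw [norm_pow, norm_div, h, Complex.norm_real, Real.norm_eq_abs, abs_of_nonneg hq0,
      div_self h0] at h1
    exact (pow_eq_one_iff_of_nonneg (norm_nonneg _) two_ne_zero).1 h1
  have hsum : ∑ i, (lam i / c) ^ 2 = q := by
    simp only [div_pow]
    rw [← Finset.sum_div, hc]
    field_simp
  have him : ∑ i, 2 * (lam i / c).im ^ 2 = 0 := by
    have h1 : ∀ i, 2 * (lam i / c).im ^ 2 = ‖lam i‖ ^ 2 - ((lam i / c) ^ 2).re := fun i => by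
      have h2 : ‖lam i‖ = ‖lam i / c‖ := by rw [norm_div, hcn, div_one]
      rw [h2, ← Complex.normSq_eq_norm_sq, Complex.normSq_apply, sq (lam i / c), Complex.mul_re]
      ring
    simp only [h1]
    rw [Finset.sum_sub_distrib, ← Complex.re_sum, hsum, Complex.ofReal_re, sub_self]
  refine ⟨c, fun i => (lam i / c).re, fun i => ?_⟩
  have h1 := (Finset.sum_eq_zero_iff_of_nonneg fun k _ => by positivity).1 him i (Finset.mem_univ _)
  have h2 : (lam i / c).im = 0 := by simpa using h1
  have h3 : (((lam i / c).re : ℝ) : ℂ) = lam i / c := Complex.ext (by simp) (by simp [h2])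
  rw [h3, mul_div_cancel₀ _ hc0]

/-- The zeros of K on the orbit are its normal elements, and diag(λ) lies outside Z exactly because
equality in |∑λ_i²| ≤ ∑|λ_i|² would make λ uni-real. A standard critical point would do the same,
its eigenvalues being multiples of integer weights. -/
theorem hasMinimum_zero_of_not_uniReal (htr : trace A = 0)
    (hA : ¬ ∃ c : ℂ, A = c • (1 : Matrix (Fin n) (Fin n) ℂ)) {lam : Fin n → ℂ}
    (hd : IsDiagonalizable A) (hev : HasEigenvalues A lam) (hu : ¬ UniReal lam) :
    HasMinimumExactlyOn A 0 (suOrbit {diagonal lam}) ∧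
      criticalSet A = suOrbit {diagonal lam} := by
  have h := sim_diagonal_iff.2 ⟨hd, hev⟩
  have hmem : ∀ B, B ∈ suOrbit {diagonal lam} ↔ USim (diagonal lam) B := fun B => by
    rw [mem_suOrbit_iff]
    simp
  have hmom : mom (diagonal lam) = 0 := by
    rw [mom, diagonal_conjTranspose, diagonal_mul_diagonal, diagonal_mul_diagonal, sub_eq_zero]
    exact congrArg diagonal (funext fun i => mul_comm _ _)
  have hmomB : ∀ B, USim (diagonal lam) B → mom B = 0 := fun B hB => by
    rw [← normSq_eq_zero, ← hB.mom.normSq_eq, hmom, normSq_zero]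
  have hZ : diagonal lam ∉ Z n := by
    rintro ⟨-, hD⟩
    apply hu
    apply uniReal_of_norm_sum_sq
    rw [normSq_diagonal, diagonal_mul_diagonal, trace_diagonal, sub_eq_zero] at hD
    simp only [sq (lam _)]
    exact ((pow_left_inj₀ (Finset.sum_nonneg fun k _ => sq_nonneg _) (norm_nonneg _)
      two_ne_zero).1 hD).symm
  have horb : ∀ B, USim (diagonal lam) B → B ∈ slOrbit A \ Z n := fun B hB =>
    ⟨mem_slOrbit_iff.2 (h.symm.trans hB.sim), fun hBZ => hZ (hB.mem_Z_iff.2 hBZ)⟩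
  refine ⟨hasMinimumExactlyOn_of_forall ⟨diagonal lam, (hmem _).2 (USim.refl _)⟩ (fun B hB => ?_)
    (fun B _ => K_nonneg B) fun B hB hK => ?_, Set.Subset.antisymm (fun B hB => ?_) fun B hB => ?_⟩
  · have hB' := (hmem B).1 hB
    exact ⟨horb B hB', (K_eq_zero_iff (denom_pos_of_mem htr (horb B hB'))).2 (hmomB B hB')⟩
  · exact (hmem B).2 (usim_diagonal_of_mom_eq_zero (h.trans (slOrbit.sim hB))
      ((K_eq_zero_iff (denom_pos_of_mem htr hB)).1 hK))
  · have hAB := slOrbit.sim hB.1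
    rcases mom_eq_zero_or_exists_mem_of_mem_criticalSet htr hB with hm | ⟨π, hπ⟩
    · exact (hmem B).2 (usim_diagonal_of_mom_eq_zero (h.trans hAB) hm)
    · exfalso
      rcases sim_of_mem_suOrbit_stdSl2 hπ with ⟨z, -, hs⟩ | hs
      · apply hu
        have h1 := (sim_diagonal_iff.1 (hs.trans hAB.symm)).2
        rw [HasEigenvalues] at hev h1
        rw [hev] at h1
        obtain ⟨σ, hσ⟩ := exists_equiv_of_map_univ_eq h1
        exact ⟨z, fun i => weight π (σ i), fun i => by rw [hσ]; simp⟩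
      · exact not_isNilpotent_of_sim_diagonal hA h
          ((hs.trans hAB.symm).isNilpotent (isNilpotent_diagBlocks_eMat π))
  · have hB' := (hmem B).1 hB
    have h1 := horb B hB'
    exact ⟨h1, (isCriticalPoint_iff (denom_pos_of_mem htr h1)).2
      (gradK_eq_zero_of_mom_eq_zero (hmomB B hB'))⟩

end OrbitK

theorem mainTheorem3 (n : ℕ) (A : Matrix (Fin n) (Fin n) ℂ) (htr : Matrix.trace A = 0)
    (hA : ¬ ∃ c : ℂ, A = c • (1 : Matrix (Fin n) (Fin n) ℂ)) :
    -- (1) diagonalizable, not uni-real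
    (∀ lam : Fin n → ℂ, IsDiagonalizable A → HasEigenvalues A lam → ¬ UniReal lam →
      HasMinimumExactlyOn A 0 (suOrbit {Matrix.diagonal lam}) ∧
      criticalSet A = suOrbit {Matrix.diagonal lam}) ∧
    -- (2) diagonalizable, eigenvalues of the form c Λ_π with all parts of π odd
    (∀ (m : Multiset ℕ) (π : n.Partition) (c : ℂ), π.parts = m.map (fun k => 2 * k + 1) →
      IsDiagonalizable A → c ≠ 0 → EigenvaluesOfForm A c π →
      ∃ π' : n.Partition, π'.parts = consecutivePairs m ∧
        EigenvaluesOfForm A (2 * c) π' ∧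
        HasMinimumExactlyOn A (C π) (suOrbit (stdSl2 π \ Z n) ∩ slOrbit A) ∧
        criticalSet A = (suOrbit (stdSl2 π \ Z n) ∩ slOrbit A) ∪
          (suOrbit (stdSl2 π' \ Z n) ∩ slOrbit A) ∧
        (suOrbit (stdSl2 π' \ Z n) ∩ slOrbit A).Nonempty ∧
        (∀ B ∈ suOrbit (stdSl2 π' \ Z n) ∩ slOrbit A, K B = C π') ∧
        C π' = 4 * C π) ∧
    -- (3) diagonalizable, eigenvalues of the form c Λ_π with all parts of π even
    (∀ (m : Multiset ℕ) (π : n.Partition) (c : ℂ), π.parts = m.map (fun k => 2 * k) →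
      IsDiagonalizable A → c ≠ 0 → EigenvaluesOfForm A c π →
      HasMinimumExactlyOn A (C π) (suOrbit (stdSl2 π \ Z n) ∩ slOrbit A) ∧
      criticalSet A = suOrbit (stdSl2 π \ Z n) ∩ slOrbit A) ∧
    -- (4) diagonalizable, eigenvalues of the form c Λ_π with π odd, not a list of pairs m, m + 1
    (∀ (π : n.Partition) (c : ℂ), ¬ IsEvenPartition π →
      (¬ ∃ m : Multiset ℕ, π.parts = consecutivePairs m) →
      IsDiagonalizable A → c ≠ 0 → EigenvaluesOfForm A c π →
      HasInfimum A (C π / 4) ∧ ¬ AttainsMinimum A ∧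
      criticalSet A = suOrbit (stdSl2 π \ Z n) ∩ slOrbit A ∧
      (suOrbit (stdSl2 π \ Z n) ∩ slOrbit A).Nonempty ∧
      ∀ B ∈ suOrbit (stdSl2 π \ Z n) ∩ slOrbit A, K B = C π) ∧
    -- (5) diagonalizable, uni-real, eigenvalues not of the form c Λ_π
    (∀ lam : Fin n → ℂ, IsDiagonalizable A → HasEigenvalues A lam → UniReal lam →
      (¬ ∃ (c : ℂ) (π : n.Partition), c ≠ 0 ∧ EigenvaluesOfForm A c π) →
      (∃ δ : ℝ, IsLeast {r : ℝ | ∃ i j, lam i ≠ lam j ∧ r = ‖lam i - lam j‖ ^ 2} δ ∧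
        HasInfimum A (δ / ∑ i, ‖lam i‖ ^ 2)) ∧
      ¬ AttainsMinimum A ∧ criticalSet A = ∅) ∧
    -- (6) nilpotent of Jordan type π
    (∀ π : n.Partition, IsNilpotent A → HasJordanType A π →
      HasMinimumExactlyOn A (C π) (suOrbit (stdSl2 π) ∩ slOrbit A) ∧
      criticalSet A = suOrbit (stdSl2 π) ∩ slOrbit A) ∧
    -- (7) neither diagonalizable nor nilpotent
    (¬ IsDiagonalizable A → ¬ IsNilpotent A →
      HasInfimum A 0 ∧ criticalSet A = ∅) :=
  ⟨fun _ hd hev hu => hasMinimum_zero_of_not_uniReal htr hA hd hev hu,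
    fun _ _ _ hm hd hc hev => hasMinimum_of_odd_parts htr hA hm hd hc hev,
    fun _ _ _ hm hd hc hev => hasMinimum_of_even_parts htr hA hm hd hc hev,
    fun _ _ ho hcp hd hc hev => hasInfimum_of_not_even htr hA ho hcp hd hc hev,
    fun _ hd hev hu hno => hasInfimum_of_uniReal htr hA hd hev hu hno,
    fun _ hnil hJ => hasMinimum_of_isNilpotent htr hA hnil hJ,
    fun hd hnil => hasInfimum_zero_of_not_diagonalizable htr hd hnil⟩
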